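/- Write $dA=d^2z/\pi$, $\bar\partial=\frac12(\partial_x+i\partial_y)$, $\Delta=\partial\bar\partial=\frac14(\partial_x^2+\partial_y^2)$. Let $Q:\mathbb C\to\mathbb R\cup\{+\infty\}$ be lower semicontinuous, finite on some set of positive logarithmic capacity, with $\liminf_{\zeta\to\infty}Q(\zeta)/\log|\zeta|>2$. Let $\sigma$ be its equilibrium measure, i.e. the minimizer of $I_Q[\mu]=\iint\log\frac1{|\zeta-\eta|}\,d\mu(\zeta)\,d\mu(\eta)+\int Q\,d\mu$ among compactly supported Borel probability measures on $\mathbb C$, and let $S=\operatorname{supp}\sigma$. Assume that $Q$ is finite and real analytic with $\Delta Q>0$ in some neighbourhood of $S$. Let $\mathbf K_n(\zeta,\eta)=\sum_{j=0}^{n-1}q_j(\zeta)\overline{q_j(\eta)}\,e^{-nQ(\zeta)/2-nQ(\eta)/2}$, where $q_j$ is the $j$-th orthonormal polynomial with respect to $e^{-nQ}dA$. Let $p_n\in S$ and $\theta_n\in\mathbb R$ be arbitrary sequences, and put $K_n(z,w)=\frac1{n\Delta Q(p_n)}\mathbf K_n(\zeta,\eta)$ with $z=e^{-i\theta_n}\sqrt{n\Delta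 Q(p_n)}(\zeta-p_n)$ and $w=e^{-i\theta_n}\sqrt{n\Delta Q(p_n)}(\eta-p_n)$. A function $f:\mathbb C^2\to\mathbb C$ is Hermitian if it is continuous and $f(z,w)=\overline{f(w,z)}$; it is Hermitian-entire if moreover it is entire as a function of $z$ and $\bar w$. A cocycle is a Hermitian function $c$ with $c(z_1,z_2)c(z_2,z_3)\cdots c(z_k,z_1)=1$ for all finite sequences $z_1,\dots,z_k$, $k\ge1$. Let $G(z,w)=e^{z\bar w-|z|^2/2-|w|^2/2}$. A limiting kernel is a limit $K$, uniform on compact subsets of $\mathbb C^2$, of a subsequence of $(c_nK_n)$ for some sequence of cocycles $c_n$, of the form $K=G\Psi$ with $\Psi$ Hermitian-entire. Let $K=G\Psi$ be a limiting kernel, and write $R(z)=K(z,z)=\Psi(z,z)$, $B(z,w)=|K(z,w)|^2/R(z)$ and $C(z)=\int_{\mathbb C}\frac{B(z,w)}{z-w}\,dA(w)$. Then: (i) Zero-one law: either $R(z)=0$ for all $z\in\mathbb C$, or $R(z)>0$ for all $z\in\mathbb C$. (ii) Ward's equation: if $R$ does not vanish identically, then for every $z\in\mathbb C$ the integral $C(z)$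 converges absolutely, $C$ is a $C^\infty$ function on $\mathbb C$, and $\bar\partial C(z)=R(z)-1-\Delta\log R(z)$ for all $z\in\mathbb C$. (iii) Complementarity: the kernel $\tilde K(z,w)=G(z,w)(1-\Psi(z,w))$ is a positive matrix, i.e. $\sum_{j,k=1}^N\alpha_j\bar\alpha_k\tilde K(z_j,z_k)\ge0$ for all $N$, $z_j\in\mathbb C$, $\alpha_j\in\mathbb C$. In particular $R(z)=\Psi(z,z)\le1$ for all $z\in\mathbb C$. -/

import Mathlib

open MeasureTheory Filter Topology
open scoped ENNReal ContDiff ComplexConjugate ComplexOrder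

noncomputable section

namespace RNM

/-! ### Conventions: normalized area, complex derivatives, normalized Laplacian -/

/-- Normalized Lebesgue measure `dA = d²z / π`. -/
def dA : Measure ℂ := ENNReal.ofReal (Real.pi⁻¹) • volume

/-- The operator `∂̄ = (∂/∂x + i ∂/∂y) / 2`. -/
def dbar (f : ℂ → ℂ) (z : ℂ) : ℂ :=
  (1 / 2) * (fderiv ℝ f z 1 + Complex.I * fderiv ℝ f z Complex.I)

/-- The normalized Laplacian `∂∂̄`, a quarter of the standard one. -/
def lap (f : ℂ → ℝ) (z : ℂ) : ℝ := (1 / 4) * Laplacian.laplacian f z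

/-! ### Weighted potential theory -/

/-- The integral, as an extended real number, of an extended-real valued function whose negative
part has finite integral. -/
def eintegral {α : Type*} [MeasurableSpace α] (μ : Measure α) (f : α → EReal) : EReal :=
  ((∫⁻ x, (f x).toENNReal ∂μ : ℝ≥0∞) : EReal) - ((∫⁻ x, (-f x).toENNReal ∂μ : ℝ≥0∞) : EReal)

/-- Probability measures on `ℂ` that live on a compact set. -/
def IsCompactProb (μ : Measure ℂ) : Prop :=
  IsProbabilityMeasure μ ∧ ∃ E : Set ℂ, IsCompact E ∧ μ Eᶜ = 0

/-- The logarithmic energy `∬ log (1 / |ζ - η|) dμ(ζ) dμ(η)`; the integrand is `+∞` on the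
diagonal. -/
def logEnergy (μ : Measure ℂ) : EReal :=
  eintegral (μ.prod μ) (fun x => -ENNReal.log (edist x.1 x.2))

/-- The weighted logarithmic energy `I_Q[μ]`. -/
def weightedEnergy (Q : ℂ → EReal) (μ : Measure ℂ) : EReal :=
  logEnergy μ + eintegral μ Q

/-- Positive (inner) logarithmic capacity: some compact subset carries a probability measure of
finite logarithmic energy. -/
def HasPosLogCapacity (E : Set ℂ) : Prop :=
  ∃ K : Set ℂ, IsCompact K ∧ K ⊆ E ∧
    ∃ μ : Measure ℂ, IsProbabilityMeasure μ ∧ μ Kᶜ = 0 ∧ logEnergy μ < ⊤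

/-- External potentials `Q : ℂ → ℝ ∪ {+∞}`: lower semicontinuous, finite on a set of positive
capacity, and with `liminf Q(ζ) / log |ζ| > 2` at infinity. -/
structure IsPotential (Q : ℂ → EReal) : Prop where
  ne_bot : ∀ ζ, Q ζ ≠ ⊥
  lsc : LowerSemicontinuous Q
  cap : HasPosLogCapacity {ζ | Q ζ < ⊤}
  growth : (2 : EReal) < liminf (fun ζ => Q ζ / ((Real.log ‖ζ‖ : ℝ) : EReal)) (cocompact ℂ)

/-- `σ` is the equilibrium measure in the external field `Q`. The droplet is `σ.support`. -/
def IsEquilibriumMeasure (Q : ℂ → EReal) (σ : Measure ℂ) : Prop :=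
  IsCompactProb σ ∧ ∀ μ : Measure ℂ, IsCompactProb μ → weightedEnergy Q σ ≤ weightedEnergy Q μ

/-- In some neighbourhood of `S` the potential is (finite and) real analytic with `∂∂̄Q > 0`. -/
def IsRegularNear (Q : ℂ → EReal) (S : Set ℂ) : Prop :=
  ∃ N : Set ℂ, IsOpen N ∧ S ⊆ N ∧ (∀ ζ ∈ N, Q ζ ≠ ⊤) ∧
    AnalyticOnNhd ℝ (fun ζ => (Q ζ).toReal) N ∧ ∀ ζ ∈ N, 0 < lap (fun ζ => (Q ζ).toReal) ζ

/-! ### Orthonormal polynomials and correlation kernels -/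

/-- The weight `e^{-tQ(ζ)}`, for `t > 0`; it vanishes where `Q = +∞`. -/
def weight (Q : ℂ → EReal) (t : ℝ) (ζ : ℂ) : ℝ :=
  if Q ζ = ⊤ then 0 else Real.exp (-(t * (Q ζ).toReal))

/-- The inner product of polynomials in `L²(e^{-nQ} dA)`. -/
def polyInner (Q : ℂ → EReal) (n : ℕ) (p q : Polynomial ℂ) : ℂ :=
  ∫ ζ, p.eval ζ * conj (q.eval ζ) * (weight Q n ζ : ℂ) ∂dA

/-- The `j`-th monic orthogonal polynomial with respect to `e^{-nQ} dA`. -/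
def monicOrtho (Q : ℂ → EReal) (n : ℕ) (j : ℕ) : Polynomial ℂ :=
  Polynomial.X ^ j - ∑ k : Fin j,
    Polynomial.C (polyInner Q n (Polynomial.X ^ j) (monicOrtho Q n k) /
      polyInner Q n (monicOrtho Q n k) (monicOrtho Q n k)) * monicOrtho Q n k
termination_by j
decreasing_by all_goals exact k.2

/-- The `j`-th orthonormal polynomial with respect to `e^{-nQ} dA`. -/
def orthoPoly (Q : ℂ → EReal) (n : ℕ) (j : ℕ) : Polynomial ℂ :=
  Polynomial.C (((Real.sqrt (polyInner Q n (monicOrtho Q n j) (monicOrtho Q n j)).re)⁻¹ : ℝ) : ℂ) *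
    monicOrtho Q n j

/-- The correlation kernel of the `n`-point process of `Q`: the reproducing kernel of the space of
weighted polynomials `q e^{-nQ/2}`, `deg q ≤ n - 1`, in `L²(dA)`. -/
def corrKernel (Q : ℂ → EReal) (n : ℕ) (ζ η : ℂ) : ℂ :=
  ∑ j ∈ Finset.range n, (orthoPoly Q n j).eval ζ * conj ((orthoPoly Q n j).eval η) *
    (weight Q (n / 2) ζ : ℂ) * (weight Q (n / 2) η : ℂ)

/-- The point `ζ` with `z = e^{-iθ} √(n ∂∂̄Q(p)) (ζ - p)`. -/
def unscale (Q : ℂ → EReal) (n : ℕ) (p : ℂ) (θ : ℝ) (z : ℂ) : ℂ :=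
  p + Complex.exp (θ * Complex.I) * z / (Real.sqrt (n * lap (fun ζ => (Q ζ).toReal) p) : ℂ)

/-- The correlation kernel `K_n` of the process rescaled about `p` in the direction `e^{iθ}`. -/
def rescaledKernel (Q : ℂ → EReal) (n : ℕ) (p : ℂ) (θ : ℝ) (z w : ℂ) : ℂ :=
  (1 / (n * lap (fun ζ => (Q ζ).toReal) p : ℝ) : ℂ) *
    corrKernel Q n (unscale Q n p θ z) (unscale Q n p θ w)

/-! ### Hermitian functions, cocycles, limiting kernels -/

/-- Continuous Hermitian functions on `ℂ²`. -/
def IsHermitianFun (f : ℂ → ℂ → ℂ) : Prop :=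
  Continuous (Function.uncurry f) ∧ ∀ z w, f z w = conj (f w z)

/-- Hermitian functions that are entire as functions of `z` and `w̄`. -/
def IsHermitianEntire (f : ℂ → ℂ → ℂ) : Prop :=
  IsHermitianFun f ∧ Differentiable ℂ (fun x : ℂ × ℂ => f x.1 (conj x.2))

/-- Cocycles: Hermitian functions whose product around every finite cycle
`z₀ → z₁ → ⋯ → z_k → z₀` is `1`; the addition in `Fin (k + 1)` is cyclic. -/
def IsCocycle (c : ℂ → ℂ → ℂ) : Prop :=
  IsHermitianFun c ∧ ∀ (k : ℕ) (z : Fin (k + 1) → ℂ), ∏ j, c (z j) (z (j + 1)) = 1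

/-- The Ginibre kernel. -/
def ginibre (z w : ℂ) : ℂ :=
  Complex.exp (z * conj w - (‖z‖ : ℂ) ^ 2 / 2 - (‖w‖ : ℂ) ^ 2 / 2)

/-- `K` is a limit point, for uniform convergence on compact sets, of the kernels `c_n K_n` rescaled
about the moving point `p` with angles `θ`, for some sequence of cocycles `c_n`. A limiting kernel is
a limit point normalized to the form `K = GΨ` with `Ψ` Hermitian-entire; since a Hermitian-entire
function is determined by its diagonal values, this removes the freedom in the choice of the
cocycles. -/
def IsLimitPoint (Q : ℂ → EReal) (p : ℕ → ℂ) (θ : ℕ → ℝ) (K : ℂ → ℂ → ℂ) : Prop :=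
  ∃ c : ℕ → ℂ → ℂ → ℂ, (∀ n, IsCocycle (c n)) ∧ ∃ φ : ℕ → ℕ, StrictMono φ ∧
    TendstoLocallyUniformly
      (fun (k : ℕ) (x : ℂ × ℂ) =>
        c (φ k) x.1 x.2 * rescaledKernel Q (φ k) (p (φ k)) (θ (φ k)) x.1 x.2)
      (fun x : ℂ × ℂ => K x.1 x.2) atTop

/-- Positive matrices in Aronszajn's sense. -/
def IsPositiveMatrix (K : ℂ → ℂ → ℂ) : Prop :=
  ∀ (N : ℕ) (z α : Fin N → ℂ), 0 ≤ ∑ j, ∑ k, α j * conj (α k) * K (z j) (z k)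

/-- The one-point function `R(z) = K(z,z)` (which is real for Hermitian `K`). -/
def onePoint (K : ℂ → ℂ → ℂ) (z : ℂ) : ℝ := (K z z).re

/-- The Berezin kernel `B(z,w) = |K(z,w)|² / K(z,z)`. -/
def berezin (K : ℂ → ℂ → ℂ) (z w : ℂ) : ℝ := ‖K z w‖ ^ 2 / onePoint K z

/-- The Cauchy transform `C(z) = ∫ B(z,w) / (z - w) dA(w)`. -/
def cauchyTransform (K : ℂ → ℂ → ℂ) (z : ℂ) : ℂ :=
  ∫ w, (berezin K z w : ℂ) / (z - w) ∂dA

end RNM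

end

/-! Cocycles have the form $u(z)\overline{u(w)}$ with $|u|=1$. Up to phases the rescaled kernels are
therefore weighted kernels of orthonormal polynomials, and everything follows by passing to the
limit in two exact identities: the reproducing property and Ward's identity.

Complementarity. For finite $n$, the squared norm of $\sum_l\bar\alpha_l K_n(\cdot,z_l)$ equals the
quadratic form of $K_n$. Fatou's lemma (`integrable_combination_of_tendsto`) keeps an inequality
$\|f\|^2\le q_K$ for $f=\sum_l\bar\alpha_l K(\cdot,z_l)$. Since $K=G\Psi$, $f$ lies in the Fock
space, where $G$ reproduces: with $g=\sum_l\bar\alpha_l G(\cdot,z_l)$ one has $\langle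
f,g\rangle=q_K$ and $\|g\|^2=q_G$. Hence $0\le\|f-g\|^2\le q_G-q_K$ (`quadForm_le_ginibre`). In
particular $R\le1$, which makes the densities $R_n$ eventually bounded on compact sets.

Ward's equation. Divided differences and orthogonality give $\partial\log
k_n(z,z)=\int\frac{R_n(w)-B_n(z,w)}{z-w}dA(w)$ (`OrthoSystem.del_log_kernel`). With weight
$e^{-V_n}$, $\partial\log R_n$ equals this minus $\partial V_n$, and $\partial V_n$ is $\bar z$ plus
an entire function plus $o(1)$, by expanding $Q$ at the base point. Nothing is known about $R_n$ far
away, but its distant part has a Cauchy transform holomorphic near a given point $a$. So near $a$,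
$\partial\log R_n=T_n+h_n$ with $h_n$ holomorphic and $T_n$ bounded, convergent where $R>0$. Testing
against a radial bump bounds $h_n$ by $\log R_n$ and $T_n$ (`exists_holomorphic_part_bound`). If
$R>0$, the $h_n$ converge, and $\bar\partial$ of the limiting identity is Ward's equation.

Zero-one law. If $R(b)\ne0$, then $\Psi(\cdot,b)$ is entire and not zero, and $|K(w,b)|^2\le
R(w)R(b)$ forces $R>0$ off its isolated zeros. On a small circle around such a zero $h_n$ is
bounded; by the maximum principle it is bounded inside too. As $T_n$ is bounded without any
positivity, $\log R_n$ has bounded gradient in the disc, so $R$ is positive at the centre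
(`IsLimitSystem.onePoint_pos_of_sphere`). -/

namespace RNM

open Polynomial

/-! ### Systems of orthonormal polynomials -/

/-- Polynomials `f 0, …, f (n - 1)` with `deg f j = j`, orthonormal in `L²(W dA)`. -/
structure OrthoSystem (n : ℕ) (W : ℂ → ℝ) (f : ℕ → ℂ[X]) : Prop where
  nonneg : ∀ z, 0 ≤ W z
  meas : Measurable W
  integrable : ∀ p q : ℂ[X], p.degree < n → q.degree < n →
    Integrable (fun z => p.eval z * conj (q.eval z) * (W z : ℂ)) dA
  degree : ∀ j < n, (f j).degree = j
  ortho : ∀ i < n, ∀ j < n,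
    ∫ z, (f i).eval z * conj ((f j).eval z) * (W z : ℂ) ∂dA = if i = j then 1 else 0

/-- The polynomial kernel `∑ f_j(z) conj (f_j(w))`. -/
noncomputable def polyKernel (n : ℕ) (f : ℕ → ℂ[X]) (z w : ℂ) : ℂ :=
  ∑ j ∈ Finset.range n, (f j).eval z * conj ((f j).eval w)

/-- The polynomial `w ↦ polyKernel n f w z`. -/
noncomputable def kernelPoly (n : ℕ) (f : ℕ → ℂ[X]) (z : ℂ) : ℂ[X] :=
  ∑ j ∈ Finset.range n, C (conj ((f j).eval z)) * f j

lemma eval_kernelPoly (n : ℕ) (f : ℕ → ℂ[X]) (z w : ℂ) :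
    (kernelPoly n f z).eval w = polyKernel n f w z := by
  simp [kernelPoly, polyKernel, eval_finsetSum, mul_comm]

lemma polyKernel_conj (n : ℕ) (f : ℕ → ℂ[X]) (z w : ℂ) :
    conj (polyKernel n f z w) = polyKernel n f w z := by
  simp [polyKernel, mul_comm]

lemma polyKernel_self (n : ℕ) (f : ℕ → ℂ[X]) (z : ℂ) :
    polyKernel n f z z = ((∑ j ∈ Finset.range n, ‖(f j).eval z‖ ^ 2 : ℝ) : ℂ) := by
  simp [polyKernel, Complex.mul_conj, Complex.normSq_eq_norm_sq]

lemma norm_polyKernel_sq_le (n : ℕ) (f : ℕ → ℂ[X]) (z w : ℂ) :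
    ‖polyKernel n f z w‖ ^ 2 ≤ (polyKernel n f z z).re * (polyKernel n f w w).re := by
  rw [polyKernel_self, polyKernel_self, Complex.ofReal_re, Complex.ofReal_re]
  have h1 : ‖polyKernel n f z w‖ ≤
      ∑ j ∈ Finset.range n, ‖(f j).eval z‖ * ‖(f j).eval w‖ := by
    refine (norm_sum_le _ _).trans (le_of_eq ?_)
    simp
  calc ‖polyKernel n f z w‖ ^ 2
      ≤ (∑ j ∈ Finset.range n, ‖(f j).eval z‖ * ‖(f j).eval w‖) ^ 2 := by gcongr
    _ ≤ _ := Finset.sum_mul_sq_le_sq_mul_sq _ _ _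

/-- The divided difference of `p` at `z`. -/
lemma eval_divByMonic (p : ℂ[X]) (z w : ℂ) :
    (w - z) * (p /ₘ (X - C z)).eval w = p.eval w - p.eval z := by
  have h := congrArg (eval w) (modByMonic_add_div p (X - C z))
  simp only [modByMonic_X_sub_C_eq_C_eval, eval_add, eval_C, eval_mul, eval_sub, eval_X] at h
  linear_combination h

lemma eval_self_divByMonic (p : ℂ[X]) (z : ℂ) :
    (p /ₘ (X - C z)).eval z = (derivative p).eval z := by
  have h := congrArg (eval z)
    (divByMonic_add_X_sub_C_mul_derivative_divByMonic_eq_derivative (f := p) (a := z))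
  simpa using h

lemma degree_divByMonic_lt' {p : ℂ[X]} {m : ℕ} (h : p.degree = m) (z : ℂ) :
    (p /ₘ (X - C z)).degree < m := by
  rw [← h]
  apply degree_divByMonic_lt
  · rintro rfl
    simp at h
  · rw [degree_X_sub_C]; norm_num

/-! ### Expansions, the reproducing property and Ward's identity for an orthonormal system. -/

namespace OrthoSystem

variable {n : ℕ} {W : ℂ → ℝ} {f : ℕ → ℂ[X]}

lemma degree_lt (S : OrthoSystem n W f) {j : ℕ} (hj : j < n) : (f j).degree < n := by
  rw [S.degree j hj]; exact_mod_cast hj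

/-- The system is triangular: subtracting the multiple of `f m` that matches the coefficient of
degree `m` lowers the degree. The intermediate levels `m ≤ n` give orthogonality of `f j` to lower
degrees, and `m = n` gives the reproducing property. -/
lemma exists_repr (S : OrthoSystem n W f) (m : ℕ) (hm : m ≤ n) (p : ℂ[X]) (hp : p.degree < m) :
    ∃ c : ℕ → ℂ, p = ∑ j ∈ Finset.range m, C (c j) * f j := by
  induction m generalizing p with
  | zero =>
    refine ⟨0, ?_⟩
    have : p = 0 := by
      rw [← degree_eq_bot]
      by_contra h
      rw [degree_eq_natDegree (by simpa using h)] at hp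
      exact absurd hp (by simp)
    simpa using this
  | succ m ih =>
    have hd := S.degree m (by omega)
    have hf0 : (f m).leadingCoeff ≠ 0 := by
      rw [leadingCoeff_ne_zero]; rintro h; rw [h] at hd; simp at hd
    have hn : (f m).natDegree = m := natDegree_eq_of_degree_eq_some hd
    set a := p.coeff m / (f m).leadingCoeff with ha
    have hlt : (p - C a * f m).degree < m := by
      rw [degree_lt_iff_coeff_zero]
      intro k hk
      rcases eq_or_lt_of_le hk with rfl | hk
      · have : (f m).coeff m = (f m).leadingCoeff := by rw [leadingCoeff, hn]
        rw [coeff_sub, coeff_C_mul, this, ha]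
        field_simp; ring
      · rw [coeff_sub, coeff_C_mul, coeff_eq_zero_of_degree_lt (p := p),
          coeff_eq_zero_of_degree_lt (p := f m)]
        · simp
        · rw [hd]; exact_mod_cast hk
        · refine lt_of_lt_of_le hp ?_; exact_mod_cast hk
    obtain ⟨c, hc⟩ := ih (by omega) _ hlt
    refine ⟨fun j => if j = m then a else c j, ?_⟩
    rw [Finset.sum_range_succ]
    simp only [if_true]
    have : ∑ j ∈ Finset.range m, C (if j = m then a else c j) * f j =
        ∑ j ∈ Finset.range m, C (c j) * f j := by
      refine Finset.sum_congr rfl fun j hj => ?_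
      rw [if_neg (by have := Finset.mem_range.1 hj; omega)]
    rw [this, ← hc]; ring

lemma integral_repr (S : OrthoSystem n W f) (m : ℕ) (hm : m ≤ n) (c : ℕ → ℂ) (j : ℕ) (hj : j < n) :
    ∫ z, (∑ i ∈ Finset.range m, C (c i) * f i).eval z * conj ((f j).eval z) * (W z : ℂ) ∂dA =
      if j < m then c j else 0 := by
  have h1 : ∀ z, (∑ i ∈ Finset.range m, C (c i) * f i).eval z * conj ((f j).eval z) * (W z : ℂ) =
      ∑ i ∈ Finset.range m, c i * ((f i).eval z * conj ((f j).eval z) * (W z : ℂ)) := by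
    intro z
    simp only [eval_finsetSum, eval_mul, eval_C, Finset.sum_mul]
    exact Finset.sum_congr rfl fun i _ => by ring
  simp_rw [h1]
  rw [integral_finsetSum]
  · simp_rw [integral_const_mul]
    rw [Finset.sum_congr rfl (g := fun i => if i = j then c j else 0)]
    · simp
    · intro i hi
      have := Finset.mem_range.1 hi
      rw [S.ortho i (by omega) j hj]
      split_ifs with h <;> simp [h]
  · intro i hi
    have := Finset.mem_range.1 hi
    exact (S.integrable _ _ (S.degree_lt (by omega)) (S.degree_lt hj)).const_mul _

lemma integral_eq_zero (S : OrthoSystem n W f) {p : ℂ[X]} {j : ℕ} (hj : j < n) (hp : p.degree < j) :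
    ∫ z, p.eval z * conj ((f j).eval z) * (W z : ℂ) ∂dA = 0 := by
  obtain ⟨c, rfl⟩ := S.exists_repr j hj.le p hp
  rw [S.integral_repr j hj.le c j hj, if_neg (lt_irrefl j)]

lemma reproducing (S : OrthoSystem n W f) {p : ℂ[X]} (hp : p.degree < n) (x : ℂ) :
    ∑ j ∈ Finset.range n, (f j).eval x *
      ∫ z, p.eval z * conj ((f j).eval z) * (W z : ℂ) ∂dA = p.eval x := by
  obtain ⟨c, rfl⟩ := S.exists_repr n le_rfl p hp
  rw [eval_finsetSum]
  refine Finset.sum_congr rfl fun j hj => ?_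
  rw [S.integral_repr n le_rfl c j (Finset.mem_range.1 hj), if_pos (Finset.mem_range.1 hj)]
  simp [mul_comm]

lemma degree_kernelPoly_lt (S : OrthoSystem n W f) (z : ℂ) : (kernelPoly n f z).degree < n := by
  refine (degree_sum_le _ _).trans_lt ?_
  rw [Finset.sup_lt_iff (by exact_mod_cast WithBot.bot_lt_coe n)]
  intro j hj
  refine (degree_mul_le _ _).trans_lt ?_
  refine lt_of_le_of_lt (add_le_add_left degree_C_le _) ?_
  rw [zero_add]
  exact S.degree_lt (Finset.mem_range.1 hj)

lemma kernel_pos (S : OrthoSystem n W f) (hn : 0 < n) (z : ℂ) : 0 < (polyKernel n f z z).re := by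
  rw [polyKernel_self, Complex.ofReal_re]
  refine Finset.sum_pos' (fun _ _ => by positivity) ⟨0, by simpa using hn, ?_⟩
  have h := S.degree 0 hn
  have hC : f 0 = C ((f 0).coeff 0) := eq_C_of_degree_eq_zero (by simpa using h)
  have : (f 0).coeff 0 ≠ 0 := by
    intro h0
    rw [hC, h0] at h
    simp at h
  rw [hC, eval_C]
  positivity

/-- Ward's identity for the kernel of an orthonormal system. -/
lemma ward (S : OrthoSystem n W f) (z : ℂ) :
    ∫ w, (polyKernel n f z z * polyKernel n f w w - polyKernel n f z w * polyKernel n f w z) /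
      (z - w) * (W w : ℂ) ∂dA =
      ∑ j ∈ Finset.range n, (derivative (f j)).eval z * conj ((f j).eval z) := by
  set κ := kernelPoly n f z
  have hκ : (κ /ₘ (X - C z)).degree < n := by
    refine lt_of_le_of_lt (degree_divByMonic_le _ _) (S.degree_kernelPoly_lt z)
  have hd : ∀ j ∈ Finset.range n, (f j /ₘ (X - C z)).degree < n := fun j hj =>
    lt_of_le_of_lt (degree_divByMonic_le _ _) (S.degree_lt (Finset.mem_range.1 hj))
  have hne : ∀ᵐ w ∂dA, w ≠ z := by
    have : ∀ᵐ w ∂(volume : Measure ℂ), w ≠ z := by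
      simp [ae_iff]
    exact Measure.ae_smul_measure this _
  -- Write $Dp(w)=(p(z)-p(w))/(z-w)$ and $\kappa=k(\cdot,z)$. Adding and subtracting $k(z,z)f_j(z)$
  -- in the $j$-th numerator turns the summand into
  -- $(-k(z,z)\,Df_j+f_j(z)\,D\kappa)\,\overline{f_j}$, which has polynomial factors only.
  have h1 : ∀ᵐ w ∂dA, (polyKernel n f z z * polyKernel n f w w -
      polyKernel n f z w * polyKernel n f w z) / (z - w) * (W w : ℂ) =
      ∑ j ∈ Finset.range n, (-polyKernel n f z z *
        ((f j /ₘ (X - C z)).eval w * conj ((f j).eval w) * (W w : ℂ)) +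
        (f j).eval z * ((κ /ₘ (X - C z)).eval w * conj ((f j).eval w) * (W w : ℂ))) := by
    filter_upwards [hne] with w hw
    have hzw : z - w ≠ 0 := sub_ne_zero.2 (Ne.symm hw)
    have e1 : ∀ p : ℂ[X], (p /ₘ (X - C z)).eval w = (p.eval z - p.eval w) / (z - w) := by
      intro p
      rw [eq_div_iff hzw]
      linear_combination -eval_divByMonic p z w
    simp_rw [e1, κ, eval_kernelPoly]
    have e2 : polyKernel n f w w = ∑ j ∈ Finset.range n, (f j).eval w * conj ((f j).eval w) := rfl
    have e3 : polyKernel n f z w = ∑ j ∈ Finset.range n, (f j).eval z * conj ((f j).eval w) := rfl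
    rw [e2, e3, Finset.mul_sum, Finset.sum_mul, ← Finset.sum_sub_distrib, Finset.sum_div,
      Finset.sum_mul]
    refine Finset.sum_congr rfl fun j _ => ?_
    field_simp
    ring
  rw [integral_congr_ae h1, integral_finsetSum]
  -- $Df_j$ has degree below $j$, so it is orthogonal to $f_j$ and drops out. The other terms sum,
  -- by the reproducing property, to $D\kappa(z)=\kappa'(z)$.
  · have h2 : ∀ j ∈ Finset.range n, ∫ w, (-polyKernel n f z z *
        ((f j /ₘ (X - C z)).eval w * conj ((f j).eval w) * (W w : ℂ)) +
        (f j).eval z * ((κ /ₘ (X - C z)).eval w * conj ((f j).eval w) * (W w : ℂ))) ∂dA =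
        (f j).eval z * ∫ w, (κ /ₘ (X - C z)).eval w * conj ((f j).eval w) * (W w : ℂ) ∂dA := by
      intro j hj
      have hj' := Finset.mem_range.1 hj
      rw [integral_add, integral_const_mul, integral_const_mul,
        S.integral_eq_zero hj' (degree_divByMonic_lt' (S.degree j hj') z)]
      · simp
      · exact (S.integrable _ _ (hd j hj) (S.degree_lt hj')).const_mul _
      · exact (S.integrable _ _ hκ (S.degree_lt hj')).const_mul _
    rw [Finset.sum_congr rfl h2, S.reproducing hκ, eval_self_divByMonic]
    simp [κ, kernelPoly, eval_finsetSum, mul_comm]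
  · intro j hj
    have hj' := Finset.mem_range.1 hj
    exact ((S.integrable _ _ (hd j hj) (S.degree_lt hj')).const_mul _).add
      ((S.integrable _ _ hκ (S.degree_lt hj')).const_mul _)

/-- The reproducing property for pairs of kernel functions. -/
lemma integral_kernel_mul (S : OrthoSystem n W f) (x y : ℂ) :
    ∫ w, polyKernel n f x w * polyKernel n f w y * (W w : ℂ) ∂dA = polyKernel n f x y := by
  have h := S.reproducing (S.degree_kernelPoly_lt y) x
  rw [eval_kernelPoly] at h
  rw [← h]
  simp_rw [← integral_const_mul]
  rw [← integral_finsetSum]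
  · refine integral_congr_ae (ae_of_all _ fun w => ?_)
    have e : polyKernel n f x w = ∑ j ∈ Finset.range n, (f j).eval x * conj ((f j).eval w) := rfl
    simp only [e, eval_kernelPoly, Finset.sum_mul]
    refine Finset.sum_congr rfl fun j _ => ?_
    ring
  · intro j hj
    exact (S.integrable _ _ (S.degree_kernelPoly_lt y)
      (S.degree_lt (Finset.mem_range.1 hj))).const_mul _

lemma integrable_kernel_mul (S : OrthoSystem n W f) (x y : ℂ) :
    Integrable (fun w => polyKernel n f x w * polyKernel n f w y * (W w : ℂ)) dA := by
  have h := S.integrable _ _ (S.degree_kernelPoly_lt y) (S.degree_kernelPoly_lt x)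
  refine h.congr (ae_of_all _ fun w => ?_)
  simp only [eval_kernelPoly, polyKernel_conj]
  ring

lemma integrable_kernel_diag (S : OrthoSystem n W f) :
    Integrable (fun w => polyKernel n f w w * (W w : ℂ)) dA := by
  simp only [polyKernel, Finset.sum_mul]
  refine integrable_finsetSum _ fun j hj => ?_
  exact S.integrable _ _ (S.degree_lt (Finset.mem_range.1 hj)) (S.degree_lt (Finset.mem_range.1 hj))

end OrthoSystem

/-! ### The normalized area measure -/

instance instIsAddHaarMeasure_dA : Measure.IsAddHaarMeasure dA := by
  unfold dA
  exact Measure.IsAddHaarMeasure.smul _ (by simp [Real.pi_pos]) ENNReal.ofReal_ne_top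

lemma dA_real_ball : dA.real (Metric.ball (0 : ℂ) 1) = 1 := by
  simp [dA, Measure.real, Complex.volume_ball, Real.pi_pos.le, Real.pi_ne_zero]

lemma integral_radial (f : ℝ → ℝ) :
    ∫ x : ℂ, f ‖x‖ ∂dA = 2 * ∫ y in Set.Ioi (0 : ℝ), y * f y := by
  rw [integral_fun_norm_addHaar, dA_real_ball]
  simp [Complex.finrank_real_complex]

lemma integrable_radial_iff (f : ℝ → ℝ) :
    Integrable (fun x : ℂ => f ‖x‖) dA ↔ IntegrableOn (fun y => y * f y) (Set.Ioi (0 : ℝ)) := by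
  rw [integrable_fun_norm_addHaar]
  simp [Complex.finrank_real_complex]

/-- In polar coordinates the Jacobian $y$ cancels the singularity $y^{-1}$. -/
lemma integrable_indicator_inv_norm (r : ℝ) :
    Integrable (fun x : ℂ => (Set.Iio r).indicator (fun y : ℝ => y⁻¹) ‖x‖) dA := by
  rw [integrable_radial_iff]
  have : IntegrableOn ((Set.Iio r).indicator (fun _ => (1 : ℝ))) (Set.Ioi (0 : ℝ)) := by
    rw [IntegrableOn, integrable_indicator_iff measurableSet_Iio, IntegrableOn,
      Measure.restrict_restrict measurableSet_Iio, Set.inter_comm, Set.Ioi_inter_Iio]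
    simp
  refine this.congr_fun (fun y hy => ?_) measurableSet_Ioi
  have hy' : (0 : ℝ) < y := hy
  by_cases h : y < r <;> simp [h, hy'.ne']

lemma integral_indicator_inv_norm {r : ℝ} (hr : 0 ≤ r) :
    ∫ x : ℂ, (Set.Iio r).indicator (fun y : ℝ => y⁻¹) ‖x‖ ∂dA = 2 * r := by
  rw [integral_radial]
  have : ∀ y ∈ Set.Ioi (0 : ℝ), y * (Set.Iio r).indicator (fun y : ℝ => y⁻¹) y =
      (Set.Iio r).indicator (fun _ => (1 : ℝ)) y := by
    intro y hy
    have hy' : (0 : ℝ) < y := hy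
    by_cases h : y < r <;> simp [h, hy'.ne']
  rw [setIntegral_congr_fun measurableSet_Ioi this, setIntegral_indicator measurableSet_Iio,
    Set.Ioi_inter_Iio]
  simp [hr]

lemma integral_gaussian_dA :
    Integrable (fun x : ℂ => Real.exp (-‖x‖ ^ 2)) dA ∧
      ∫ x : ℂ, Real.exp (-‖x‖ ^ 2) ∂dA = 1 := by
  have hd : ∀ x ∈ Set.Ici (0 : ℝ), HasDerivAt (fun y : ℝ => -(1 / 2) * Real.exp (-y ^ 2))
      (x * Real.exp (-x ^ 2)) x := by
    intro x _
    have := (((hasDerivAt_pow 2 x).neg).exp).const_mul (-(1 / 2))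
    convert! this using 1
    simp; ring
  have hl : Tendsto (fun y : ℝ => -(1 / 2) * Real.exp (-y ^ 2)) atTop (𝓝 0) := by
    have : Tendsto (fun y : ℝ => Real.exp (-y ^ 2)) atTop (𝓝 0) :=
      Real.tendsto_exp_neg_atTop_nhds_zero.comp (tendsto_pow_atTop two_ne_zero)
    simpa using this.const_mul (-(1 / 2 : ℝ))
  have hp : ∀ x ∈ Set.Ioi (0 : ℝ), 0 ≤ x * Real.exp (-x ^ 2) := fun x hx =>
    mul_nonneg (le_of_lt hx) (Real.exp_pos _).le
  refine ⟨(integrable_radial_iff fun y => Real.exp (-y ^ 2)).2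
    (integrableOn_Ioi_deriv_of_nonneg' hd hp hl), ?_⟩
  rw [integral_radial fun y => Real.exp (-y ^ 2),
    integral_Ioi_of_hasDerivAt_of_nonneg' hd hp hl]
  simp

/-- This is the profile of the approximate identity $\varepsilon/(|u|^2+\varepsilon)^2$ produced by
regularizing $1/u$; its unit mass yields the constant in the Cauchy–Pompeiu formula. -/
lemma integral_poisson_dA :
    Integrable (fun x : ℂ => ((1 + ‖x‖ ^ 2) ^ 2)⁻¹) dA ∧
      ∫ x : ℂ, ((1 + ‖x‖ ^ 2) ^ 2)⁻¹ ∂dA = 1 := by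
  have hd : ∀ x ∈ Set.Ici (0 : ℝ), HasDerivAt (fun y : ℝ => -(1 / 2) * (1 + y ^ 2)⁻¹)
      (x * ((1 + x ^ 2) ^ 2)⁻¹) x := by
    intro x _
    have := ((((hasDerivAt_pow 2 x).const_add 1)).inv (by positivity)).const_mul (-(1 / 2))
    convert! this using 1
    field_simp; simp [mul_comm]
  have hl : Tendsto (fun y : ℝ => -(1 / 2) * (1 + y ^ 2)⁻¹) atTop (𝓝 0) := by
    have : Tendsto (fun y : ℝ => (1 + y ^ 2)⁻¹) atTop (𝓝 0) :=
      (tendsto_atTop_add_const_left _ _ (tendsto_pow_atTop two_ne_zero)).inv_tendsto_atTop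
    simpa using this.const_mul (-(1 / 2 : ℝ))
  have hp : ∀ x ∈ Set.Ioi (0 : ℝ), 0 ≤ x * ((1 + x ^ 2) ^ 2)⁻¹ := fun x hx =>
    mul_nonneg (le_of_lt hx) (by positivity)
  refine ⟨(integrable_radial_iff fun y => ((1 + y ^ 2) ^ 2)⁻¹).2
    (integrableOn_Ioi_deriv_of_nonneg' hd hp hl), ?_⟩
  rw [integral_radial fun y => ((1 + y ^ 2) ^ 2)⁻¹,
    integral_Ioi_of_hasDerivAt_of_nonneg' hd hp hl]
  simp

/-! ### Estimates for the Cauchy kernel -/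

lemma norm_div_cauchy_le {b : ℂ → ℂ} {z : ℂ} {r M : ℝ} (hr : 0 < r)
    (hM : ∀ w ∈ Metric.ball z r, ‖b w‖ ≤ M) (w : ℂ) :
    ‖b w / (z - w)‖ ≤ M * (Set.Iio r).indicator (fun y : ℝ => y⁻¹) ‖w - z‖ + r⁻¹ * ‖b w‖ := by
  rw [norm_div, norm_sub_rev z w, div_eq_mul_inv]
  by_cases h : ‖w - z‖ < r
  · rw [Set.indicator_of_mem (by simpa using h)]
    have := hM w (by simpa [dist_eq_norm] using h)
    have h2 : ‖b w‖ * ‖w - z‖⁻¹ ≤ M * ‖w - z‖⁻¹ := by gcongr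
    have h3 : 0 ≤ r⁻¹ * ‖b w‖ := by positivity
    linarith
  · rw [Set.indicator_of_notMem (by simpa using h), mul_zero, zero_add, mul_comm]
    gcongr
    exact not_lt.1 h

lemma integrable_indicator_inv_norm_sub (z : ℂ) (r : ℝ) :
    Integrable (fun w : ℂ => (Set.Iio r).indicator (fun y : ℝ => y⁻¹) ‖w - z‖) dA :=
  (integrable_indicator_inv_norm r).comp_sub_right z

/-- A function that is integrable and bounded near `z` is integrable against the Cauchy kernel. -/
lemma integrable_div_cauchy {b : ℂ → ℂ} {z : ℂ} {r M : ℝ} (hr : 0 < r)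
    (hM : ∀ w ∈ Metric.ball z r, ‖b w‖ ≤ M) (hb : Integrable b dA) :
    Integrable (fun w => b w / (z - w)) dA := by
  refine Integrable.mono' (((integrable_indicator_inv_norm_sub z r).const_mul M).add
    (hb.norm.const_mul r⁻¹)) ?_ (ae_of_all _ fun w => norm_div_cauchy_le hr hM w)
  simp only [div_eq_mul_inv]
  exact hb.aestronglyMeasurable.mul (by fun_prop : Measurable fun w : ℂ => (z - w)⁻¹).aestronglyMeasurable

/-- The singularity integrates to `2 * r` over the disc of radius `r`, and outside it the Cauchy
kernel is at most `r⁻¹`. Since `r` is free, smallness near `z` can be combined with a mere $L^1$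
bound far away by taking `r` large. -/
lemma norm_integral_div_cauchy_le {b : ℂ → ℂ} {z : ℂ} {r M : ℝ} (hr : 0 < r)
    (hM : ∀ w ∈ Metric.ball z r, ‖b w‖ ≤ M) (hb : Integrable b dA) :
    ‖∫ w, b w / (z - w) ∂dA‖ ≤ 2 * r * M + r⁻¹ * ∫ w, ‖b w‖ ∂dA := by
  refine (norm_integral_le_of_norm_le (((integrable_indicator_inv_norm_sub z r).const_mul M).add
    (hb.norm.const_mul r⁻¹)) (ae_of_all _ fun w => norm_div_cauchy_le hr hM w)).trans_eq ?_
  simp only [Pi.add_apply]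
  rw [integral_add ((integrable_indicator_inv_norm_sub z r).const_mul M) (hb.norm.const_mul r⁻¹),
    integral_const_mul, integral_const_mul,
    integral_sub_right_eq_self (fun w : ℂ => (Set.Iio r).indicator (fun y : ℝ => y⁻¹) ‖w‖) z,
    integral_indicator_inv_norm hr.le]
  ring

/-! ### Affine changes of variables -/

/-- Multiplication by `s`, as a real linear map, has determinant $|s|^2$, the field norm of `s` over
$\mathbb R$. -/
lemma map_affine_dA (p : ℂ) {s : ℂ} (hs : s ≠ 0) :
    Measure.map (fun z => p + s * z) dA = ENNReal.ofReal (‖s‖ ^ 2)⁻¹ • dA := by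
  have hdet : LinearMap.det (LinearMap.mulLeft ℝ s) = ‖s‖ ^ 2 := by
    have := Algebra.norm_complex_apply s
    rw [Algebra.norm_apply] at this
    rw [← Complex.normSq_eq_norm_sq, ← this]
    rfl
  have h1 : Measure.map (fun z => s * z) dA = ENNReal.ofReal (‖s‖ ^ 2)⁻¹ • dA := by
    have hne : LinearMap.det (LinearMap.mulLeft ℝ s) ≠ 0 := by rw [hdet]; positivity
    have := Measure.map_linearMap_addHaar_eq_smul_addHaar dA hne
    rw [hdet, abs_of_pos (by positivity)] at this
    exact this
  have h2 : (fun z => p + s * z) = (fun z => p + z) ∘ (fun z => s * z) := rfl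
  rw [h2, ← Measure.map_map (by fun_prop) (by fun_prop), h1, Measure.map_smul,
    map_add_left_eq_self]

lemma measurableEmbedding_affine (p : ℂ) {s : ℂ} (hs : s ≠ 0) :
    MeasurableEmbedding (fun z : ℂ => p + s * z) := by
  have h1 := (Homeomorph.addLeft p).measurableEmbedding
  have h2 := (Homeomorph.mulLeft₀ s hs).measurableEmbedding
  exact h1.comp h2

lemma integral_affine (p : ℂ) {s : ℂ} (hs : s ≠ 0) (g : ℂ → ℂ) :
    ∫ z, g (p + s * z) ∂dA = ((‖s‖ ^ 2)⁻¹ : ℝ) * ∫ z, g z ∂dA := by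
  rw [← (measurableEmbedding_affine p hs).integral_map, map_affine_dA p hs, integral_smul_measure]
  rw [ENNReal.toReal_ofReal (by positivity), Complex.real_smul]

lemma integrable_affine (p : ℂ) {s : ℂ} (hs : s ≠ 0) {g : ℂ → ℂ} (hg : Integrable g dA) :
    Integrable (fun z => g (p + s * z)) dA := by
  refine ((measurableEmbedding_affine p hs).integrable_map_iff (g := g)).1 ?_
  rw [map_affine_dA p hs]
  exact hg.smul_measure ENNReal.ofReal_ne_top

/-- The pullback of an orthonormal system by the affine map `z ↦ p + s z`. -/
lemma OrthoSystem.affine {n : ℕ} {W : ℂ → ℝ} {f : ℕ → ℂ[X]} (S : OrthoSystem n W f)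
    (p : ℂ) {s : ℂ} (hs : s ≠ 0) :
    OrthoSystem n (fun z => W (p + s * z))
      (fun j => C (‖s‖ : ℂ) * (f j).comp (C p + C s * X)) := by
  have hdeg : ∀ (q : ℂ[X]) (a b : ℂ), a ≠ 0 →
      (q.comp (C b + C a * X)).degree = q.degree := by
    intro q a b ha
    have h1 : (C b + C a * X : ℂ[X]).natDegree = 1 := by
      rw [add_comm]; exact natDegree_linear ha
    by_cases hq : q = 0
    · simp [hq]
    have h2 : q.comp (C b + C a * X) ≠ 0 := by
      intro h0
      rcases comp_eq_zero_iff.1 h0 with h | h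
      · exact hq h
      · rw [h.2] at h1; simp at h1
    rw [degree_eq_natDegree h2, degree_eq_natDegree hq, natDegree_comp, h1, mul_one]
  -- Integrability is known for polynomials in the original variable, so each polynomial is written
  -- as the pullback of its composition with the inverse affine map, which keeps the degree.
  have hinv : ∀ (q : ℂ[X]) (z : ℂ), q.eval z =
      (q.comp (C (-p / s) + C s⁻¹ * X)).eval (p + s * z) := by
    intro q z
    simp only [eval_comp, eval_add, eval_C, eval_mul, eval_X]
    congr 1
    field_simp
    ring
  have hlt : ∀ (q : ℂ[X]), q.degree < n → (q.comp (C (-p / s) + C s⁻¹ * X)).degree < n := by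
    intro q hq
    rwa [hdeg q s⁻¹ (-p / s) (inv_ne_zero hs)]
  have hns : (‖s‖ : ℂ) ≠ 0 := by simpa using hs
  refine ⟨fun z => S.nonneg _, S.meas.comp (by fun_prop), ?_, ?_, ?_⟩
  · intro q r hq hr
    have := integrable_affine p hs (S.integrable _ _ (hlt q hq) (hlt r hr))
    refine this.congr (ae_of_all _ fun z => ?_)
    simp only [← hinv]
  · intro j hj
    rw [degree_C_mul hns, hdeg (f j) s p hs, S.degree j hj]
  · intro i hi j hj
    have := integral_affine p hs (fun z => (f i).eval z * conj ((f j).eval z) * (W z : ℂ))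
    rw [S.ortho i hi j hj] at this
    calc _ = ∫ z, (‖s‖ : ℂ) ^ 2 * ((f i).eval (p + s * z) * conj ((f j).eval (p + s * z)) *
            (W (p + s * z) : ℂ)) ∂dA := by
          refine integral_congr_ae (ae_of_all _ fun z => ?_)
          simp only [eval_mul, eval_C, eval_comp, eval_add, eval_X, map_mul, Complex.conj_ofReal]
          ring
      _ = _ := by
          rw [integral_const_mul, this]
          push_cast
          split_ifs <;> field_simp

/-! ### Mean values against radial weights -/

/-- The measure is rotation invariant, so the integrand may be averaged over rotations, and on each
circle the mean value of `h` is `h 0`. Holomorphy is only required in discs whose radius is seen by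
`g`, so `h` may be holomorphic merely near the support of a bump. -/
lemma integral_holomorphic_mul_radial {h : ℂ → ℂ} {g : ℝ → ℝ}
    (hc : Continuous fun u : ℂ => h u * (g ‖u‖ : ℂ))
    (hi : Integrable (fun u : ℂ => h u * (g ‖u‖ : ℂ)) dA)
    (hd : ∀ u : ℂ, g ‖u‖ ≠ 0 → DiffContOnCl ℂ h (Metric.ball 0 ‖u‖)) :
    ∫ u, h u * (g ‖u‖ : ℂ) ∂dA = h 0 * ∫ u : ℂ, (g ‖u‖ : ℂ) ∂dA := by
  set F : ℂ → ℂ := fun u => h u * (g ‖u‖ : ℂ) with hF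
  have hs : ∀ t : ℝ, circleMap 0 1 t ≠ 0 := fun t => by simp [circleMap]
  have hns : ∀ t : ℝ, ‖circleMap 0 1 t‖ = 1 := fun t => by simp
  have h1 : ∀ t : ℝ, ∫ u, F (circleMap 0 1 t * u) ∂dA = ∫ u, F u ∂dA := by
    intro t
    have := integral_affine 0 (hs t) F
    simpa [hns] using this
  have h1n : ∀ t : ℝ, ∫ u, ‖F (circleMap 0 1 t * u)‖ ∂dA = ∫ u, ‖F u‖ ∂dA := by
    intro t
    have := integral_affine 0 (hs t) (fun u => ((‖F u‖ : ℝ) : ℂ))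
    simp only [hns, zero_add, one_pow, inv_one, Complex.ofReal_one, one_mul] at this
    rw [integral_complex_ofReal, integral_complex_ofReal] at this
    exact_mod_cast this
  have hprod : Integrable (Function.uncurry fun (t : ℝ) (u : ℂ) => F (circleMap 0 1 t * u))
      ((volume.restrict (Set.uIoc 0 (2 * Real.pi))).prod dA) := by
    have hcont : Continuous (Function.uncurry fun (t : ℝ) (u : ℂ) => F (circleMap 0 1 t * u)) := by
      refine hc.comp ?_
      exact ((continuous_circleMap 0 1).comp continuous_fst).mul continuous_snd
    rw [integrable_prod_iff hcont.aestronglyMeasurable]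
    refine ⟨ae_of_all _ fun t => ?_, ?_⟩
    · have := integrable_affine 0 (hs t) hi
      simpa using this
    · simp only [Function.uncurry, h1n]
      rw [Set.uIoc_of_le (by positivity)]
      exact integrable_const _
  have h2 := intervalIntegral_integral_swap (f := fun (t : ℝ) (u : ℂ) => F (circleMap 0 1 t * u))
    hprod
  simp only [h1] at h2
  have h3 : ∀ u, ∫ t in (0 : ℝ)..2 * Real.pi, F (circleMap 0 1 t * u) =
      (2 * Real.pi : ℂ) * (h 0 * (g ‖u‖ : ℂ)) := by
    intro u
    have e : ∀ t, F (circleMap 0 1 t * u) = h (circleMap 0 1 t * u) * (g ‖u‖ : ℂ) := fun t => by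
      simp [hF]
    simp_rw [e]
    by_cases h0 : g ‖u‖ = 0
    · simp [h0]
    rw [intervalIntegral.integral_mul_const]
    have hdc : DiffContOnCl ℂ (fun x => h (x * u)) (Metric.ball 0 |1|) := by
      rcases eq_or_ne u 0 with rfl | hu
      · simpa using diffContOnCl_const
      refine (hd u h0).comp (g := fun x => x * u) (by fun_prop : Differentiable ℂ _).diffContOnCl ?_
      intro x hx
      simp only [abs_one, mem_ball_zero_iff, norm_mul] at hx ⊢
      exact mul_lt_of_lt_one_left (norm_pos_iff.2 hu) hx
    have := hdc.circleAverage
    rw [Real.circleAverage_def, inv_smul_eq_iff₀ (by positivity)] at this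
    rw [this]
    simp [Complex.real_smul]; ring
  simp_rw [h3] at h2
  rw [integral_const_mul, integral_const_mul, intervalIntegral.integral_const, sub_zero,
    Complex.real_smul] at h2
  push_cast at h2
  exact mul_left_cancel₀ (by simp [Real.pi_ne_zero]) h2

/-! ### The operators `∂` and `∂̄` and integration by parts -/

/-- The operator `∂ = (∂/∂x - i ∂/∂y) / 2`. -/
noncomputable def del (f : ℂ → ℂ) (z : ℂ) : ℂ :=
  (1 / 2) * (fderiv ℝ f z 1 - Complex.I * fderiv ℝ f z Complex.I)

lemma continuous_mul_of_tsupport_subset {f g : ℂ → ℂ} {U : Set ℂ} (hU : IsOpen U)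
    (hf : ContinuousOn f U) (hg : Continuous g) (hgU : tsupport g ⊆ U) :
    Continuous fun x => f x * g x := by
  refine continuous_of_tsupport fun x hx => ?_
  have hx' : x ∈ U := hgU (tsupport_mul_subset_right hx)
  exact (hf.continuousAt (hU.mem_nhds hx')).mul hg.continuousAt

/-- Smoothness of `f` is needed only near the support of the test function `g`; this is what allows
`f` to be a logarithm of a density controlled only on a disc. -/
lemma integral_mul_fderiv_eq_neg {f g : ℂ → ℂ} {U : Set ℂ} (hU : IsOpen U)
    (hf : ContDiffOn ℝ 1 f U) (hg : ContDiff ℝ 1 g) (hgc : HasCompactSupport g)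
    (hgU : tsupport g ⊆ U) (w : ℂ) :
    Integrable (fun x => fderiv ℝ f x w * g x) dA ∧ Integrable (fun x => f x * fderiv ℝ g x w) dA ∧
    ∫ x, f x * fderiv ℝ g x w ∂dA = -∫ x, fderiv ℝ f x w * g x ∂dA := by
  have hf' : ContinuousOn (fun x => fderiv ℝ f x w) U :=
    (hf.continuousOn_fderiv_of_isOpen hU le_rfl).clm_apply continuousOn_const
  have hg' : Continuous fun x => fderiv ℝ g x w :=
    (hg.continuous_fderiv one_ne_zero).clm_apply continuous_const
  have hsub : tsupport (fun x => fderiv ℝ g x w) ⊆ tsupport g := by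
    refine (closure_mono ?_).trans (tsupport_fderiv_subset ℝ (f := g))
    intro x hx
    simp only [Function.mem_support] at hx ⊢
    intro h; rw [h] at hx; simp at hx
  have i1 : Integrable (fun x => fderiv ℝ f x w * g x) dA :=
    (continuous_mul_of_tsupport_subset hU hf' hg.continuous hgU).integrable_of_hasCompactSupport
      hgc.mul_left
  have i2 : Integrable (fun x => f x * fderiv ℝ g x w) dA :=
    (continuous_mul_of_tsupport_subset hU hf.continuousOn hg'
      (hsub.trans hgU)).integrable_of_hasCompactSupport
      (HasCompactSupport.mul_left (hgc.mono' (subset_tsupport _ |>.trans hsub)))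
  have i3 : Integrable (fun x => f x * g x) dA :=
    (continuous_mul_of_tsupport_subset hU hf.continuousOn hg.continuous
      hgU).integrable_of_hasCompactSupport hgc.mul_left
  refine ⟨i1, i2, ?_⟩
  have := integral_bilinear_hasLineDerivAt_right_eq_neg_left_of_integrable (μ := dA)
    (f := f) (f' := fun x => fderiv ℝ f x w) (g := g) (g' := fun x => fderiv ℝ g x w) (v := w)
    (B := ContinuousLinearMap.mul ℝ ℂ) i1 i2 i3 ?_ ?_
  · simpa using this
  · intro x hx
    have := (hf.differentiableOn one_ne_zero).differentiableAt (hU.mem_nhds (hgU hx))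
    exact this.hasFDerivAt.hasLineDerivAt w
  · intro x _
    exact ((hg.differentiable one_ne_zero) x).hasFDerivAt.hasLineDerivAt w

lemma integral_mul_del_eq_neg {f g : ℂ → ℂ} {U : Set ℂ} (hU : IsOpen U)
    (hf : ContDiffOn ℝ 1 f U) (hg : ContDiff ℝ 1 g) (hgc : HasCompactSupport g)
    (hgU : tsupport g ⊆ U) :
    Integrable (fun x => del f x * g x) dA ∧ Integrable (fun x => f x * del g x) dA ∧
    ∫ x, f x * del g x ∂dA = -∫ x, del f x * g x ∂dA := by
  obtain ⟨a1, a2, a3⟩ := integral_mul_fderiv_eq_neg hU hf hg hgc hgU 1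
  obtain ⟨b1, b2, b3⟩ := integral_mul_fderiv_eq_neg hU hf hg hgc hgU Complex.I
  have e1 : ∀ x, del f x * g x = (1 / 2) * (fderiv ℝ f x 1 * g x -
      Complex.I * (fderiv ℝ f x Complex.I * g x)) := fun x => by simp only [del]; ring
  have e2 : ∀ x, f x * del g x = (1 / 2) * (f x * fderiv ℝ g x 1 -
      Complex.I * (f x * fderiv ℝ g x Complex.I)) := fun x => by simp only [del]; ring
  simp_rw [e1, e2]
  refine ⟨(a1.sub (b1.const_mul _)).const_mul _, (a2.sub (b2.const_mul _)).const_mul _, ?_⟩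
  rw [integral_const_mul, integral_const_mul, integral_sub a1 (b1.const_mul _),
    integral_sub a2 (b2.const_mul _), integral_const_mul, integral_const_mul, a3, b3]
  ring

lemma integral_mul_dbar_eq_neg {f g : ℂ → ℂ} {U : Set ℂ} (hU : IsOpen U)
    (hf : ContDiffOn ℝ 1 f U) (hg : ContDiff ℝ 1 g) (hgc : HasCompactSupport g)
    (hgU : tsupport g ⊆ U) :
    ∫ x, f x * dbar g x ∂dA = -∫ x, dbar f x * g x ∂dA := by
  obtain ⟨a1, a2, a3⟩ := integral_mul_fderiv_eq_neg hU hf hg hgc hgU 1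
  obtain ⟨b1, b2, b3⟩ := integral_mul_fderiv_eq_neg hU hf hg hgc hgU Complex.I
  have e1 : ∀ x, dbar f x * g x = (1 / 2) * (fderiv ℝ f x 1 * g x +
      Complex.I * (fderiv ℝ f x Complex.I * g x)) := fun x => by simp only [dbar]; ring
  have e2 : ∀ x, f x * dbar g x = (1 / 2) * (f x * fderiv ℝ g x 1 +
      Complex.I * (f x * fderiv ℝ g x Complex.I)) := fun x => by simp only [dbar]; ring
  simp_rw [e1, e2]
  rw [integral_const_mul, integral_const_mul, integral_add a1 (b1.const_mul _),
    integral_add a2 (b2.const_mul _), integral_const_mul, integral_const_mul, a3, b3]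
  ring

lemma continuous_dbar {g : ℂ → ℂ} (hg : ContDiff ℝ 1 g) : Continuous (dbar g) := by
  have h := hg.continuous_fderiv one_ne_zero
  unfold dbar
  fun_prop

lemma continuous_del {g : ℂ → ℂ} (hg : ContDiff ℝ 1 g) : Continuous (del g) := by
  have h := hg.continuous_fderiv one_ne_zero
  unfold del
  fun_prop

lemma hasCompactSupport_dbar {g : ℂ → ℂ} (hgc : HasCompactSupport g) :
    HasCompactSupport (dbar g) := by
  refine (hgc.fderiv ℝ).mono fun x hx => ?_
  simp only [Function.mem_support, dbar] at hx ⊢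
  intro h; rw [h] at hx; simp at hx

lemma hasCompactSupport_del {g : ℂ → ℂ} (hgc : HasCompactSupport g) :
    HasCompactSupport (del g) := by
  refine (hgc.fderiv ℝ).mono fun x hx => ?_
  simp only [Function.mem_support, del] at hx ⊢
  intro h; rw [h] at hx; simp at hx

/-! ### The Cauchy–Pompeiu formula -/

/-- The function $\bar u/(|u|^2+\varepsilon)$ is a smooth substitute for $1/u$; its $\bar\partial$
is an approximate identity as $\varepsilon\to0$. -/
lemma dbar_conj_div {ε : ℝ} (hε : 0 < ε) (u : ℂ) :
    DifferentiableAt ℝ (fun u : ℂ => conj u / (u * conj u + ε)) u ∧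
    dbar (fun u : ℂ => conj u / (u * conj u + ε)) u = ε / ((‖u‖ ^ 2 + ε : ℝ) : ℂ) ^ 2 := by
  have hne : ∀ u : ℂ, u * conj u + ε ≠ 0 := by
    intro u
    rw [Complex.mul_conj, Complex.normSq_eq_norm_sq]
    have : (0 : ℝ) < ‖u‖ ^ 2 + ε := by positivity
    exact_mod_cast this.ne'
  have hconj : DifferentiableAt ℝ (fun u : ℂ => conj u) u := Complex.conjCLE.differentiableAt
  have hd : DifferentiableAt ℝ (fun u : ℂ => conj u / (u * conj u + ε)) u := by
    simp only [div_eq_mul_inv]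
    exact hconj.mul (((differentiableAt_id.mul hconj).add_const _).inv (hne u))
  refine ⟨hd, ?_⟩
  have key : ∀ w : ℂ, fderiv ℝ (fun u : ℂ => conj u / (u * conj u + ε)) u w =
      (conj w * (u * conj u + ε) - conj u * (w * conj u + u * conj w)) / (u * conj u + ε) ^ 2 := by
    intro w
    have h1 : HasLineDerivAt ℝ (fun u : ℂ => conj u / (u * conj u + ε))
      (fderiv ℝ (fun u : ℂ => conj u / (u * conj u + ε)) u w) u w := hd.hasFDerivAt.hasLineDerivAt w
    have l1 : HasDerivAt (fun t : ℝ => u + t • w) w 0 := by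
      simpa using ((hasDerivAt_id (0 : ℝ)).smul_const w).const_add u
    have l2 : HasDerivAt (fun t : ℝ => conj (u + t • w)) (conj w) 0 := by
      have := Complex.conjCLE.hasFDerivAt.comp_hasDerivAt (0 : ℝ) l1
      simpa [Function.comp_def] using! this
    have l3 := l2.div ((l1.mul l2).add_const (ε : ℂ)) (by simpa using hne u)
    have := HasDerivAt.unique h1 l3
    simpa using this
  have e : u * conj u = ((‖u‖ ^ 2 : ℝ) : ℂ) := by
    rw [Complex.mul_conj, Complex.normSq_eq_norm_sq]
  have hne' := hne u
  simp only [dbar, key, map_one, Complex.conj_I]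
  rw [Complex.ofReal_add, ← e]
  field_simp
  linear_combination (-(ε : ℂ) - conj u ^ 2) * Complex.I_sq

/-- The Cauchy–Pompeiu formula at the origin. -/
lemma integral_dbar_div {g : ℂ → ℂ} (hg : ContDiff ℝ 1 g) (hgc : HasCompactSupport g) :
    ∫ u, dbar g u / u ∂dA = -g 0 := by
  set N : ℝ → ℂ → ℂ := fun ε u => conj u / (u * conj u + ε) with hN
  have hne : ∀ {ε : ℝ}, 0 < ε → ∀ u : ℂ, u * conj u + ε ≠ 0 := by
    intro ε hε u
    rw [Complex.mul_conj, Complex.normSq_eq_norm_sq]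
    have : (0 : ℝ) < ‖u‖ ^ 2 + ε := by positivity
    exact_mod_cast this.ne'
  have hNC : ∀ {ε : ℝ}, 0 < ε → ContDiff ℝ 1 (N ε) := by
    intro ε hε
    have hconj : ContDiff ℝ 1 (fun u : ℂ => conj u) := Complex.conjCLE.contDiff
    simp only [hN, div_eq_mul_inv]
    exact hconj.mul (((contDiff_id.mul hconj).add contDiff_const).inv (hne hε))
  -- After integrating by parts, $u=\sqrt\varepsilon\,x$ turns the approximate identity into a fixed
  -- kernel and puts all dependence on $\varepsilon$ into the argument of `g`.
  have hparts : ∀ {ε : ℝ}, 0 < ε → ∫ u, N ε u * dbar g u ∂dA =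
      -∫ x : ℂ, g ((Real.sqrt ε : ℂ) * x) * (((1 + ‖x‖ ^ 2) ^ 2)⁻¹ : ℝ) ∂dA := by
    intro ε hε
    rw [integral_mul_dbar_eq_neg isOpen_univ (hNC hε).contDiffOn hg hgc (Set.subset_univ _)]
    congr 1
    have hs : (Real.sqrt ε : ℂ) ≠ 0 := by
      have := Real.sqrt_pos.2 hε
      exact_mod_cast this.ne'
    have := integral_affine 0 hs (fun u => dbar (N ε) u * g u)
    have hsn : ‖(Real.sqrt ε : ℂ)‖ ^ 2 = ε := by
      rw [Complex.norm_real, Real.norm_of_nonneg (Real.sqrt_nonneg _), Real.sq_sqrt hε.le]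
    rw [hsn] at this
    have h2 : ∫ u, dbar (N ε) u * g u ∂dA = (ε : ℂ) * ∫ z, dbar (N ε) (0 + (Real.sqrt ε : ℂ) * z) *
        g (0 + (Real.sqrt ε : ℂ) * z) ∂dA := by
      rw [this]
      have : (ε : ℂ) ≠ 0 := by exact_mod_cast hε.ne'
      push_cast
      field_simp
    rw [h2, ← integral_const_mul]
    refine integral_congr_ae (ae_of_all _ fun x => ?_)
    simp only [hN, zero_add]
    rw [(dbar_conj_div hε _).2, norm_mul, mul_pow, hsn]
    have h3 : ((ε * ‖x‖ ^ 2 + ε : ℝ) : ℂ) = ε * ((1 + ‖x‖ ^ 2 : ℝ) : ℂ) := by push_cast; ring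
    rw [h3]
    have h4 : (ε : ℂ) ≠ 0 := by exact_mod_cast hε.ne'
    have h5 : ((1 + ‖x‖ ^ 2 : ℝ) : ℂ) ≠ 0 := by
      have : (0 : ℝ) < 1 + ‖x‖ ^ 2 := by positivity
      exact_mod_cast this.ne'
    rw [Complex.ofReal_inv, Complex.ofReal_pow]
    field_simp
  set e : ℕ → ℝ := fun n => 1 / ((n : ℝ) + 1) with he
  have hepos : ∀ n, 0 < e n := fun n => by positivity
  have helim : Tendsto e atTop (𝓝 0) := tendsto_one_div_add_atTop_nhds_zero_nat
  have hbc := continuous_dbar hg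
  obtain ⟨M, hM⟩ := (hasCompactSupport_dbar hgc).exists_bound_of_continuous hbc
  obtain ⟨M', hM'⟩ := hgc.exists_bound_of_continuous hg.continuous
  have hbi : Integrable (dbar g) dA := hbc.integrable_of_hasCompactSupport (hasCompactSupport_dbar hgc)
  have hdom : Integrable (fun u => dbar g u / u) dA := by
    have := (integrable_div_cauchy (z := 0) one_pos (fun w _ => hM w) hbi).neg
    refine this.congr (ae_of_all _ fun u => ?_)
    simp [div_neg]
  -- The domination is $|N_\varepsilon(u)|\le1/|u|$. At $u=0$ both sides vanish, because division by
  -- zero gives zero.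
  have hL : Tendsto (fun n => ∫ u, N (e n) u * dbar g u ∂dA) atTop
      (𝓝 (∫ u, dbar g u / u ∂dA)) := by
    refine tendsto_integral_of_dominated_convergence (fun u => ‖dbar g u / u‖) ?_ hdom.norm ?_ ?_
    · intro n
      exact ((hNC (hepos n)).continuous.mul hbc).aestronglyMeasurable
    · intro n
      refine ae_of_all _ fun u => ?_
      rw [norm_mul, norm_div (dbar g u), mul_comm, div_eq_mul_inv ‖dbar g u‖]
      refine mul_le_mul_of_nonneg_left ?_ (norm_nonneg (dbar g u))
      rcases eq_or_ne u 0 with rfl | hu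
      · simp [hN]
      rw [hN]
      simp only [norm_div, RCLike.norm_conj]
      rw [Complex.mul_conj, Complex.normSq_eq_norm_sq, ← Complex.ofReal_add, Complex.norm_real,
        Real.norm_of_nonneg (by have := hepos n; positivity)]
      have hu' := norm_pos_iff.2 hu
      have := hepos n
      rw [div_le_iff₀ (by positivity), inv_mul_eq_div, le_div_iff₀ hu']
      nlinarith
    · refine ae_of_all _ fun u => ?_
      rcases eq_or_ne u 0 with rfl | hu
      · simp [hN]
      have hcu : conj u ≠ 0 := by simpa using hu
      have h1 : Tendsto (fun n => ((e n : ℝ) : ℂ)) atTop (𝓝 0) := by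
        have := (Complex.continuous_ofReal.tendsto 0).comp helim
        simpa [Function.comp_def] using this
      have h2 : Tendsto (fun n => N (e n) u) atTop (𝓝 (conj u / (u * conj u + 0))) :=
        tendsto_const_nhds.div (tendsto_const_nhds.add h1) (by simpa using hu)
      have h3 := h2.mul_const (dbar g u)
      convert h3 using 2
      field_simp
      ring
  have hR : Tendsto (fun n => -∫ x : ℂ, g ((Real.sqrt (e n) : ℂ) * x) *
      (((1 + ‖x‖ ^ 2) ^ 2)⁻¹ : ℝ) ∂dA) atTop (𝓝 (-g 0)) := by
    refine Tendsto.neg ?_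
    have hlim : g 0 = ∫ x : ℂ, g 0 * (((1 + ‖x‖ ^ 2) ^ 2)⁻¹ : ℝ) ∂dA := by
      rw [integral_const_mul, integral_complex_ofReal, integral_poisson_dA.2]
      simp
    rw [hlim]
    refine tendsto_integral_of_dominated_convergence
      (fun x => M' * ((1 + ‖x‖ ^ 2) ^ 2)⁻¹) ?_ (integral_poisson_dA.1.const_mul _) ?_ ?_
    · intro n
      refine (Continuous.mul (hg.continuous.comp (by fun_prop)) ?_).aestronglyMeasurable
      refine Complex.continuous_ofReal.comp (Continuous.inv₀ (by fun_prop) fun x => by positivity)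
    · intro n
      refine ae_of_all _ fun x => ?_
      rw [norm_mul, Complex.norm_real, Real.norm_of_nonneg (by positivity)]
      gcongr
      exact hM' _
    · refine ae_of_all _ fun x => ?_
      refine Tendsto.mul_const _ ?_
      have h1 : Tendsto (fun n => (Real.sqrt (e n) : ℂ) * x) atTop (𝓝 0) := by
        have := ((Complex.continuous_ofReal.comp Real.continuous_sqrt).tendsto 0).comp helim
        have := this.mul_const x
        simpa using this
      exact (hg.continuous.tendsto 0).comp h1
  refine tendsto_nhds_unique hL (hR.congr fun n => ?_)
  rw [hparts (hepos n)]

/-! ### Cauchy transforms of smooth functions -/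

lemma locallyIntegrable_inv : LocallyIntegrable (fun u : ℂ => u⁻¹) dA := by
  intro x
  refine ⟨Metric.ball 0 (‖x‖ + 1), Metric.isOpen_ball.mem_nhds (by simp), ?_⟩
  rw [← integrable_indicator_iff Metric.isOpen_ball.measurableSet]
  refine (integrable_indicator_inv_norm (‖x‖ + 1)).mono' ?_ (ae_of_all _ fun u => ?_)
  · exact ((by fun_prop : Measurable fun u : ℂ => u⁻¹).indicator
      Metric.isOpen_ball.measurableSet).aestronglyMeasurable
  · by_cases h : ‖u‖ < ‖x‖ + 1
    · rw [Set.indicator_of_mem (by simpa using h), Set.indicator_of_mem (by simpa using h)]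
      simp
    · rw [Set.indicator_of_notMem (by simpa using h), Set.indicator_of_notMem (by simpa using h)]
      simp

lemma cauchy_eq_convolution (g : ℂ → ℂ) (z : ℂ) :
    ∫ w, g w / (z - w) ∂dA =
      (convolution (fun u : ℂ => u⁻¹) g (ContinuousLinearMap.mul ℝ ℂ) dA) z := by
  rw [convolution_def, ← integral_sub_left_eq_self (fun w => g w / (z - w)) dA z]
  refine integral_congr_ae (ae_of_all _ fun u => ?_)
  simp [div_eq_mul_inv, mul_comm]

lemma contDiff_cauchy {g : ℂ → ℂ} (hg : ContDiff ℝ ∞ g) (hgc : HasCompactSupport g) :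
    ContDiff ℝ ∞ fun z => ∫ w, g w / (z - w) ∂dA := by
  simp_rw [cauchy_eq_convolution]
  exact hgc.contDiff_convolution_right (ContinuousLinearMap.mul ℝ ℂ) locallyIntegrable_inv hg

/-- Derivatives of the convolution $u^{-1}*g$ fall on `g`, and the outcome is the Cauchy–Pompeiu
formula at the origin for $u\mapsto g(z-u)$; the reflection changes the sign of the derivative. -/
lemma dbar_cauchy {g : ℂ → ℂ} (hg : ContDiff ℝ 1 g) (hgc : HasCompactSupport g) (z : ℂ) :
    dbar (fun z => ∫ w, g w / (z - w) ∂dA) z = g z := by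
  have hd := hgc.hasFDerivAt_convolution_right (ContinuousLinearMap.mul ℝ ℂ)
    locallyIntegrable_inv hg z
  have hfun : (fun z => ∫ w, g w / (z - w) ∂dA) =
      convolution (fun u : ℂ => u⁻¹) g (ContinuousLinearMap.mul ℝ ℂ) dA :=
    funext fun z => cauchy_eq_convolution g z
  have hconv : ConvolutionExistsAt (fun u : ℂ => u⁻¹) (fderiv ℝ g) z
      ((ContinuousLinearMap.mul ℝ ℂ).precompR ℂ) dA :=
    (hgc.fderiv ℝ).convolutionExists_right _ locallyIntegrable_inv
      (hg.continuous_fderiv one_ne_zero) z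
  have key : ∀ v : ℂ, fderiv ℝ (fun z => ∫ w, g w / (z - w) ∂dA) z v =
      ∫ u, u⁻¹ * fderiv ℝ g (z - u) v ∂dA := by
    intro v
    rw [hfun, hd.fderiv, convolution_def, ContinuousLinearMap.integral_apply hconv.integrable]
    rfl
  have h_int : ∀ v : ℂ, Integrable (fun u : ℂ => u⁻¹ * fderiv ℝ g (z - u) v) dA := by
    intro v
    have := (ContinuousLinearMap.apply ℝ ℂ v).integrable_comp hconv.integrable
    exact this
  set g' : ℂ → ℂ := fun u => g (z - u) with hg'
  have hg'C : ContDiff ℝ 1 g' := hg.comp (contDiff_const.sub contDiff_id)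
  have hg'c : HasCompactSupport g' := hgc.comp_homeomorph (Homeomorph.subLeft z)
  have hP := integral_dbar_div hg'C hg'c
  have hdb : ∀ u v, fderiv ℝ g' u v = -fderiv ℝ g (z - u) v := by
    intro u v
    have h1 : HasFDerivAt g (fderiv ℝ g (z - u)) (z - u) :=
      ((hg.differentiable one_ne_zero) _).hasFDerivAt
    have h2 := h1.comp u ((hasFDerivAt_id u).const_sub z)
    have h3 : fderiv ℝ g' u = _ := h2.fderiv
    rw [h3]
    simp
  have hP' : ∫ u, dbar g' u / u ∂dA =
      -((1 / 2) * (∫ u, u⁻¹ * fderiv ℝ g (z - u) 1 ∂dA +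
        Complex.I * ∫ u, u⁻¹ * fderiv ℝ g (z - u) Complex.I ∂dA)) := by
    rw [← integral_const_mul, ← integral_add (h_int 1) ((h_int _).const_mul _), ← integral_const_mul,
      ← integral_neg]
    refine integral_congr_ae (ae_of_all _ fun u => ?_)
    simp only [dbar, hdb, div_eq_mul_inv]
    ring
  rw [dbar, key, key]
  rw [hP'] at hP
  have := neg_injective hP
  rw [this, hg']
  simp

/-! ### Holomorphic parts of `∂v` are controlled by `v` -/

/-- A radial smooth bump supported in the disc of radius `δ / 2`. -/
noncomputable def radialBump (δ : ℝ) (y : ℝ) : ℝ := Real.smoothTransition (1 - 4 * y ^ 2 / δ ^ 2)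

lemma contDiff_radialBump (δ : ℝ) : ContDiff ℝ ∞ fun u : ℂ => (radialBump δ ‖u‖ : ℂ) := by
  have h1 : ContDiff ℝ ∞ fun u : ℂ => ‖u‖ ^ 2 := contDiff_norm_sq ℝ
  have h2 : ContDiff ℝ ∞ fun u : ℂ => 1 - 4 * ‖u‖ ^ 2 / δ ^ 2 := by fun_prop
  have h3 : ContDiff ℝ ∞ fun u : ℂ => Real.smoothTransition (1 - 4 * ‖u‖ ^ 2 / δ ^ 2) :=
    Real.smoothTransition.contDiff.comp h2
  exact Complex.ofRealCLM.contDiff.comp h3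

lemma radialBump_eq_zero {δ y : ℝ} (hδ : 0 < δ) (hy : δ / 2 ≤ y) : radialBump δ y = 0 := by
  refine Real.smoothTransition.zero_of_nonpos ?_
  have : 1 ≤ 4 * y ^ 2 / δ ^ 2 := by
    rw [le_div_iff₀ (by positivity)]; nlinarith
  linarith

lemma tsupport_radialBump_sub {δ : ℝ} (hδ : 0 < δ) (z : ℂ) :
    tsupport (fun w : ℂ => (radialBump δ ‖w - z‖ : ℂ)) ⊆ Metric.closedBall z (δ / 2) := by
  refine closure_minimal (fun w hw => ?_) Metric.isClosed_closedBall
  rw [Metric.mem_closedBall, dist_eq_norm]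
  by_contra h
  exact hw (by simp [radialBump_eq_zero hδ (not_le.1 h).le])

lemma hasCompactSupport_radialBump_sub {δ : ℝ} (hδ : 0 < δ) (z : ℂ) :
    HasCompactSupport (fun w : ℂ => (radialBump δ ‖w - z‖ : ℂ)) :=
  (isCompact_closedBall z (δ / 2)).of_isClosed_subset (isClosed_tsupport _)
    (tsupport_radialBump_sub hδ z)

lemma integral_radialBump_pos {δ : ℝ} (hδ : 0 < δ) : 0 < ∫ u : ℂ, radialBump δ ‖u‖ ∂dA := by
  have hc : Continuous fun u : ℂ => radialBump δ ‖u‖ := by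
    have := Complex.continuous_re.comp (contDiff_radialBump δ).continuous
    simpa [Function.comp_def] using this
  have hs : HasCompactSupport fun u : ℂ => radialBump δ ‖u‖ := by
    refine HasCompactSupport.intro (isCompact_closedBall (0 : ℂ) (δ / 2)) fun u hu => ?_
    refine radialBump_eq_zero hδ ?_
    simpa using (not_le.1 (by simpa using hu)).le
  refine hc.integral_pos_of_hasCompactSupport_nonneg_nonzero hs
    (fun u => Real.smoothTransition.nonneg _) (x := 0) ?_
  simp [radialBump]

/-- If `∂v = T + h` near `z` with `h` holomorphic, then `h z` is bounded by `v` and `T`. -/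
lemma exists_holomorphic_part_bound {δ : ℝ} (hδ : 0 < δ) :
    ∃ M : ℝ, 0 ≤ M ∧ ∀ (z : ℂ) (v h T : ℂ → ℂ) (A B : ℝ),
      ContDiffOn ℝ 1 v (Metric.ball z δ) → DifferentiableOn ℂ h (Metric.ball z δ) →
      (∀ w ∈ Metric.ball z δ, del v w = T w + h w) →
      (∀ w ∈ Metric.ball z δ, ‖v w‖ ≤ A) → (∀ w ∈ Metric.ball z δ, ‖T w‖ ≤ B) →
      ‖h z‖ ≤ M * (A + B) := by
  set φ : ℂ → ℂ := fun u => (radialBump δ ‖u‖ : ℂ) with hφ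
  set c : ℝ := ∫ u : ℂ, radialBump δ ‖u‖ ∂dA with hc
  have hcpos : 0 < c := integral_radialBump_pos hδ
  have hφ0 : HasCompactSupport φ := by simpa using hasCompactSupport_radialBump_sub hδ 0
  have hφC : ContDiff ℝ 1 φ := (contDiff_radialBump δ).of_le (by norm_num)
  have hφi : Integrable φ dA := hφC.continuous.integrable_of_hasCompactSupport hφ0
  have hdφi : Integrable (del φ) dA :=
    (continuous_del hφC).integrable_of_hasCompactSupport (hasCompactSupport_del hφ0)
  set m : ℝ := (∫ u, ‖del φ u‖ ∂dA) + ∫ u, ‖φ u‖ ∂dA with hm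
  have hm1 : 0 ≤ ∫ u, ‖del φ u‖ ∂dA := integral_nonneg fun _ => norm_nonneg _
  have hm2 : 0 ≤ ∫ u, ‖φ u‖ ∂dA := integral_nonneg fun _ => norm_nonneg _
  -- `c` is the mass of the bump, and `m` adds the $L^1$ norms of its $\partial$ derivative, which
  -- multiplies `A`, and of the bump, which multiplies `B`. All are translation invariant, so the
  -- constant depends on `δ` only.
  refine ⟨m / c, by positivity, ?_⟩
  intro z v h T A B hv hh hT hA hB
  set ψ : ℂ → ℂ := fun w => φ (w - z) with hψ
  have hψt : tsupport ψ ⊆ Metric.ball z δ :=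
    (tsupport_radialBump_sub hδ z).trans (Metric.closedBall_subset_ball (by linarith))
  have hψc : HasCompactSupport ψ := hasCompactSupport_radialBump_sub hδ z
  have hψC : ContDiff ℝ 1 ψ := hφC.comp (contDiff_id.sub contDiff_const)
  have hdψ : ∀ w, del ψ w = del φ (w - z) := by
    intro w
    have : fderiv ℝ ψ w = fderiv ℝ φ (w - z) := by
      have := fderiv_comp_add_right (𝕜 := ℝ) (f := φ) (x := w) (-z)
      simpa [hψ, sub_eq_add_neg] using this
    simp only [del, this]
  have hA0 : 0 ≤ A := (norm_nonneg _).trans (hA z (Metric.mem_ball_self hδ))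
  have hB0 : 0 ≤ B := (norm_nonneg _).trans (hB z (Metric.mem_ball_self hδ))
  obtain ⟨i1, i2, i3⟩ := integral_mul_del_eq_neg Metric.isOpen_ball hv hψC hψc hψt
  have hhψ : Continuous fun w => h w * ψ w :=
    continuous_mul_of_tsupport_subset Metric.isOpen_ball hh.continuousOn hψC.continuous hψt
  have hhi : Integrable (fun w => h w * ψ w) dA :=
    hhψ.integrable_of_hasCompactSupport hψc.mul_left
  have hzero : ∀ w, w ∉ Metric.ball z δ → ψ w = 0 := fun w hw =>
    image_eq_zero_of_notMem_tsupport fun h => hw (hψt h)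
  have eT : ∀ w, T w * ψ w = del v w * ψ w - h w * ψ w := by
    intro w
    by_cases hw : w ∈ Metric.ball z δ
    · rw [hT w hw]; ring
    · simp [hzero w hw]
  have hTi : Integrable (fun w => T w * ψ w) dA := by
    simp_rw [eT]; exact i1.sub hhi
  have hmean : ∫ w, h w * ψ w ∂dA = h z * c := by
    have e1 : ∫ w, h w * ψ w ∂dA = ∫ u, h (u + z) * (radialBump δ ‖u‖ : ℂ) ∂dA := by
      rw [← integral_add_right_eq_self (fun w => h w * ψ w) z]
      simp [hψ, hφ]
    rw [e1, integral_holomorphic_mul_radial (h := fun u => h (u + z))]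
    · rw [integral_complex_ofReal]; simp [hc]
    · have := hhψ.comp (continuous_add_const z)
      simpa [Function.comp_def, hψ, hφ] using this
    · have := hhi.comp_add_right z
      simpa [hψ, hφ] using this
    · intro u hu
      have hu' : ‖u‖ < δ / 2 := by
        by_contra h0
        exact hu (radialBump_eq_zero hδ (not_lt.1 h0))
      have : DifferentiableOn ℂ (fun u => h (u + z)) (Metric.ball 0 δ) := by
        refine hh.comp (by fun_prop) fun x hx => ?_
        simpa [dist_eq_norm] using hx
      refine DifferentiableOn.diffContOnCl (this.mono ?_)
      refine Metric.closure_ball_subset_closedBall.trans (Metric.closedBall_subset_ball ?_)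
      linarith
  -- The mean value property identifies the pairing of `h` with the radial bump, and integration by
  -- parts moves $\partial$ off `v`, so no bound on derivatives of `v` is used.
  have hid : h z * c = -(∫ w, v w * del ψ w ∂dA) - ∫ w, T w * ψ w ∂dA := by
    simp_rw [eT]
    rw [integral_sub i1 hhi, i3, ← hmean]; ring
  have b1 : ‖∫ w, v w * del ψ w ∂dA‖ ≤ A * ∫ u, ‖del φ u‖ ∂dA := by
    rw [← integral_sub_right_eq_self (fun u => ‖del φ u‖) z, ← integral_const_mul]
    refine norm_integral_le_of_norm_le ((hdφi.norm.comp_sub_right z).const_mul A)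
      (ae_of_all _ fun w => ?_)
    rw [norm_mul, hdψ]
    by_cases hw : w ∈ Metric.ball z δ
    · gcongr; exact hA w hw
    · have : del ψ w = 0 := by
        have hw' : w ∉ tsupport ψ := fun h => hw (hψt h)
        have : fderiv ℝ ψ w = 0 := by
          by_contra h0
          exact hw' (support_fderiv_subset ℝ h0)
        simp [del, this]
      rw [← hdψ, this]; simp
  have b2 : ‖∫ w, T w * ψ w ∂dA‖ ≤ B * ∫ u, ‖φ u‖ ∂dA := by
    rw [← integral_sub_right_eq_self (fun u => ‖φ u‖) z, ← integral_const_mul]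
    refine norm_integral_le_of_norm_le ((hφi.norm.comp_sub_right z).const_mul B)
      (ae_of_all _ fun w => ?_)
    rw [norm_mul]
    by_cases hw : w ∈ Metric.ball z δ
    · gcongr; exact hB w hw
    · have := hzero w hw
      simp only [hψ] at this
      simp [hψ, this]
  have b3 : ‖h z‖ * c ≤ A * (∫ u, ‖del φ u‖ ∂dA) + B * ∫ u, ‖φ u‖ ∂dA := by
    have : ‖h z * c‖ = ‖h z‖ * c := by
      rw [norm_mul, Complex.norm_real, Real.norm_of_nonneg hcpos.le]
    rw [← this, hid]
    refine (norm_sub_le _ _).trans ?_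
    rw [norm_neg]
    linarith
  rw [div_mul_eq_mul_div, le_div_iff₀ hcpos]
  refine b3.trans ?_
  rw [hm]
  nlinarith [mul_nonneg hA0 hm2, mul_nonneg hB0 hm1]

/-! ### The Ginibre kernel and the Fock space -/

lemma ginibre_conj (z w : ℂ) : conj (ginibre z w) = ginibre w z := by
  simp only [ginibre, ← Complex.exp_conj, map_sub, map_mul, Complex.conj_conj, map_div₀, map_pow,
    Complex.conj_ofReal, map_ofNat]
  congr 1; ring

lemma ginibre_self (z : ℂ) : ginibre z z = 1 := by
  rw [ginibre, Complex.mul_conj, Complex.normSq_eq_norm_sq]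
  push_cast
  rw [show (‖z‖ : ℂ) ^ 2 - (‖z‖ : ℂ) ^ 2 / 2 - (‖z‖ : ℂ) ^ 2 / 2 = 0 by ring, Complex.exp_zero]

lemma ginibre_eq (z w : ℂ) :
    ginibre w z = (Complex.exp (w * conj z) * Complex.exp (-(‖z‖ : ℂ) ^ 2 / 2)) *
      (Real.exp (-‖w‖ ^ 2 / 2) : ℂ) := by
  rw [ginibre]
  push_cast
  rw [← Complex.exp_add, ← Complex.exp_add]
  congr 1; ring

lemma norm_sq_add_complex (z u : ℂ) :
    ((‖z + u‖ : ℝ) : ℂ) ^ 2 = z * conj z + z * conj u + conj z * u + u * conj u := by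
  have := Complex.mul_conj (z + u)
  rw [Complex.normSq_eq_norm_sq] at this
  push_cast at this
  rw [← this, map_add]; ring

lemma norm_ginibre_sq (z w : ℂ) : ‖ginibre z w‖ ^ 2 = Real.exp (-‖w - z‖ ^ 2) := by
  have h : ((‖ginibre z w‖ ^ 2 : ℝ) : ℂ) = ((Real.exp (-‖w - z‖ ^ 2) : ℝ) : ℂ) := by
    rw [← Complex.normSq_eq_norm_sq, ← Complex.mul_conj, ginibre_conj, ginibre, ginibre,
      ← Complex.exp_add]
    push_cast
    congr 1
    have e1 := norm_sq_add_complex w (-z)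
    have e2 := norm_sq_add_complex z 0
    have e3 := norm_sq_add_complex w 0
    simp only [← sub_eq_add_neg, add_zero, map_neg, map_zero, mul_zero] at e1 e2 e3
    rw [e1, e2, e3]; ring
  exact_mod_cast h

lemma continuous_ginibre_left (z : ℂ) : Continuous fun w => ginibre w z := by
  unfold ginibre; fun_prop

lemma continuous_ginibre_right (z : ℂ) : Continuous fun w => ginibre z w := by
  unfold ginibre
  exact Complex.continuous_exp.comp (by fun_prop)

lemma integrable_norm_ginibre_sq (z : ℂ) : Integrable (fun w => ‖ginibre z w‖ ^ 2) dA := by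
  simp_rw [norm_ginibre_sq]
  exact integral_gaussian_dA.1.comp_sub_right z

lemma integrable_mul_of_sq {f g : ℂ → ℂ} (hf : Continuous f) (hg : Continuous g)
    (hf2 : Integrable (fun w => ‖f w‖ ^ 2) dA) (hg2 : Integrable (fun w => ‖g w‖ ^ 2) dA) :
    Integrable (fun w => f w * g w) dA := by
  refine (hf2.add hg2).mono' (hf.mul hg).aestronglyMeasurable (ae_of_all _ fun w => ?_)
  rw [norm_mul, Pi.add_apply]
  nlinarith [sq_nonneg (‖f w‖ - ‖g w‖), sq_nonneg ‖f w‖, sq_nonneg ‖g w‖]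

/-- The reproducing property of the Ginibre kernel in the Fock space. -/
lemma fock_reproducing {F : ℂ → ℂ} (hF : Differentiable ℂ F)
    (hi : Integrable (fun w => ‖F w * (Real.exp (-‖w‖ ^ 2 / 2) : ℂ)‖ ^ 2) dA) (z : ℂ) :
    ∫ w, ginibre z w * (F w * (Real.exp (-‖w‖ ^ 2 / 2) : ℂ)) ∂dA =
      F z * (Real.exp (-‖z‖ ^ 2 / 2) : ℂ) := by
  have hfc : Continuous fun w => F w * (Real.exp (-‖w‖ ^ 2 / 2) : ℂ) :=
    hF.continuous.mul (Complex.continuous_ofReal.comp (by fun_prop))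
  have h_int := integrable_mul_of_sq (continuous_ginibre_right z) hfc
    (integrable_norm_ginibre_sq z) hi
  -- Translating by `z` completes the square: what remains is the radial Gaussian times an entire
  -- function of `u` whose value at `0` is `F z`, so the mean value property applies.
  have hpt : ∀ u, ginibre z (u + z) * (F (u + z) * (Real.exp (-‖u + z‖ ^ 2 / 2) : ℂ)) =
      (Real.exp (-‖z‖ ^ 2 / 2) : ℂ) *
        (F (u + z) * Complex.exp (-(conj z * u)) * (Real.exp (-‖u‖ ^ 2) : ℂ)) := by
    intro u
    rw [ginibre]
    have e1 := norm_sq_add_complex u z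
    have e2 := norm_sq_add_complex z 0
    have e3 := norm_sq_add_complex u 0
    simp only [add_zero, map_zero, mul_zero] at e2 e3
    have : Complex.exp (z * conj (u + z) - (‖z‖ : ℂ) ^ 2 / 2 - (‖u + z‖ : ℂ) ^ 2 / 2) *
        (Real.exp (-‖u + z‖ ^ 2 / 2) : ℂ) = (Real.exp (-‖z‖ ^ 2 / 2) : ℂ) *
        (Complex.exp (-(conj z * u)) * (Real.exp (-‖u‖ ^ 2) : ℂ)) := by
      push_cast
      rw [← Complex.exp_add, ← Complex.exp_add, ← Complex.exp_add]
      congr 1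
      rw [e1, e2, e3, map_add]; ring
    linear_combination F (u + z) * this
  have hne : (Real.exp (-‖z‖ ^ 2 / 2) : ℂ) ≠ 0 := by exact_mod_cast (Real.exp_pos _).ne'
  rw [← integral_add_right_eq_self _ z]
  have h_int' := h_int.comp_add_right z
  simp_rw [hpt] at h_int' ⊢
  have hint2 := h_int'.const_mul (Real.exp (-‖z‖ ^ 2 / 2) : ℂ)⁻¹
  simp_rw [inv_mul_cancel_left₀ hne] at hint2
  rw [integral_const_mul, integral_holomorphic_mul_radial
    (h := fun u => F (u + z) * Complex.exp (-(conj z * u))) (g := fun y => Real.exp (-y ^ 2))]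
  · rw [integral_complex_ofReal, integral_gaussian_dA.2]
    simp [mul_comm]
  · exact ((hF.continuous.comp (by fun_prop)).mul (by fun_prop)).mul
      (Complex.continuous_ofReal.comp (by fun_prop))
  · exact hint2
  · intro u _
    refine Differentiable.diffContOnCl ?_
    exact (hF.comp (by fun_prop)).mul (by fun_prop)

/-- The quadratic form of a kernel. -/
noncomputable def quadForm (K : ℂ → ℂ → ℂ) {N : ℕ} (z a : Fin N → ℂ) : ℂ :=
  ∑ j, ∑ l, a j * conj (a l) * K (z j) (z l)

lemma quadForm_im_eq_zero {K : ℂ → ℂ → ℂ} (hK : ∀ z w, K z w = conj (K w z)) {N : ℕ}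
    (z a : Fin N → ℂ) : (quadForm K z a).im = 0 := by
  rw [← Complex.conj_eq_iff_im]
  simp only [quadForm, map_sum]
  rw [Finset.sum_comm]
  refine Finset.sum_congr rfl fun j _ => Finset.sum_congr rfl fun l _ => ?_
  rw [hK (z j) (z l)]
  simp [mul_comm]

/-- Pairing a function with combinations of the Ginibre kernel. -/
lemma integral_conj_combination {N : ℕ} (z a : Fin N → ℂ) {F : ℂ → ℂ} (hF : Differentiable ℂ F)
    (hi : Integrable (fun w => ‖F w * (Real.exp (-‖w‖ ^ 2 / 2) : ℂ)‖ ^ 2) dA) :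
    Integrable (fun w => conj (∑ l, conj (a l) * ginibre w (z l)) *
      (F w * (Real.exp (-‖w‖ ^ 2 / 2) : ℂ))) dA ∧
    ∫ w, conj (∑ l, conj (a l) * ginibre w (z l)) *
      (F w * (Real.exp (-‖w‖ ^ 2 / 2) : ℂ)) ∂dA =
      ∑ l, a l * (F (z l) * (Real.exp (-‖z l‖ ^ 2 / 2) : ℂ)) := by
  have hfc : Continuous fun w => F w * (Real.exp (-‖w‖ ^ 2 / 2) : ℂ) :=
    hF.continuous.mul (Complex.continuous_ofReal.comp (by fun_prop))
  have e : ∀ w, conj (∑ l, conj (a l) * ginibre w (z l)) *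
      (F w * (Real.exp (-‖w‖ ^ 2 / 2) : ℂ)) =
      ∑ l, a l * (ginibre (z l) w * (F w * (Real.exp (-‖w‖ ^ 2 / 2) : ℂ))) := by
    intro w
    rw [map_sum, Finset.sum_mul]
    refine Finset.sum_congr rfl fun l _ => ?_
    rw [map_mul, Complex.conj_conj, ginibre_conj]; ring
  simp_rw [e]
  have hl : ∀ l, Integrable (fun w => a l * (ginibre (z l) w *
      (F w * (Real.exp (-‖w‖ ^ 2 / 2) : ℂ)))) dA := fun l =>
    (integrable_mul_of_sq (continuous_ginibre_right (z l)) hfc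
      (integrable_norm_ginibre_sq (z l)) hi).const_mul _
  refine ⟨integrable_finsetSum _ fun l _ => hl l, ?_⟩
  rw [integral_finsetSum _ fun l _ => hl l]
  refine Finset.sum_congr rfl fun l _ => ?_
  rw [integral_const_mul, fock_reproducing hF hi]

/-- A kernel `K` of Fock type that satisfies the mass-one inequality is dominated by the Ginibre
kernel. -/
lemma quadForm_le_ginibre {K L : ℂ → ℂ → ℂ} (hL : ∀ z, Differentiable ℂ fun w => L w z)
    (hKL : ∀ z w, K w z = L w z * (Real.exp (-‖w‖ ^ 2 / 2) : ℂ)) {N : ℕ} (z a : Fin N → ℂ)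
    (hi : Integrable (fun w => ‖∑ l, conj (a l) * K w (z l)‖ ^ 2) dA)
    (hle : ∫ w, ‖∑ l, conj (a l) * K w (z l)‖ ^ 2 ∂dA ≤ (quadForm K z a).re) :
    (quadForm K z a).re ≤ (quadForm ginibre z a).re := by
  set F : ℂ → ℂ := fun w => ∑ l, conj (a l) * L w (z l) with hF
  set E : ℂ → ℂ := fun w => ∑ l, conj (a l) *
    (Complex.exp (w * conj (z l)) * Complex.exp (-(‖z l‖ : ℂ) ^ 2 / 2)) with hE
  have hFd : Differentiable ℂ F := by
    refine Differentiable.fun_sum fun l _ => (hL (z l)).const_mul _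
  have hEd : Differentiable ℂ E := by
    refine Differentiable.fun_sum fun l _ => ?_
    fun_prop
  have hFe : ∀ w, F w * (Real.exp (-‖w‖ ^ 2 / 2) : ℂ) = ∑ l, conj (a l) * K w (z l) := by
    intro w
    rw [hF, Finset.sum_mul]
    refine Finset.sum_congr rfl fun l _ => ?_
    rw [hKL]; ring
  have hEe : ∀ w, E w * (Real.exp (-‖w‖ ^ 2 / 2) : ℂ) = ∑ l, conj (a l) * ginibre w (z l) := by
    intro w
    rw [hE, Finset.sum_mul]
    refine Finset.sum_congr rfl fun l _ => ?_
    rw [ginibre_eq]; ring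
  set f : ℂ → ℂ := fun w => ∑ l, conj (a l) * K w (z l) with hf
  set g : ℂ → ℂ := fun w => ∑ l, conj (a l) * ginibre w (z l) with hg
  have hgc : Continuous g := continuous_finsetSum _ fun l _ =>
    continuous_const.mul (continuous_ginibre_left (z l))
  have hg2 : Integrable (fun w => ‖g w‖ ^ 2) dA := by
    refine (integrable_finsetSum Finset.univ (μ := dA)
      (f := fun l w => ‖a l‖ ^ 2 * ‖ginibre (z l) w‖ ^ 2)
      (fun l _ => (integrable_norm_ginibre_sq (z l)).const_mul _)).const_mul (N : ℝ) |>.mono'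
      (by fun_prop) (ae_of_all _ fun w => ?_)
    rw [Real.norm_of_nonneg (by positivity)]
    have h1 : ‖g w‖ ≤ ∑ l, ‖a l‖ * ‖ginibre (z l) w‖ := by
      refine (norm_sum_le _ _).trans (le_of_eq (Finset.sum_congr rfl fun l _ => ?_))
      rw [norm_mul, RCLike.norm_conj, ← ginibre_conj, RCLike.norm_conj]
    calc ‖g w‖ ^ 2 ≤ (∑ l, ‖a l‖ * ‖ginibre (z l) w‖) ^ 2 := by gcongr
      _ ≤ (Finset.univ : Finset (Fin N)).card * ∑ l, (‖a l‖ * ‖ginibre (z l) w‖) ^ 2 :=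
        sq_sum_le_card_mul_sum_sq
      _ = _ := by simp [mul_pow]
  obtain ⟨i1, e1⟩ := integral_conj_combination z a hFd (by simpa only [hFe] using hi)
  obtain ⟨i2, e2⟩ := integral_conj_combination z a hEd (by simpa only [hEe] using hg2)
  simp only [hFe] at i1 e1
  simp only [hEe] at i2 e2
  have q1 : ∑ l, a l * f (z l) = quadForm K z a := by
    simp only [hf, quadForm, Finset.mul_sum]
    exact Finset.sum_congr rfl fun j _ => Finset.sum_congr rfl fun l _ => by ring
  have q2 : ∑ l, a l * g (z l) = quadForm ginibre z a := by
    simp only [hg, quadForm, Finset.mul_sum]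
    exact Finset.sum_congr rfl fun j _ => Finset.sum_congr rfl fun l _ => by ring
  have r1 : ∫ w, (conj (g w) * f w).re ∂dA = (quadForm K z a).re := by
    rw [← q1, ← e1]; exact integral_re i1
  have r2 : ∫ w, ‖g w‖ ^ 2 ∂dA = (quadForm ginibre z a).re := by
    rw [← q2, ← e2]
    have := integral_re i2
    rw [← RCLike.re_eq_complex_re, ← this]
    refine integral_congr_ae (ae_of_all _ fun w => ?_)
    simp only
    rw [mul_comm, Complex.mul_conj, Complex.normSq_eq_norm_sq]
    exact (Complex.ofReal_re _).symm
  -- Expanding gives $\|f\|^2-2q_K+q_G\ge0$, and $\|f\|^2\le q_K$ by assumption.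
  have hnn : 0 ≤ ∫ w, ‖f w - g w‖ ^ 2 ∂dA := integral_nonneg fun w => by positivity
  have hexp : ∀ w, ‖f w - g w‖ ^ 2 = ‖f w‖ ^ 2 - 2 * (conj (g w) * f w).re + ‖g w‖ ^ 2 := by
    intro w
    rw [← Complex.normSq_eq_norm_sq, ← Complex.normSq_eq_norm_sq, ← Complex.normSq_eq_norm_sq,
      Complex.normSq_sub]
    rw [mul_comm (conj (g w))]; ring
  have i1r : Integrable (fun w => 2 * (conj (g w) * f w).re) dA := (i1.re).const_mul 2
  simp_rw [hexp] at hnn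
  have hi' : Integrable (fun w => ‖f w‖ ^ 2) dA := hi
  have hsub : Integrable (fun w => ‖f w‖ ^ 2 - 2 * (conj (g w) * f w).re) dA := hi'.sub i1r
  have hle' : ∫ w, ‖f w‖ ^ 2 ∂dA ≤ (quadForm K z a).re := hle
  rw [integral_add hsub hg2, integral_sub hi' i1r, integral_const_mul, r1, r2] at hnn
  linarith

/-! ### Weighted kernels of orthonormal systems -/

/-- The weighted kernel `k(z,w) √W(z) √W(w)`. -/
noncomputable def weightedKernel (n : ℕ) (f : ℕ → ℂ[X]) (W : ℂ → ℝ) (z w : ℂ) : ℂ :=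
  polyKernel n f z w * (Real.sqrt (W z) : ℂ) * (Real.sqrt (W w) : ℂ)

/-- Fatou's lemma for the mass-one equation. -/
lemma integrable_combination_of_tendsto {n : ℕ → ℕ} {W : ℕ → ℂ → ℝ} {f : ℕ → ℕ → ℂ[X]}
    (S : ∀ k, OrthoSystem (n k) (W k) (f k)) {u : ℕ → ℂ → ℂ} (hu : ∀ k z, ‖u k z‖ = 1)
    {K : ℂ → ℂ → ℂ}
    (hlim : ∀ z w, Tendsto (fun k => u k z * conj (u k w) * weightedKernel (n k) (f k) (W k) z w)
      atTop (𝓝 (K z w)))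
    (hKc : ∀ z, Continuous fun w => K w z) {N : ℕ} (z a : Fin N → ℂ) :
    Integrable (fun w => ‖∑ l, conj (a l) * K w (z l)‖ ^ 2) dA ∧
      ∫ w, ‖∑ l, conj (a l) * K w (z l)‖ ^ 2 ∂dA ≤ (quadForm K z a).re := by
  set Kk : ℕ → ℂ → ℂ → ℂ := fun k z w =>
    u k z * conj (u k w) * weightedKernel (n k) (f k) (W k) z w with hKk
  -- The phase `u k w` disappears in the modulus, and the two factors `√(W k w)` combine into the
  -- weight required by the reproducing property.
  have hpt : ∀ k w, ((‖∑ l, conj (a l) * Kk k w (z l)‖ ^ 2 : ℝ) : ℂ) =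
      ∑ j, ∑ l, (a j * u k (z j) * (Real.sqrt (W k (z j)) : ℂ)) *
        (conj (a l) * conj (u k (z l)) * (Real.sqrt (W k (z l)) : ℂ)) *
        (polyKernel (n k) (f k) (z j) w * polyKernel (n k) (f k) w (z l) * (W k w : ℂ)) := by
    intro k w
    rw [← Complex.normSq_eq_norm_sq, ← Complex.mul_conj, mul_comm, map_sum, Finset.sum_mul_sum]
    refine Finset.sum_congr rfl fun j _ => Finset.sum_congr rfl fun l _ => ?_
    have e1 : (Real.sqrt (W k w) : ℂ) * (Real.sqrt (W k w) : ℂ) = (W k w : ℂ) := by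
      rw [← Complex.ofReal_mul, Real.mul_self_sqrt ((S k).nonneg w)]
    have e2 : u k w * conj (u k w) = 1 := by
      rw [Complex.mul_conj, Complex.normSq_eq_norm_sq, hu]; simp
    simp only [hKk, weightedKernel, map_mul, Complex.conj_conj, polyKernel_conj,
      Complex.conj_ofReal]
    rw [← e1]
    linear_combination (a j * u k (z j) * (Real.sqrt (W k (z j)) : ℂ)) *
        (conj (a l) * conj (u k (z l)) * (Real.sqrt (W k (z l)) : ℂ)) *
        (polyKernel (n k) (f k) (z j) w * polyKernel (n k) (f k) w (z l) *
        ((Real.sqrt (W k w) : ℂ) * (Real.sqrt (W k w) : ℂ))) * e2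
  have h_int : ∀ k, Integrable (fun w => ((‖∑ l, conj (a l) * Kk k w (z l)‖ ^ 2 : ℝ) : ℂ)) dA := by
    intro k
    simp_rw [hpt]
    exact integrable_finsetSum _ fun j _ => integrable_finsetSum _ fun l _ =>
      ((S k).integrable_kernel_mul _ _).const_mul _
  have hval : ∀ k, ∫ w, ‖∑ l, conj (a l) * Kk k w (z l)‖ ^ 2 ∂dA = (quadForm (Kk k) z a).re := by
    intro k
    have : ((∫ w, ‖∑ l, conj (a l) * Kk k w (z l)‖ ^ 2 ∂dA : ℝ) : ℂ) = quadForm (Kk k) z a := by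
      rw [← integral_complex_ofReal]
      simp_rw [hpt]
      rw [integral_finsetSum _ fun j _ => integrable_finsetSum _ fun l _ =>
        ((S k).integrable_kernel_mul _ _).const_mul _]
      refine Finset.sum_congr rfl fun j _ => ?_
      rw [integral_finsetSum _ fun l _ => ((S k).integrable_kernel_mul _ _).const_mul _]
      refine Finset.sum_congr rfl fun l _ => ?_
      rw [integral_const_mul, (S k).integral_kernel_mul]
      simp only [hKk, weightedKernel]
      ring
    rw [← this, Complex.ofReal_re]
  have hintR : ∀ k, Integrable (fun w => ‖∑ l, conj (a l) * Kk k w (z l)‖ ^ 2) dA := fun k => by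
    refine (h_int k).re.congr (ae_of_all _ fun w => ?_)
    exact Complex.ofReal_re _
  have hq : Tendsto (fun k => (quadForm (Kk k) z a).re) atTop (𝓝 (quadForm K z a).re) := by
    refine (Complex.continuous_re.tendsto _).comp ?_
    refine tendsto_finsetSum _ fun j _ => tendsto_finsetSum _ fun l _ => ?_
    exact (hlim (z j) (z l)).const_mul _
  have hcont : Continuous fun w => ‖∑ l, conj (a l) * K w (z l)‖ ^ 2 :=
    (continuous_finsetSum _ fun l _ => continuous_const.mul (hKc (z l))).norm.pow 2
  -- Convergence is only local, so mass may escape to infinity and just an inequality survives.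
  have hF : ∫⁻ w, ENNReal.ofReal (‖∑ l, conj (a l) * K w (z l)‖ ^ 2) ∂dA ≤
      ENNReal.ofReal (quadForm K z a).re := by
    have hpw : ∀ w, Tendsto (fun k => ENNReal.ofReal (‖∑ l, conj (a l) * Kk k w (z l)‖ ^ 2)) atTop
        (𝓝 (ENNReal.ofReal (‖∑ l, conj (a l) * K w (z l)‖ ^ 2))) := by
      intro w
      refine ENNReal.tendsto_ofReal (Tendsto.pow (Tendsto.norm ?_) 2)
      exact tendsto_finsetSum _ fun l _ => (hlim w (z l)).const_mul _
    calc ∫⁻ w, ENNReal.ofReal (‖∑ l, conj (a l) * K w (z l)‖ ^ 2) ∂dA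
        = ∫⁻ w, liminf (fun k => ENNReal.ofReal (‖∑ l, conj (a l) * Kk k w (z l)‖ ^ 2)) atTop ∂dA :=
          lintegral_congr fun w => (hpw w).liminf_eq.symm
      _ ≤ liminf (fun k => ∫⁻ w, ENNReal.ofReal (‖∑ l, conj (a l) * Kk k w (z l)‖ ^ 2) ∂dA) atTop :=
          lintegral_liminf_le' fun k => (hintR k).aestronglyMeasurable.aemeasurable.ennreal_ofReal
      _ = liminf (fun k => ENNReal.ofReal (quadForm (Kk k) z a).re) atTop := by
          congr 1; ext k
          rw [← hval, ofReal_integral_eq_lintegral_ofReal (hintR k)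
            (ae_of_all _ fun w => by positivity)]
      _ = _ := (ENNReal.tendsto_ofReal hq).liminf_eq
  have hi : Integrable (fun w => ‖∑ l, conj (a l) * K w (z l)‖ ^ 2) dA := by
    refine ⟨hcont.aestronglyMeasurable, ?_⟩
    rw [hasFiniteIntegral_iff_ofReal (ae_of_all _ fun w => by positivity)]
    exact hF.trans_lt ENNReal.ofReal_lt_top
  refine ⟨hi, ?_⟩
  have hq0 : 0 ≤ (quadForm K z a).re := by
    refine ge_of_tendsto' hq fun k => ?_
    rw [← hval]; exact integral_nonneg fun w => by positivity
  rw [integral_eq_lintegral_of_nonneg_ae (ae_of_all _ fun w => by positivity)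
    hcont.aestronglyMeasurable]
  exact ENNReal.toReal_le_of_le_ofReal hq0 hF

/-! ### The operator `∂` on real functions -/

lemma del_ofReal_of_hasFDerivAt {v : ℂ → ℝ} {v' : ℂ →L[ℝ] ℝ} {z A : ℂ}
    (h : HasFDerivAt v v' z) (hA : ∀ w, v' w = 2 * (A * w).re) :
    del (fun x => (v x : ℂ)) z = A := by
  have h1 : HasFDerivAt (fun x => (v x : ℂ)) (Complex.ofRealCLM.comp v') z :=
    Complex.ofRealCLM.hasFDerivAt.comp z h
  rw [del, h1.fderiv]
  simp only [ContinuousLinearMap.comp_apply, hA, Complex.ofRealCLM_apply, Complex.ofReal_mul]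
  apply Complex.ext <;> simp

lemma fderiv_eq_del {v : ℂ → ℝ} {z : ℂ} (h : DifferentiableAt ℝ v z) (w : ℂ) :
    fderiv ℝ v z w = 2 * (del (fun x => (v x : ℂ)) z * w).re := by
  have h1 : HasFDerivAt (fun x => (v x : ℂ)) (Complex.ofRealCLM.comp (fderiv ℝ v z)) z :=
    Complex.ofRealCLM.hasFDerivAt.comp z h.hasFDerivAt
  have h2 : fderiv ℝ v z w = w.re * fderiv ℝ v z 1 + w.im * fderiv ℝ v z Complex.I := by
    conv_lhs => rw [← Complex.re_add_im w]
    rw [map_add, ← smul_eq_mul (w.re), ← smul_eq_mul (w.im), ← map_smul, ← map_smul]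
    simp
  rw [h2, del, h1.fderiv]
  simp
  ring

lemma del_sub {f g : ℂ → ℂ} {z : ℂ} (hf : DifferentiableAt ℝ f z) (hg : DifferentiableAt ℝ g z) :
    del (fun x => f x - g x) z = del f z - del g z := by
  simp only [del]
  rw [fderiv_fun_sub hf hg]
  simp
  ring

/-! ### One-point functions and Berezin kernels of orthonormal systems -/

/-- The one-point function `k(z,z) W(z)` of an orthonormal system. -/
noncomputable def density (n : ℕ) (f : ℕ → ℂ[X]) (W : ℂ → ℝ) (z : ℂ) : ℝ :=
  (polyKernel n f z z).re * W z

/-- The Berezin kernel `|k(z,w)|² W(w) / k(z,z)` of an orthonormal system. -/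
noncomputable def systemBerezin (n : ℕ) (f : ℕ → ℂ[X]) (W : ℂ → ℝ) (z w : ℂ) : ℝ :=
  ‖polyKernel n f z w‖ ^ 2 * W w / (polyKernel n f z z).re

lemma polyKernel_self_re (n : ℕ) (f : ℕ → ℂ[X]) (z : ℂ) :
    ((polyKernel n f z z).re : ℂ) = polyKernel n f z z := by
  rw [polyKernel_self, Complex.ofReal_re]

lemma polyKernel_self_re_nonneg (n : ℕ) (f : ℕ → ℂ[X]) (z : ℂ) :
    0 ≤ (polyKernel n f z z).re := by
  rw [polyKernel_self, Complex.ofReal_re]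
  positivity

lemma polyKernel_mul_swap (n : ℕ) (f : ℕ → ℂ[X]) (z w : ℂ) :
    polyKernel n f z w * polyKernel n f w z = ((‖polyKernel n f z w‖ ^ 2 : ℝ) : ℂ) := by
  rw [← polyKernel_conj n f z w, Complex.mul_conj, Complex.normSq_eq_norm_sq]

lemma contDiff_polyKernel_diag (n : ℕ) (f : ℕ → ℂ[X]) :
    ContDiff ℝ ∞ fun z => (polyKernel n f z z).re := by
  have hp : ∀ p : ℂ[X], ContDiff ℝ ∞ fun z => p.eval z := fun p => by
    have : ContDiff ℂ ∞ fun z => aeval z p := contDiff_aeval p ∞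
    simpa using this.restrict_scalars ℝ
  refine Complex.reCLM.contDiff.comp ?_
  unfold polyKernel
  refine ContDiff.sum fun j _ => (hp (f j)).mul ?_
  exact Complex.conjCLE.contDiff.comp (hp (f j))

/-- In each $f_j\overline{f_j}$ the operator $\partial$ sees only the holomorphic factor. The sum
that appears is the right-hand side of `OrthoSystem.ward`. -/
lemma fderiv_polyKernel_diag (n : ℕ) (f : ℕ → ℂ[X]) (z w : ℂ) :
    fderiv ℝ (fun z => (polyKernel n f z z).re) z w =
      2 * ((∑ j ∈ Finset.range n, (derivative (f j)).eval z * conj ((f j).eval z)) * w).re := by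
  have hd : DifferentiableAt ℝ (fun z => (polyKernel n f z z).re) z :=
    (contDiff_polyKernel_diag n f).differentiable (by simp) z
  have h1 := hd.hasFDerivAt.hasLineDerivAt w
  have l1 : HasDerivAt (fun t : ℝ => z + t • w) w 0 := by
    simpa using ((hasDerivAt_id (0 : ℝ)).smul_const w).const_add z
  have l2 : ∀ p : ℂ[X], HasDerivAt (fun t : ℝ => p.eval (z + t • w))
      ((derivative p).eval z * w) 0 := by
    intro p
    have hp : HasDerivAt (fun x => p.eval x) ((derivative p).eval (z + (0 : ℝ) • w))
      (z + (0 : ℝ) • w) := p.hasDerivAt _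
    have := hp.comp (0 : ℝ) l1
    simpa [Function.comp_def] using this
  have l3 : ∀ p : ℂ[X], HasDerivAt (fun t : ℝ => conj (p.eval (z + t • w)))
      (conj ((derivative p).eval z * w)) 0 := by
    intro p
    have := Complex.conjCLE.hasFDerivAt.comp_hasDerivAt (0 : ℝ) (l2 p)
    simpa [Function.comp_def] using! this
  have l4 : HasDerivAt (fun t : ℝ => polyKernel n f (z + t • w) (z + t • w))
      (∑ j ∈ Finset.range n, ((derivative (f j)).eval z * w * conj ((f j).eval z) +
        (f j).eval z * conj ((derivative (f j)).eval z * w))) 0 := by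
    have := HasDerivAt.fun_sum (u := Finset.range n) fun j _ => (l2 (f j)).mul (l3 (f j))
    simpa [polyKernel] using! this
  have l5 := Complex.reCLM.hasFDerivAt.comp_hasDerivAt (0 : ℝ) l4
  have := HasDerivAt.unique h1 l5
  rw [this, Finset.sum_mul]
  simp only [Complex.reCLM_apply, Complex.re_sum, Finset.mul_sum]
  refine Finset.sum_congr rfl fun j _ => ?_
  simp
  ring

namespace OrthoSystem

variable {n : ℕ} {W : ℂ → ℝ} {f : ℕ → ℂ[X]}

lemma density_nonneg (S : OrthoSystem n W f) (z : ℂ) : 0 ≤ density n f W z :=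
  mul_nonneg (polyKernel_self_re_nonneg n f z) (S.nonneg z)

lemma integrable_density (S : OrthoSystem n W f)
    : Integrable (fun w => (density n f W w : ℂ)) dA := by
  refine S.integrable_kernel_diag.congr (ae_of_all _ fun w => ?_)
  simp only [density]
  push_cast
  rw [polyKernel_self_re]

lemma berezin_nonneg (S : OrthoSystem n W f) (z w : ℂ) : 0 ≤ systemBerezin n f W z w :=
  div_nonneg (mul_nonneg (by positivity) (S.nonneg w)) (polyKernel_self_re_nonneg n f z)

/-- Cauchy–Schwarz for the kernel. The bound does not involve the density at `z`, so it remains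
useful where that density degenerates in the limit. -/
lemma berezin_le (S : OrthoSystem n W f)
    (hn : 0 < n) (z w : ℂ) : systemBerezin n f W z w ≤ density n f W w := by
  rw [systemBerezin, div_le_iff₀ (S.kernel_pos hn z), density]
  have := mul_le_mul_of_nonneg_right (norm_polyKernel_sq_le n f z w) (S.nonneg w)
  linarith

lemma integrable_berezin (S : OrthoSystem n W f)
    (z : ℂ) : Integrable (fun w => (systemBerezin n f W z w : ℂ)) dA := by
  refine ((S.integrable_kernel_mul z z).div_const (polyKernel n f z z)).congr
    (ae_of_all _ fun w => ?_)
  simp only [systemBerezin]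
  rw [polyKernel_mul_swap]
  push_cast
  rw [polyKernel_self_re]

lemma integral_berezin (S : OrthoSystem n W f)
    (hn : 0 < n) (z : ℂ) : ∫ w, systemBerezin n f W z w ∂dA = 1 := by
  have h := S.integral_kernel_mul z z
  have hne : polyKernel n f z z ≠ 0 := by
    have := (S.kernel_pos hn z).ne'
    intro h0; rw [h0] at this; simp at this
  have : ((∫ w, systemBerezin n f W z w ∂dA : ℝ) : ℂ) = 1 := by
    rw [← integral_complex_ofReal, ← div_self hne]
    conv_rhs => rw [← h]
    rw [div_eq_mul_inv, ← integral_mul_const]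
    simp_rw [← div_eq_mul_inv]
    rw [h]
    refine integral_congr_ae (ae_of_all _ fun w => ?_)
    simp only [systemBerezin]
    rw [polyKernel_mul_swap]
    push_cast
    rw [polyKernel_self_re]
  exact_mod_cast this

/-- Ward's identity in logarithmic form. -/
lemma del_log_kernel (S : OrthoSystem n W f) (hn : 0 < n) {z : ℂ} {r M : ℝ} (hr : 0 < r)
    (hM : ∀ w ∈ Metric.ball z r, density n f W w ≤ M) :
    del (fun z => (Real.log (polyKernel n f z z).re : ℂ)) z =
      (∫ w, (density n f W w : ℂ) / (z - w) ∂dA) -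
        ∫ w, (systemBerezin n f W z w : ℂ) / (z - w) ∂dA := by
  have hpos := S.kernel_pos hn z
  have hne : polyKernel n f z z ≠ 0 := by
    intro h0; rw [h0] at hpos; simp at hpos
  have hd : DifferentiableAt ℝ (fun z => (polyKernel n f z z).re) z :=
    (contDiff_polyKernel_diag n f).differentiable (by simp) z
  have hi1 : Integrable (fun w => (density n f W w : ℂ) / (z - w)) dA := by
    refine integrable_div_cauchy (M := M) hr (fun w hw => ?_) S.integrable_density
    rw [Complex.norm_real, Real.norm_of_nonneg (S.density_nonneg w)]
    exact hM w hw
  have hi2 : Integrable (fun w => (systemBerezin n f W z w : ℂ) / (z - w)) dA := by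
    refine integrable_div_cauchy (M := M) hr (fun w hw => ?_) (S.integrable_berezin z)
    rw [Complex.norm_real, Real.norm_of_nonneg (S.berezin_nonneg z w)]
    exact (S.berezin_le hn z w).trans (hM w hw)
  -- In Ward's identity the singularity at $w=z$ cancels; the bound `M` near `z` is what lets the
  -- integral be split into two convergent ones.
  have hw : (∫ w, (density n f W w : ℂ) / (z - w) ∂dA) -
        ∫ w, (systemBerezin n f W z w : ℂ) / (z - w) ∂dA =
      (∑ j ∈ Finset.range n, (derivative (f j)).eval z * conj ((f j).eval z)) /
        polyKernel n f z z := by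
    rw [← integral_sub hi1 hi2, ← S.ward z, div_eq_mul_inv, ← integral_mul_const]
    refine integral_congr_ae (ae_of_all _ fun w => ?_)
    simp only [density, systemBerezin]
    rw [polyKernel_mul_swap]
    push_cast
    rw [polyKernel_self_re, polyKernel_self_re]
    field_simp
  rw [hw]
  refine del_ofReal_of_hasFDerivAt (hd.hasFDerivAt.log hpos.ne') fun w => ?_
  rw [smul_apply, fderiv_polyKernel_diag, ← polyKernel_self_re,
    div_mul_eq_mul_div, Complex.div_ofReal_re, smul_eq_mul, Complex.ofReal_re]
  ring

end OrthoSystem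

/-! ### Cauchy transforms away from the support -/

/-- The unit gap between the evaluation points and the support of `g` dominates the differentiated
integrand by `‖g w‖`. -/
lemma differentiableOn_cauchy_of_eq_zero {g : ℂ → ℂ} (hg : Integrable g dA) {a : ℂ}
    (h0 : ∀ w ∈ Metric.ball a 2, g w = 0) :
    DifferentiableOn ℂ (fun z => ∫ w, g w / (z - w) ∂dA) (Metric.ball a 1) := by
  intro z hz
  have hdist : ∀ x ∈ Metric.ball a 1, ∀ w, g w ≠ 0 → 1 ≤ ‖x - w‖ := by
    intro x hx w hw
    have h1 : 2 ≤ dist w a := by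
      by_contra h
      exact hw (h0 w (by simpa using h))
    have h2 : dist x a < 1 := hx
    have h3 := dist_triangle w x a
    rw [dist_comm w x, dist_eq_norm x w] at h3
    linarith
  have hmeas : ∀ x : ℂ, AEStronglyMeasurable (fun w => g w / (x - w)) dA := by
    intro x
    simp only [div_eq_mul_inv]
    exact hg.aestronglyMeasurable.mul
      (by fun_prop : Measurable fun w : ℂ => (x - w)⁻¹).aestronglyMeasurable
  have hmeas' : AEStronglyMeasurable (fun w => -g w / (z - w) ^ 2) dA := by
    simp only [div_eq_mul_inv]
    exact hg.aestronglyMeasurable.neg.mul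
      (by fun_prop : Measurable fun w : ℂ => ((z - w) ^ 2)⁻¹).aestronglyMeasurable
  have hbd : ∀ x ∈ Metric.ball a 1, ∀ w, ‖-g w / (x - w) ^ 2‖ ≤ ‖g w‖ := by
    intro x hx w
    by_cases hw : g w = 0
    · simp [hw]
    · have := hdist x hx w hw
      rw [norm_div, norm_neg, norm_pow]
      exact div_le_self (norm_nonneg _) (one_le_pow₀ this)
  have := hasDerivAt_integral_of_dominated_loc_of_deriv_le (μ := dA) (𝕜 := ℂ)
    (F := fun x w => g w / (x - w)) (F' := fun x w => -g w / (x - w) ^ 2) (x₀ := z)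
    (bound := fun w => ‖g w‖) (s := Metric.ball a 1)
    (Metric.isOpen_ball.mem_nhds hz) (Eventually.of_forall hmeas) ?_ hmeas'
    (ae_of_all _ fun w x hx => hbd x hx w) hg.norm ?_
  · exact this.2.differentiableAt.differentiableWithinAt
  · refine hg.mono (hmeas z) (ae_of_all _ fun w => ?_)
    by_cases hw : g w = 0
    · simp [hw]
    · rw [norm_div]
      exact div_le_self (norm_nonneg _) (hdist z hz w hw)
  · refine ae_of_all _ fun w x hx => ?_
    by_cases hw : g w = 0
    · simpa [hw] using hasDerivAt_const x (0 : ℂ)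
    · have hne : x - w ≠ 0 := by
        rw [← norm_pos_iff]; linarith [hdist x hx w hw]
      have := (((hasDerivAt_id x).sub_const w).inv hne).const_mul (g w)
      convert! this using 1
      simp; ring

/-! ### Limits of orthonormal systems -/

/-- Continuous convergence at the points of a compact set is uniform there. -/
lemma tendstoUniformlyOn_of_continuous_convergence {α β : Type*} [TopologicalSpace α]
    [PseudoMetricSpace β] {F : ℕ → α → β} {f : α → β} {E : Set α} (hE : IsCompact E)
    (hf : ContinuousOn f E)
    (h : ∀ x ∈ E, Tendsto (fun y : ℕ × α => F y.1 y.2) (atTop ×ˢ 𝓝 x) (𝓝 (f x))) :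
    TendstoUniformlyOn F f atTop E := by
  rw [← tendstoLocallyUniformlyOn_iff_tendstoUniformlyOn_of_compact hE,
    tendstoLocallyUniformlyOn_iff_forall_tendsto]
  intro x hx
  have h1 : Tendsto (fun y : ℕ × α => F y.1 y.2) (atTop ×ˢ 𝓝[E] x) (𝓝 (f x)) :=
    (h x hx).mono_left (prod_mono le_rfl nhdsWithin_le_nhds)
  have h2 : Tendsto (fun y : ℕ × α => f y.2) (atTop ×ˢ 𝓝[E] x) (𝓝 (f x)) :=
    (hf x hx).tendsto.comp tendsto_snd
  exact (h2.prodMk_nhds h1).mono_right (nhds_le_uniformity (f x))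

lemma Tendsto.pointwise_of_continuous_convergence {α β : Type*} [TopologicalSpace α]
    [TopologicalSpace β] {F : ℕ → α → β} {x : α} {b : β}
    (h : Tendsto (fun y : ℕ × α => F y.1 y.2) (atTop ×ˢ 𝓝 x) (𝓝 b)) :
    Tendsto (fun k => F k x) atTop (𝓝 b) :=
  h.comp (tendsto_id.prodMk (tendsto_const_nhds (x := x)))

/-- The kernel `K` is a locally uniform limit, up to unimodular factors, of the weighted kernels of
the orthonormal systems `f k` with weights `W k = e^{-V k}`, where `∂(V k) = ℓ k + z̄ + o(1)` with
`ℓ k` entire. -/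
structure IsLimitSystem (n : ℕ → ℕ) (W : ℕ → ℂ → ℝ) (f : ℕ → ℕ → ℂ[X]) (V : ℕ → ℂ → ℝ)
    (ℓ : ℕ → ℂ → ℂ) (K : ℂ → ℂ → ℂ) : Prop where
  system : ∀ k, OrthoSystem (n k) (W k) (f k)
  pos : ∀ k, 0 < n k
  kernel : ∀ x : ℂ × ℂ, Tendsto (fun y : ℕ × (ℂ × ℂ) =>
    ‖weightedKernel (n y.1) (f y.1) (W y.1) y.2.1 y.2.2‖) (atTop ×ˢ 𝓝 x) (𝓝 ‖K x.1 x.2‖)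
  diag : ∀ z : ℂ, Tendsto (fun y : ℕ × ℂ => density (n y.1) (f y.1) (W y.1) y.2)
    (atTop ×ˢ 𝓝 z) (𝓝 (onePoint K z))
  continuous : Continuous (Function.uncurry K)
  le_one : ∀ z, onePoint K z ≤ 1
  mass : ∀ z, 0 < onePoint K z → Integrable (berezin K z) dA ∧ ∫ w, berezin K z w ∂dA ≤ 1
  weight : ∀ ρ : ℝ, ∀ᶠ k in atTop, ContDiffOn ℝ 1 (V k) (Metric.ball 0 ρ) ∧
    ∀ z ∈ Metric.ball 0 ρ, W k z = Real.exp (-V k z)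
  holo : ∀ k, Differentiable ℂ (ℓ k)
  potential : ∀ z : ℂ, Tendsto (fun y : ℕ × ℂ =>
    del (fun x => (V y.1 x : ℂ)) y.2 - ℓ y.1 y.2 - conj y.2) (atTop ×ˢ 𝓝 z) (𝓝 0)

/-! ### Localization: splitting $\partial\log R_n$ into a controlled part and a holomorphic part. -/

/-- A smooth bump equal to one on the disc of radius `2` about `a`. -/
noncomputable def cutoff (a : ℂ) : ContDiffBump a := ⟨2, 3, by norm_num, by norm_num⟩

/-- The Cauchy transform of `g` cut off to a neighbourhood of `a`. -/
noncomputable def cutoffCauchy (a : ℂ) (g : ℂ → ℝ) (z : ℂ) : ℂ :=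
  ∫ w, ((cutoff a w * g w : ℝ) : ℂ) / (z - w) ∂dA

/-- The Cauchy transform of the Berezin kernel of an orthonormal system. -/
noncomputable def systemCauchy (n : ℕ) (f : ℕ → ℂ[X]) (W : ℂ → ℝ) (z : ℂ) : ℂ :=
  ∫ w, (systemBerezin n f W z w : ℂ) / (z - w) ∂dA

lemma norm_weightedKernel_sq {n : ℕ} {W : ℂ → ℝ} {f : ℕ → ℂ[X]} (S : OrthoSystem n W f) (z w : ℂ) :
    ‖weightedKernel n f W z w‖ ^ 2 = ‖polyKernel n f z w‖ ^ 2 * W z * W w := by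
  rw [weightedKernel, norm_mul, norm_mul, Complex.norm_real, Complex.norm_real,
    Real.norm_of_nonneg (Real.sqrt_nonneg _), Real.norm_of_nonneg (Real.sqrt_nonneg _), mul_pow,
    mul_pow, Real.sq_sqrt (S.nonneg z), Real.sq_sqrt (S.nonneg w)]

lemma systemBerezin_eq {n : ℕ} {W : ℂ → ℝ} {f : ℕ → ℂ[X]} (S : OrthoSystem n W f) (z w : ℂ)
    (h : density n f W z ≠ 0) :
    systemBerezin n f W z w = ‖weightedKernel n f W z w‖ ^ 2 / density n f W z := by
  rw [norm_weightedKernel_sq S, systemBerezin, density]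
  rw [density] at h
  have h1 := left_ne_zero_of_mul h
  have h2 := right_ne_zero_of_mul h
  field_simp

lemma cutoff_zero {a w : ℂ} (hw : w ∉ Metric.closedBall a 3) : cutoff a w = 0 := by
  refine (cutoff a).zero_of_le_dist ?_
  exact (not_le.1 hw).le

lemma cutoff_one {a w : ℂ} (hw : w ∈ Metric.ball a 2) : cutoff a w = 1 :=
  (cutoff a).one_of_mem_closedBall (Metric.ball_subset_closedBall hw)

lemma integrable_cutoff (a : ℂ) : Integrable (fun w => cutoff a w) dA :=
  (cutoff a).continuous.integrable_of_hasCompactSupport (cutoff a).hasCompactSupport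

/-- This is `norm_integral_div_cauchy_le` with radius `1`. The bound is uniform in `z` and linear in
`M`, so uniform convergence of densities on one closed disc gives uniform convergence of the cut-off
transforms. -/
lemma norm_cutoffCauchy_le {a : ℂ} {g : ℂ → ℝ} {M : ℝ}
    (hg : AEStronglyMeasurable g dA) (hM : ∀ w ∈ Metric.closedBall a 3, |g w| ≤ M) (z : ℂ) :
    Integrable (fun w => ((cutoff a w * g w : ℝ) : ℂ) / (z - w)) dA ∧
    ‖cutoffCauchy a g z‖ ≤ (2 + ∫ w, cutoff a w ∂dA) * M := by
  have hM0 : 0 ≤ M := (abs_nonneg _).trans (hM a (Metric.mem_closedBall_self (by norm_num)))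
  have hb : ∀ w, ‖((cutoff a w * g w : ℝ) : ℂ)‖ ≤ M * cutoff a w := by
    intro w
    rw [Complex.norm_real, Real.norm_eq_abs, abs_mul, abs_of_nonneg (cutoff a).nonneg, mul_comm]
    by_cases hw : w ∈ Metric.closedBall a 3
    · exact mul_le_mul_of_nonneg_right (hM w hw) (cutoff a).nonneg
    · simp [cutoff_zero hw]
  have h_int : Integrable (fun w => ((cutoff a w * g w : ℝ) : ℂ)) dA := by
    refine ((integrable_cutoff a).const_mul M).mono' ?_ (ae_of_all _ hb)
    exact Complex.continuous_ofReal.comp_aestronglyMeasurable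
      ((cutoff a).continuous.aestronglyMeasurable.mul hg)
  have hb1 : ∀ w ∈ Metric.ball z 1, ‖((cutoff a w * g w : ℝ) : ℂ)‖ ≤ M := fun w _ =>
    (hb w).trans (mul_le_of_le_one_right hM0 (cutoff a).le_one)
  refine ⟨integrable_div_cauchy one_pos hb1 h_int, ?_⟩
  refine (norm_integral_div_cauchy_le one_pos hb1 h_int).trans ?_
  have : ∫ w, ‖((cutoff a w * g w : ℝ) : ℂ)‖ ∂dA ≤ M * ∫ w, cutoff a w ∂dA := by
    rw [← integral_const_mul]
    exact integral_mono h_int.norm ((integrable_cutoff a).const_mul M) hb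
  linarith

/-- The part of `∂ log R` that converges with the kernels. -/
noncomputable def regularPart (n : ℕ) (f : ℕ → ℂ[X]) (W V : ℂ → ℝ) (ℓ : ℂ → ℂ) (a z : ℂ) : ℂ :=
  cutoffCauchy a (density n f W) z - systemCauchy n f W z - conj z -
    (del (fun x => (V x : ℂ)) z - ℓ z - conj z)

/-- The part of `∂ log R` that is holomorphic near `a`. -/
noncomputable def holoPart (n : ℕ) (f : ℕ → ℂ[X]) (W : ℂ → ℝ) (ℓ : ℂ → ℂ) (a z : ℂ) : ℂ :=
  (∫ w, (((1 - cutoff a w) * density n f W w : ℝ) : ℂ) / (z - w) ∂dA) - ℓ z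

lemma integrable_one_sub_cutoff {n : ℕ} {W : ℂ → ℝ} {f : ℕ → ℂ[X]} (S : OrthoSystem n W f)
    (a : ℂ) : Integrable (fun w => (((1 - cutoff a w) * density n f W w : ℝ) : ℂ)) dA := by
  have h := S.integrable_density
  refine h.mono (Complex.continuous_ofReal.comp_aestronglyMeasurable
    ((continuous_const.sub (cutoff a).continuous).aestronglyMeasurable.mul
      (Complex.continuous_re.comp_aestronglyMeasurable h.aestronglyMeasurable)))
    (ae_of_all _ fun w => ?_)
  simp only [Complex.norm_real, norm_mul]
  refine mul_le_of_le_one_left (norm_nonneg _) ?_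
  rw [Real.norm_of_nonneg (sub_nonneg.2 (cutoff a).le_one)]
  linarith [(cutoff a).nonneg (x := w)]

lemma differentiableOn_holoPart {n : ℕ} {W : ℂ → ℝ} {f : ℕ → ℂ[X]} (S : OrthoSystem n W f)
    {ℓ : ℂ → ℂ} (hℓ : Differentiable ℂ ℓ) (a : ℂ) :
    DifferentiableOn ℂ (holoPart n f W ℓ a) (Metric.ball a 1) := by
  refine DifferentiableOn.sub ?_ hℓ.differentiableOn
  refine differentiableOn_cauchy_of_eq_zero (integrable_one_sub_cutoff S a) fun w hw => ?_
  simp [cutoff_one hw]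

/-- Since $\log R=\log k(z,z)-V$, Ward's identity gives the derivative; the terms $\ell$ and $\bar
z$ are added and subtracted. The radii nest: unit discs about points of `ball a 1` stay where the
cutoff is one, and the cutoff lives where the density is bounded by `M`. -/
lemma del_log_density {n : ℕ} {W V : ℂ → ℝ} {f : ℕ → ℂ[X]} (S : OrthoSystem n W f) (hn : 0 < n)
    {ℓ : ℂ → ℂ} {a : ℂ} {M : ℝ} (hM : ∀ w ∈ Metric.closedBall a 3, density n f W w ≤ M)
    (hV : ContDiffOn ℝ 1 V (Metric.ball a 1))
    (hW : ∀ z ∈ Metric.ball a 1, W z = Real.exp (-V z)) :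
    (∀ z ∈ Metric.ball a 1, 0 < density n f W z) ∧
    ContDiffOn ℝ 1 (fun z => Real.log (density n f W z)) (Metric.ball a 1) ∧
    ∀ z ∈ Metric.ball a 1, del (fun z => (Real.log (density n f W z) : ℂ)) z =
      regularPart n f W V ℓ a z + holoPart n f W ℓ a z := by
  have hlog : ∀ z ∈ Metric.ball a 1, Real.log (density n f W z) =
      Real.log (polyKernel n f z z).re - V z := by
    intro z hz
    rw [density, hW z hz, Real.log_mul (S.kernel_pos hn z).ne' (Real.exp_pos _).ne', Real.log_exp]
    ring
  have hlk : ContDiff ℝ 1 fun z => Real.log (polyKernel n f z z).re :=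
    ((contDiff_polyKernel_diag n f).of_le (by norm_num)).log fun z => (S.kernel_pos hn z).ne'
  refine ⟨fun z hz => ?_, ?_, fun z hz => ?_⟩
  · rw [density, hW z hz]
    exact mul_pos (S.kernel_pos hn z) (Real.exp_pos _)
  · exact (hlk.contDiffOn.sub hV).congr hlog
  · have hev : (fun z => (Real.log (density n f W z) : ℂ)) =ᶠ[𝓝 z]
        fun z => (Real.log (polyKernel n f z z).re : ℂ) - (V z : ℂ) := by
      filter_upwards [Metric.isOpen_ball.mem_nhds hz] with x hx
      rw [hlog x hx]; push_cast; rfl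
    have hdV : DifferentiableAt ℝ V z :=
      (hV.differentiableOn one_ne_zero).differentiableAt (Metric.isOpen_ball.mem_nhds hz)
    have hdV' : DifferentiableAt ℝ (fun z => (V z : ℂ)) z :=
      Complex.ofRealCLM.differentiableAt.comp z hdV
    have hdl' : DifferentiableAt ℝ (fun z => (Real.log (polyKernel n f z z).re : ℂ)) z :=
      Complex.ofRealCLM.differentiableAt.comp z (hlk.differentiable one_ne_zero z)
    have e1 : del (fun z => (Real.log (density n f W z) : ℂ)) z =
        del (fun z => (Real.log (polyKernel n f z z).re : ℂ)) z - del (fun z => (V z : ℂ)) z := by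
      rw [← del_sub hdl' hdV']
      simp only [del, hev.fderiv_eq]
    have hball : ∀ w ∈ Metric.ball z 1, density n f W w ≤ M := fun w hw => by
      refine hM w ?_
      rw [Metric.mem_closedBall]
      have h1 : dist w z < 1 := hw
      have h2 : dist z a < 1 := hz
      linarith [dist_triangle w z a]
    rw [e1, S.del_log_kernel hn one_pos hball]
    have hmeas : AEStronglyMeasurable (density n f W) dA := by
      simpa using! Complex.continuous_re.comp_aestronglyMeasurable
        S.integrable_density.aestronglyMeasurable
    have hi1 := (norm_cutoffCauchy_le hmeas (a := a) (M := M) (fun w hw => by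
      rw [abs_of_nonneg (S.density_nonneg w)]; exact hM w hw) z).1
    have hi2 : Integrable (fun w => (((1 - cutoff a w) * density n f W w : ℝ) : ℂ) / (z - w)) dA := by
      refine integrable_div_cauchy (M := 0) one_pos (fun w hw => ?_) (integrable_one_sub_cutoff S a)
      have : w ∈ Metric.ball a 2 := by
        rw [Metric.mem_ball]
        have h1 : dist w z < 1 := hw
        have h2 : dist z a < 1 := hz
        linarith [dist_triangle w z a]
      simp [cutoff_one this]
    have e2 : ∫ w, (density n f W w : ℂ) / (z - w) ∂dA = cutoffCauchy a (density n f W) z +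
        ∫ w, (((1 - cutoff a w) * density n f W w : ℝ) : ℂ) / (z - w) ∂dA := by
      rw [cutoffCauchy, ← integral_add hi1 hi2]
      refine integral_congr_ae (ae_of_all _ fun w => ?_)
      simp only
      push_cast
      ring
    rw [e2, regularPart, holoPart, systemCauchy]
    ring

/-! ### Uniform convergence of densities, Berezin kernels and Cauchy transforms. -/

namespace IsLimitSystem

variable {n : ℕ → ℕ} {W : ℕ → ℂ → ℝ} {f : ℕ → ℕ → ℂ[X]} {V : ℕ → ℂ → ℝ} {ℓ : ℕ → ℂ → ℂ}
  {K : ℂ → ℂ → ℂ}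

lemma continuous_onePoint (H : IsLimitSystem n W f V ℓ K) : Continuous (onePoint K) := by
  unfold onePoint
  exact Complex.continuous_re.comp (H.continuous.comp (continuous_id.prodMk continuous_id))

lemma onePoint_nonneg (H : IsLimitSystem n W f V ℓ K) (z : ℂ) : 0 ≤ onePoint K z :=
  ge_of_tendsto' (Tendsto.pointwise_of_continuous_convergence (F := fun k z =>
    density (n k) (f k) (W k) z) (H.diag z)) fun k => (H.system k).density_nonneg z

lemma norm_sq_le (H : IsLimitSystem n W f V ℓ K)
    (z w : ℂ) : ‖K z w‖ ^ 2 ≤ onePoint K z * onePoint K w := by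
  have h1 := (Tendsto.pointwise_of_continuous_convergence (F := fun k (x : ℂ × ℂ) =>
    ‖weightedKernel (n k) (f k) (W k) x.1 x.2‖) (H.kernel (z, w))).pow 2
  have h2 := (Tendsto.pointwise_of_continuous_convergence (F := fun k z =>
    density (n k) (f k) (W k) z) (H.diag z)).mul (Tendsto.pointwise_of_continuous_convergence
    (F := fun k z => density (n k) (f k) (W k) z) (H.diag w))
  refine le_of_tendsto_of_tendsto' h1 h2 fun k => ?_
  have S := H.system k
  simp only
  rw [norm_weightedKernel_sq S, density, density]
  have := mul_le_mul_of_nonneg_right (norm_polyKernel_sq_le (n k) (f k) z w)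
    (mul_nonneg (S.nonneg z) (S.nonneg w))
  linarith

lemma berezin_le (H : IsLimitSystem n W f V ℓ K)
    {z : ℂ} (hz : 0 < onePoint K z) (w : ℂ) : berezin K z w ≤ 1 := by
  rw [berezin, div_le_one hz]
  exact (H.norm_sq_le z w).trans (mul_le_of_le_one_right hz.le (H.le_one w))

lemma tendstoUniformlyOn_density (H : IsLimitSystem n W f V ℓ K) {E : Set ℂ} (hE : IsCompact E) :
    TendstoUniformlyOn (fun k => density (n k) (f k) (W k)) (onePoint K) atTop E :=
  tendstoUniformlyOn_of_continuous_convergence hE H.continuous_onePoint.continuousOn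
    fun z _ => H.diag z

lemma eventually_density_le (H : IsLimitSystem n W f V ℓ K) {E : Set ℂ} (hE : IsCompact E) :
    ∀ᶠ k in atTop, ∀ z ∈ E, density (n k) (f k) (W k) z ≤ 2 := by
  have := Metric.tendstoUniformlyOn_iff.1 (H.tendstoUniformlyOn_density hE) 1 one_pos
  filter_upwards [this] with k hk z hz
  have h1 := hk z hz
  rw [Real.dist_eq, abs_lt] at h1
  linarith [H.le_one z]

lemma tendstoUniformlyOn_log (H : IsLimitSystem n W f V ℓ K)
    {E : Set ℂ} (hE : IsCompact E) (hpos : ∀ z ∈ E, 0 < onePoint K z) :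
    TendstoUniformlyOn (fun k z => Real.log (density (n k) (f k) (W k) z))
      (fun z => Real.log (onePoint K z)) atTop E :=
  tendstoUniformlyOn_of_continuous_convergence hE
    (H.continuous_onePoint.continuousOn.log fun z hz => (hpos z hz).ne')
    fun z hz => (H.diag z).log (hpos z hz).ne'

lemma tendstoUniformlyOn_berezin (H : IsLimitSystem n W f V ℓ K)
    {E : Set (ℂ × ℂ)} (hE : IsCompact E)
    (hpos : ∀ x ∈ E, 0 < onePoint K x.1) :
    TendstoUniformlyOn (fun k (x : ℂ × ℂ) => systemBerezin (n k) (f k) (W k) x.1 x.2)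
      (fun x => berezin K x.1 x.2) atTop E := by
  refine tendstoUniformlyOn_of_continuous_convergence hE ?_ fun x hx => ?_
  · unfold berezin
    refine ContinuousOn.div ?_ ?_ fun x hx => (hpos x hx).ne'
    · have : Continuous fun x : ℂ × ℂ => ‖K x.1 x.2‖ ^ 2 := H.continuous.norm.pow 2
      exact this.continuousOn
    · exact (H.continuous_onePoint.comp continuous_fst).continuousOn
  · have h1 : Tendsto (fun y : ℕ × (ℂ × ℂ) => density (n y.1) (f y.1) (W y.1) y.2.1)
        (atTop ×ˢ 𝓝 x) (𝓝 (onePoint K x.1)) := by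
      have := (H.diag x.1).comp (f := fun y : ℕ × (ℂ × ℂ) => (y.1, y.2.1)) (x := atTop ×ˢ 𝓝 x)
        (tendsto_fst.prodMk ((continuous_fst.tendsto x).comp tendsto_snd))
      exact this
    have h2 := ((H.kernel x).pow 2).div h1 (hpos x hx).ne'
    refine h2.congr' ?_
    filter_upwards [h1.eventually_ne (hpos x hx).ne'] with y hy
    exact (systemBerezin_eq (H.system y.1) _ _ hy).symm

/-- No tightness of the Berezin kernels is needed: both have mass at most one, so the decay of the
Cauchy kernel alone makes the tail small, while near `z` the kernels converge uniformly. -/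
lemma tendstoUniformlyOn_cauchy (H : IsLimitSystem n W f V ℓ K) {E : Set ℂ} (hE : IsCompact E)
    (hpos : ∀ z ∈ E, 0 < onePoint K z) :
    TendstoUniformlyOn (fun k => systemCauchy (n k) (f k) (W k)) (cauchyTransform K) atTop E := by
  rw [Metric.tendstoUniformlyOn_iff]
  intro ε hε
  obtain ⟨ρ, hρ⟩ := hE.isBounded.subset_closedBall (0 : ℂ)
  -- The tail costs at most $2/r=\varepsilon/4$, and the tolerance $\varepsilon/(8r)$ inside the
  -- disc costs $2r\cdot\varepsilon/(8r)=\varepsilon/4$.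
  set r : ℝ := 8 / ε with hr
  have hrpos : 0 < r := by positivity
  have hcpt : IsCompact (E ×ˢ Metric.closedBall (0 : ℂ) (ρ + r)) :=
    hE.prod (isCompact_closedBall _ _)
  have hδ : 0 < ε / (8 * r) := by positivity
  have hunif := Metric.tendstoUniformlyOn_iff.1
    (H.tendstoUniformlyOn_berezin hcpt fun x hx => hpos x.1 hx.1) _ hδ
  have hdens := H.eventually_density_le (isCompact_closedBall (0 : ℂ) (ρ + 1))
  filter_upwards [hunif, hdens] with k hk hd z hz
  have S := H.system k
  have hz0 : ‖z‖ ≤ ρ := by simpa using hρ hz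
  have hzR := hpos z hz
  obtain ⟨hi, hm⟩ := H.mass z hzR
  have hbn : ∀ w, 0 ≤ berezin K z w := fun w => by
    rw [berezin]; positivity
  have hi1 : Integrable (fun w => (berezin K z w : ℂ) / (z - w)) dA := by
    refine integrable_div_cauchy (M := 1) one_pos (fun w _ => ?_) hi.ofReal
    rw [Complex.norm_real, Real.norm_of_nonneg (hbn w)]
    exact H.berezin_le hzR w
  have hi2 : Integrable (fun w => (systemBerezin (n k) (f k) (W k) z w : ℂ) / (z - w)) dA := by
    refine integrable_div_cauchy (M := 2) one_pos (fun w hw => ?_) (S.integrable_berezin z)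
    rw [Complex.norm_real, Real.norm_of_nonneg (S.berezin_nonneg z w)]
    refine (S.berezin_le (H.pos k) z w).trans (hd w ?_)
    have : ‖w - z‖ < 1 := by simpa [dist_eq_norm] using hw
    rw [mem_closedBall_zero_iff]
    linarith [norm_le_norm_add_norm_sub' w z]
  have hiS : Integrable (fun w => systemBerezin (n k) (f k) (W k) z w) dA := by
    simpa using (S.integrable_berezin z).re
  rw [dist_eq_norm, cauchyTransform, systemCauchy, ← integral_sub hi1 hi2]
  have hsub : ∀ w, (berezin K z w : ℂ) / (z - w) -
      (systemBerezin (n k) (f k) (W k) z w : ℂ) / (z - w) =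
      ((berezin K z w - systemBerezin (n k) (f k) (W k) z w : ℝ) : ℂ) / (z - w) := by
    intro w; push_cast; ring
  simp_rw [hsub]
  have hb : ∀ w ∈ Metric.ball z r,
      ‖((berezin K z w - systemBerezin (n k) (f k) (W k) z w : ℝ) : ℂ)‖ ≤ ε / (8 * r) := by
    intro w hw
    have hw' : ‖w - z‖ < r := by simpa [dist_eq_norm] using hw
    have := hk (z, w) ⟨hz, by
      rw [mem_closedBall_zero_iff]; linarith [norm_le_norm_add_norm_sub' w z]⟩
    rw [Complex.norm_real, ← dist_eq_norm]
    exact this.le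
  refine (norm_integral_div_cauchy_le hrpos hb (hi.sub hiS).ofReal).trans_lt ?_
  have hmass : ∫ w, ‖((berezin K z w - systemBerezin (n k) (f k) (W k) z w : ℝ) : ℂ)‖ ∂dA ≤ 2 := by
    calc _ ≤ ∫ w, (berezin K z w + systemBerezin (n k) (f k) (W k) z w) ∂dA := by
          refine integral_mono (hi.sub hiS).ofReal.norm (hi.add hiS) fun w => ?_
          simp only [Complex.norm_real]
          refine (norm_sub_le _ _).trans ?_
          rw [Real.norm_of_nonneg (hbn w), Real.norm_of_nonneg (S.berezin_nonneg z w)]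
      _ ≤ 2 := by
          rw [integral_add hi hiS, S.integral_berezin (H.pos k)]
          linarith
  have h1 : 2 * r * (ε / (8 * r)) = ε / 4 := by field_simp; norm_num
  have h2 : r⁻¹ * ∫ w, ‖((berezin K z w - systemBerezin (n k) (f k) (W k) z w : ℝ) : ℂ)‖ ∂dA ≤
      ε / 4 := by
    calc _ ≤ r⁻¹ * 2 := by gcongr
      _ = ε / 4 := by rw [hr]; field_simp; norm_num
  linarith

lemma aestronglyMeasurable_density (H : IsLimitSystem n W f V ℓ K) (k : ℕ) :
    AEStronglyMeasurable (density (n k) (f k) (W k)) dA := by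
  simpa using! Complex.continuous_re.comp_aestronglyMeasurable
    (H.system k).integrable_density.aestronglyMeasurable

lemma tendstoUniformlyOn_cutoffCauchy (H : IsLimitSystem n W f V ℓ K) (a : ℂ) (E : Set ℂ) :
    TendstoUniformlyOn (fun k => cutoffCauchy a (density (n k) (f k) (W k)))
      (cutoffCauchy a (onePoint K)) atTop E := by
  rw [Metric.tendstoUniformlyOn_iff]
  intro ε hε
  have hc : 0 ≤ ∫ w, cutoff a w ∂dA := integral_nonneg fun w => (cutoff a).nonneg
  set m : ℝ := 2 + ∫ w, cutoff a w ∂dA with hm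
  have hmpos : 0 < m := by linarith
  have hδ : 0 < ε / (2 * m) := by positivity
  have hcpt := isCompact_closedBall a (3 : ℝ)
  filter_upwards [Metric.tendstoUniformlyOn_iff.1 (H.tendstoUniformlyOn_density hcpt) _ hδ,
    H.eventually_density_le hcpt] with k hk hd z _
  have S := H.system k
  have m1 := H.continuous_onePoint.aestronglyMeasurable (μ := dA)
  have m2 := H.aestronglyMeasurable_density k
  have i1 := (norm_cutoffCauchy_le (a := a) (M := 1) m1 (fun w _ => by
    rw [abs_of_nonneg (H.onePoint_nonneg w)]; exact H.le_one w) z).1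
  have i2 := (norm_cutoffCauchy_le (a := a) (M := 2) m2 (fun w hw => by
    rw [abs_of_nonneg (S.density_nonneg w)]; exact hd w hw) z).1
  have h3 := (norm_cutoffCauchy_le (a := a) (M := ε / (2 * m)) (m1.sub m2) (fun w hw => by
    have := hk w hw
    rw [Real.dist_eq] at this
    exact this.le) z).2
  have e : cutoffCauchy a (onePoint K) z - cutoffCauchy a (density (n k) (f k) (W k)) z =
      cutoffCauchy a (onePoint K - density (n k) (f k) (W k)) z := by
    simp only [cutoffCauchy]
    rw [← integral_sub i1 i2]
    refine integral_congr_ae (ae_of_all _ fun w => ?_)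
    simp only [Pi.sub_apply]
    push_cast
    ring
  rw [dist_eq_norm, e]
  refine h3.trans_lt ?_
  rw [← hm]
  have : m * (ε / (2 * m)) = ε / 2 := by field_simp
  linarith

lemma tendstoUniformlyOn_potential (H : IsLimitSystem n W f V ℓ K) {E : Set ℂ} (hE : IsCompact E) :
    TendstoUniformlyOn (fun k z => del (fun x => (V k x : ℂ)) z - ℓ k z - conj z)
      (fun _ => 0) atTop E :=
  tendstoUniformlyOn_of_continuous_convergence hE continuousOn_const fun z _ => H.potential z

lemma tendstoUniformlyOn_regularPart (H : IsLimitSystem n W f V ℓ K)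
    (a : ℂ) {E : Set ℂ} (hE : IsCompact E)
    (hpos : ∀ z ∈ E, 0 < onePoint K z) :
    TendstoUniformlyOn (fun k => regularPart (n k) (f k) (W k) (V k) (ℓ k) a)
      (fun z => cutoffCauchy a (onePoint K) z - cauchyTransform K z - conj z) atTop E := by
  have hconst : TendstoUniformlyOn (fun (_ : ℕ) (z : ℂ) => conj z) (fun z => conj z) atTop E := by
    rw [Metric.tendstoUniformlyOn_iff]
    intro ε hε
    exact Eventually.of_forall fun k z _ => by simpa using hε
  have := (((H.tendstoUniformlyOn_cutoffCauchy a E).sub (H.tendstoUniformlyOn_cauchy hE hpos)).sub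
    hconst).sub (H.tendstoUniformlyOn_potential hE)
  refine this.congr_right fun z _ => ?_
  simp

/-- Positivity of the limit is not required, which is essential for the zero-one law: the finite
Berezin kernel has mass one and is bounded by the density, hence by `2` nearby, so its Cauchy
transform is at most $2\cdot2+1=5$. -/
lemma eventually_regularPart_le (H : IsLimitSystem n W f V ℓ K) (a : ℂ) :
    ∃ B : ℝ, ∀ᶠ k in atTop, ∀ z ∈ Metric.ball a 1,
      ‖regularPart (n k) (f k) (W k) (V k) (ℓ k) a z‖ ≤ B := by
  have hcpt := isCompact_closedBall a (3 : ℝ)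
  refine ⟨(2 + ∫ w, cutoff a w ∂dA) * 2 + 5 + (‖a‖ + 1) + 1, ?_⟩
  filter_upwards [H.eventually_density_le hcpt,
    Metric.tendstoUniformlyOn_iff.1 (H.tendstoUniformlyOn_potential hcpt) 1 one_pos] with k hd he z hz
  have S := H.system k
  have hza : ‖z - a‖ < 1 := by simpa [dist_eq_norm] using hz
  have b1 := (norm_cutoffCauchy_le (a := a) (M := 2) (H.aestronglyMeasurable_density k)
    (fun w hw => by rw [abs_of_nonneg (S.density_nonneg w)]; exact hd w hw) z).2
  have b2 : ‖systemCauchy (n k) (f k) (W k) z‖ ≤ 5 := by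
    refine (norm_integral_div_cauchy_le (M := 2) one_pos (fun w hw => ?_)
      (S.integrable_berezin z)).trans ?_
    · rw [Complex.norm_real, Real.norm_of_nonneg (S.berezin_nonneg z w)]
      refine (S.berezin_le (H.pos k) z w).trans (hd w ?_)
      rw [Metric.mem_closedBall]
      have h1 : dist w z < 1 := hw
      have h2 : dist z a < 1 := hz
      linarith [dist_triangle w z a]
    · have : ∫ w, ‖(systemBerezin (n k) (f k) (W k) z w : ℂ)‖ ∂dA = 1 := by
        rw [← S.integral_berezin (H.pos k) z]
        refine integral_congr_ae (ae_of_all _ fun w => ?_)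
        simp only
        rw [Complex.norm_real, Real.norm_of_nonneg (S.berezin_nonneg z w)]
      rw [this]; norm_num
  have b3 : ‖conj z‖ ≤ ‖a‖ + 1 := by
    rw [RCLike.norm_conj]
    linarith [norm_le_norm_add_norm_sub' z a]
  have b4 : ‖del (fun x => (V k x : ℂ)) z - ℓ k z - conj z‖ ≤ 1 := by
    have := he z (Metric.mem_closedBall.2 (by have : dist z a < 1 := hz; linarith))
    rw [dist_zero_left] at this
    exact this.le
  rw [regularPart]
  refine (norm_sub_le _ _).trans (add_le_add ((norm_sub_le _ _).trans
    (add_le_add ((norm_sub_le _ _).trans (add_le_add b1 b2)) b3)) b4)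

/-- The decomposition of `∂ log R` near `a`. -/
lemma eventually_del_log (H : IsLimitSystem n W f V ℓ K) (a : ℂ) : ∀ᶠ k in atTop,
    (∀ z ∈ Metric.ball a 1, 0 < density (n k) (f k) (W k) z) ∧
    ContDiffOn ℝ 1 (fun z => Real.log (density (n k) (f k) (W k) z)) (Metric.ball a 1) ∧
    ∀ z ∈ Metric.ball a 1, del (fun z => (Real.log (density (n k) (f k) (W k) z) : ℂ)) z =
      regularPart (n k) (f k) (W k) (V k) (ℓ k) a z + holoPart (n k) (f k) (W k) (ℓ k) a z := by
  filter_upwards [H.eventually_density_le (isCompact_closedBall a (3 : ℝ)),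
    H.weight (‖a‖ + 1)] with k hd hw
  have hsub : Metric.ball a 1 ⊆ Metric.ball 0 (‖a‖ + 1) := by
    intro z hz
    have : ‖z - a‖ < 1 := by simpa [dist_eq_norm] using hz
    rw [mem_ball_zero_iff]
    linarith [norm_le_norm_add_norm_sub' z a]
  exact del_log_density (H.system k) (H.pos k) hd (hw.1.mono hsub) fun z hz => hw.2 z (hsub hz)

end IsLimitSystem

/-- The real differential `w ↦ 2 Re (D w)` of a real function with `∂v = D`. -/
noncomputable def realDifferential (D : ℂ) : ℂ →L[ℝ] ℝ :=
  (2 : ℝ) • Complex.reCLM.comp (ContinuousLinearMap.mul ℝ ℂ D)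

lemma realDifferential_apply (D w : ℂ) : realDifferential D w = 2 * (D * w).re := by
  simp [realDifferential]

lemma norm_realDifferential_le (D : ℂ) : ‖realDifferential D‖ ≤ 2 * ‖D‖ := by
  refine ContinuousLinearMap.opNorm_le_bound _ (by positivity) fun w => ?_
  rw [realDifferential_apply, norm_mul, Real.norm_ofNat, mul_assoc, ← norm_mul]
  gcongr
  exact Complex.abs_re_le_norm _

lemma realDifferential_sub (D D' : ℂ) :
    realDifferential D - realDifferential D' = realDifferential (D - D') := by
  refine ContinuousLinearMap.ext fun w => ?_
  simp [realDifferential_apply]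
  ring

lemma hasFDerivAt_realDifferential {v : ℂ → ℝ} {z : ℂ} (h : DifferentiableAt ℝ v z) :
    HasFDerivAt v (realDifferential (del (fun x => (v x : ℂ)) z)) z := by
  have : fderiv ℝ v z = realDifferential (del (fun x => (v x : ℂ)) z) :=
    ContinuousLinearMap.ext fun w => by rw [fderiv_eq_del h, realDifferential_apply]
  rw [← this]
  exact h.hasFDerivAt

lemma contDiffOn_ofReal {v : ℂ → ℝ} {U : Set ℂ} (h : ContDiffOn ℝ 1 v U) :
    ContDiffOn ℝ 1 (fun z => (v z : ℂ)) U :=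
  Complex.ofRealCLM.contDiff.comp_contDiffOn h

/-! ### Positivity across exceptional points and convergence of the holomorphic parts. -/

namespace IsLimitSystem

variable {n : ℕ → ℕ} {W : ℕ → ℂ → ℝ} {f : ℕ → ℕ → ℂ[X]} {V : ℕ → ℂ → ℝ} {ℓ : ℕ → ℂ → ℂ}
  {K : ℂ → ℂ → ℂ}

/-- If the limiting one-point function is positive on a small circle, it is positive at its
centre. -/
lemma onePoint_pos_of_sphere (H : IsLimitSystem n W f V ℓ K)
    {a : ℂ} {r : ℝ} (hr : 0 < r) (hr1 : r < 1 / 2)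
    (hs : ∀ z ∈ Metric.sphere a r, 0 < onePoint K z) : 0 < onePoint K a := by
  -- The bound for the holomorphic part needs `log` of the density on whole discs, so the circle is
  -- thickened to a compact collar where the limit is still positive.
  obtain ⟨δ₀, hδ₀, hth⟩ := (isCompact_sphere a r).exists_cthickening_subset_open
    (isOpen_lt continuous_const H.continuous_onePoint) (fun z hz => hs z hz)
  set δ : ℝ := min δ₀ (1 / 2) with hδdef
  have hδ : 0 < δ := lt_min hδ₀ (by norm_num)
  set E : Set ℂ := Metric.cthickening δ₀ (Metric.sphere a r) with hEdef
  have hE : IsCompact E := (isCompact_sphere a r).cthickening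
  have hballE : ∀ z ∈ Metric.sphere a r, Metric.ball z δ ⊆ E := by
    intro z hz w hw
    refine Metric.mem_cthickening_of_dist_le w z δ₀ _ hz ?_
    have : dist w z < δ := hw
    exact this.le.trans (min_le_left _ _)
  have hball1 : ∀ z ∈ Metric.sphere a r, Metric.ball z δ ⊆ Metric.ball a 1 := by
    intro z hz w hw
    have h1 : dist w z < δ := hw
    have h2 : dist z a = r := hz
    have h3 : δ ≤ 1 / 2 := min_le_right _ _
    rw [Metric.mem_ball]
    linarith [dist_triangle w z a]
  have hlogc : ContinuousOn (fun z => Real.log (onePoint K z)) E :=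
    H.continuous_onePoint.continuousOn.log fun z hz => (hth hz).ne'
  obtain ⟨A₀, hA₀⟩ := hE.exists_bound_of_continuousOn hlogc
  obtain ⟨B, hB⟩ := H.eventually_regularPart_le a
  obtain ⟨M, hM0, hM⟩ := exists_holomorphic_part_bound hδ
  have hlogk := Metric.tendstoUniformlyOn_iff.1
    (H.tendstoUniformlyOn_log hE fun z hz => hth hz) 1 one_pos
  set A : ℝ := A₀ + 1
  set D : ℝ := B + M * (A + B)
  have hb : a + r ∈ Metric.sphere a r := by simp [abs_of_pos hr]
  have key : ∀ᶠ k in atTop, Real.exp (-A - 2 * D * r) ≤ density (n k) (f k) (W k) a := by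
    filter_upwards [hB, hlogk, H.eventually_del_log a] with k hBk hlk hk
    obtain ⟨hpos, hC1, hdel⟩ := hk
    have hv : ∀ z ∈ E, ‖Real.log (density (n k) (f k) (W k) z)‖ ≤ A := by
      intro z hz
      have h1 := hlk z hz
      rw [dist_comm, dist_eq_norm] at h1
      have h2 := hA₀ z hz
      have h3 := norm_le_norm_add_norm_sub' (Real.log (density (n k) (f k) (W k) z))
        (Real.log (onePoint K z))
      linarith
    have hdiff := differentiableOn_holoPart (H.system k) (H.holo k) a
    have hsph : ∀ z ∈ Metric.sphere a r, ‖holoPart (n k) (f k) (W k) (ℓ k) a z‖ ≤ M * (A + B) := by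
      intro z hz
      refine hM z (fun z => (Real.log (density (n k) (f k) (W k) z) : ℂ)) _
        (regularPart (n k) (f k) (W k) (V k) (ℓ k) a) A B
        (contDiffOn_ofReal (hC1.mono (hball1 z hz))) (hdiff.mono (hball1 z hz))
        (fun w hw => hdel w (hball1 z hz hw)) (fun w hw => ?_) (fun w hw => hBk w (hball1 z hz hw))
      rw [Complex.norm_real]
      exact hv w (hballE z hz hw)
    have hcb : Metric.closedBall a r ⊆ Metric.ball a 1 :=
      Metric.closedBall_subset_ball (by linarith)
    -- Inside the disc the density has no lower bound yet, so the bound on the circle is carried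
    -- inwards by the maximum principle.
    have hin : ∀ z ∈ Metric.closedBall a r,
        ‖holoPart (n k) (f k) (W k) (ℓ k) a z‖ ≤ M * (A + B) := by
      intro z hz
      rw [← closure_ball a hr.ne'] at hz
      refine Complex.norm_le_of_forall_mem_frontier_norm_le Metric.isBounded_ball
        (DifferentiableOn.diffContOnCl ?_)
        (fun w hw => hsph w (Metric.frontier_ball_subset_sphere hw)) hz
      rw [closure_ball a hr.ne']
      exact hdiff.mono hcb
    have hd : ∀ z ∈ Metric.closedBall a r,
        DifferentiableAt ℝ (fun z => Real.log (density (n k) (f k) (W k) z)) z := fun z hz =>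
      (hC1.differentiableOn one_ne_zero).differentiableAt (Metric.isOpen_ball.mem_nhds (hcb hz))
    have hbound : ∀ z ∈ Metric.closedBall a r,
        ‖fderiv ℝ (fun z => Real.log (density (n k) (f k) (W k) z)) z‖ ≤ 2 * D := by
      intro z hz
      rw [(hasFDerivAt_realDifferential (hd z hz)).fderiv]
      refine (norm_realDifferential_le _).trans ?_
      rw [hdel z (hcb hz)]
      refine mul_le_mul_of_nonneg_left ((norm_add_le _ _).trans ?_) (by norm_num)
      exact add_le_add (hBk z (hcb hz)) (hin z hz)
    -- With the gradient of `log` of the density at most `2 * D`, comparison of the centre with the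
    -- boundary point `a + r` gives a lower bound independent of `k`.
    have hmv := (convex_closedBall a r).norm_image_sub_le_of_norm_fderiv_le (𝕜 := ℝ) hd hbound
      (Metric.mem_closedBall_self hr.le) (Metric.sphere_subset_closedBall hb)
    have hnr : ‖a + r - a‖ = r := by simp [abs_of_pos hr]
    rw [hnr] at hmv
    have h1 := hv _ (Metric.self_subset_cthickening _ hb)
    rw [Real.norm_eq_abs, abs_le] at h1 hmv
    rw [← Real.le_log_iff_exp_le (hpos a (Metric.mem_ball_self one_pos))]
    linarith [h1.1, hmv.2]
  have hlim := Tendsto.pointwise_of_continuous_convergence (F := fun k z =>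
    density (n k) (f k) (W k) z) (H.diag a)
  exact (Real.exp_pos _).trans_le (ge_of_tendsto hlim key)

/-- Where the limiting one-point function is positive, the holomorphic parts converge. -/
lemma exists_holomorphic_limit (H : IsLimitSystem n W f V ℓ K)
    (hpos : ∀ z, 0 < onePoint K z) (a : ℂ) :
    ∃ h : ℂ → ℂ, DifferentiableOn ℂ h (Metric.ball a (1 / 2)) ∧ ∀ z ∈ Metric.ball a (1 / 2),
      del (fun z => (Real.log (onePoint K z) : ℂ)) z =
        cutoffCauchy a (onePoint K) z - cauchyTransform K z - conj z + h z := by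
  obtain ⟨M, hM0, hM⟩ := exists_holomorphic_part_bound (δ := 1 / 4) (by norm_num)
  have hE := isCompact_closedBall a (3 / 4 : ℝ)
  have hE1 : Metric.closedBall a (3 / 4) ⊆ Metric.ball a 1 :=
    Metric.closedBall_subset_ball (by norm_num)
  have hT := H.tendstoUniformlyOn_regularPart a hE fun z _ => hpos z
  have hv := H.tendstoUniformlyOn_log hE fun z _ => hpos z
  have hev := H.eventually_del_log a
  have hballE : ∀ z ∈ Metric.ball a (1 / 2), Metric.ball z (1 / 4) ⊆ Metric.closedBall a (3 / 4) := by
    intro z hz w hw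
    have h1 : dist w z < 1 / 4 := hw
    have h2 : dist z a < 1 / 2 := hz
    rw [Metric.mem_closedBall]
    linarith [dist_triangle w z a]
  -- The decomposition is linear, so the holomorphic part bound applies to the difference of two
  -- indices: logarithms and regular parts are uniformly Cauchy, hence so are the holomorphic parts.
  have hcauchy : UniformCauchySeqOn (fun k => holoPart (n k) (f k) (W k) (ℓ k) a) atTop
      (Metric.ball a (1 / 2)) := by
    rw [Metric.uniformCauchySeqOn_iff]
    intro ε hε
    set η : ℝ := ε / (2 * M + 1) / 2 with hη
    have hηpos : 0 < η := by positivity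
    obtain ⟨N₁, hN₁⟩ := Metric.uniformCauchySeqOn_iff.1 hT.uniformCauchySeqOn η hηpos
    obtain ⟨N₂, hN₂⟩ := Metric.uniformCauchySeqOn_iff.1 hv.uniformCauchySeqOn η hηpos
    obtain ⟨N₃, hN₃⟩ := eventually_atTop.1 hev
    refine ⟨max N₁ (max N₂ N₃), fun k hk m hm z hz => ?_⟩
    obtain ⟨_, hkC, hkd⟩ := hN₃ k (le_trans (by simp) hk)
    obtain ⟨_, hmC, hmd⟩ := hN₃ m (le_trans (by simp) hm)
    have hsub : Metric.ball z (1 / 4) ⊆ Metric.ball a 1 := (hballE z hz).trans hE1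
    have hkC' := contDiffOn_ofReal (hkC.mono hsub)
    have hmC' := contDiffOn_ofReal (hmC.mono hsub)
    rw [dist_eq_norm]
    have := hM z (fun w => (Real.log (density (n k) (f k) (W k) w) : ℂ) -
        (Real.log (density (n m) (f m) (W m) w) : ℂ))
      (fun w => holoPart (n k) (f k) (W k) (ℓ k) a w - holoPart (n m) (f m) (W m) (ℓ m) a w)
      (fun w => regularPart (n k) (f k) (W k) (V k) (ℓ k) a w -
        regularPart (n m) (f m) (W m) (V m) (ℓ m) a w) η η (hkC'.sub hmC')
      (((differentiableOn_holoPart (H.system k) (H.holo k) a).sub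
        (differentiableOn_holoPart (H.system m) (H.holo m) a)).mono hsub) ?_ ?_ ?_
    · refine this.trans_lt ?_
      have h3 : M * (η + η) ≤ (2 * M + 1) * η := by nlinarith
      have h4 : (2 * M + 1) * η = ε / 2 := by rw [hη]; field_simp
      linarith
    · intro w hw
      have hw' := Metric.isOpen_ball.mem_nhds hw
      rw [del_sub ((hkC'.differentiableOn one_ne_zero).differentiableAt hw')
        ((hmC'.differentiableOn one_ne_zero).differentiableAt hw'), hkd w (hsub hw),
        hmd w (hsub hw)]
      ring
    · intro w hw
      rw [← Complex.ofReal_sub, Complex.norm_real, ← dist_eq_norm]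
      exact (hN₂ k (le_trans (by simp) hk) m (le_trans (by simp) hm) w (hballE z hz hw)).le
    · intro w hw
      rw [← dist_eq_norm]
      exact (hN₁ k (le_trans (by simp) hk) m (le_trans (by simp) hm) w (hballE z hz hw)).le
  have hpt : ∀ z, ∃ y : ℂ, z ∈ Metric.ball a (1 / 2) →
      Tendsto (fun k => holoPart (n k) (f k) (W k) (ℓ k) a z) atTop (𝓝 y) := by
    intro z
    by_cases hz : z ∈ Metric.ball a (1 / 2)
    · obtain ⟨y, hy⟩ := cauchySeq_tendsto_of_complete (hcauchy.cauchySeq hz)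
      exact ⟨y, fun _ => hy⟩
    · exact ⟨0, fun h => absurd h hz⟩
  choose h hh using hpt
  have hlim : TendstoUniformlyOn (fun k => holoPart (n k) (f k) (W k) (ℓ k) a) h atTop
      (Metric.ball a (1 / 2)) := hcauchy.tendstoUniformlyOn_of_tendsto fun z hz => hh z hz
  refine ⟨h, ?_, ?_⟩
  · refine hlim.tendstoLocallyUniformlyOn.differentiableOn (Eventually.of_forall fun k => ?_)
      Metric.isOpen_ball
    exact (differentiableOn_holoPart (H.system k) (H.holo k) a).mono
      (Metric.ball_subset_ball (by norm_num))
  · intro z hz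
    have hsubE : Metric.ball a (1 / 2) ⊆ Metric.closedBall a (3 / 4) :=
      Metric.ball_subset_closedBall.trans (Metric.closedBall_subset_closedBall (by norm_num))
    have hsum := (hT.mono hsubE).add hlim
    set D : ℂ → ℂ := fun z => cutoffCauchy a (onePoint K) z - cauchyTransform K z - conj z + h z
    have hderiv : TendstoUniformlyOn (fun k z => realDifferential
        (regularPart (n k) (f k) (W k) (V k) (ℓ k) a z + holoPart (n k) (f k) (W k) (ℓ k) a z))
        (fun z => realDifferential (D z)) atTop (Metric.ball a (1 / 2)) := by
      rw [Metric.tendstoUniformlyOn_iff]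
      intro ε hε
      filter_upwards [Metric.tendstoUniformlyOn_iff.1 hsum (ε / 3) (by positivity)] with k hk w hw
      rw [dist_eq_norm, realDifferential_sub]
      refine (norm_realDifferential_le _).trans_lt ?_
      have := hk w hw
      rw [dist_eq_norm] at this
      simp only [Pi.add_apply] at this
      linarith
    -- Uniform convergence of the differentials and pointwise convergence of the logarithms identify
    -- the differential of the limit.
    have hfin : HasFDerivAt (fun z => Real.log (onePoint K z)) (realDifferential (D z)) z := by
      refine hasFDerivAt_of_tendstoUniformlyOnFilter (l := atTop)
        (f := fun k z => Real.log (density (n k) (f k) (W k) z)) (hderiv.tendstoUniformlyOnFilter.mono_right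
          (by rw [le_principal_iff]; exact Metric.isOpen_ball.mem_nhds hz)) ?_ ?_
      · have hball : ∀ᶠ w in 𝓝 z, w ∈ Metric.ball a 1 := by
          refine Metric.isOpen_ball.mem_nhds ?_
          exact Metric.ball_subset_ball (by norm_num) hz
        filter_upwards [hev.prod_mk hball] with y hy
        obtain ⟨⟨_, hC, hd⟩, hy2⟩ := hy
        rw [← hd y.2 hy2]
        exact hasFDerivAt_realDifferential
          ((hC.differentiableOn one_ne_zero).differentiableAt (Metric.isOpen_ball.mem_nhds hy2))
      · have : ∀ᶠ w in 𝓝 z, w ∈ Metric.ball a (1 / 2) := Metric.isOpen_ball.mem_nhds hz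
        filter_upwards [this] with w hw
        exact hv.tendsto_at (hsubE hw)
    exact del_ofReal_of_hasFDerivAt hfin fun w => realDifferential_apply _ _

end IsLimitSystem

/-! ### Ward's equation in the limit -/

lemma del_ofReal_eq {v : ℂ → ℝ} {x : ℂ} (h : DifferentiableAt ℝ v x) :
    del (fun x => (v x : ℂ)) x =
      (1 / 2) * ((fderiv ℝ v x 1 : ℂ) - Complex.I * (fderiv ℝ v x Complex.I : ℂ)) := by
  have h1 : HasFDerivAt (fun x => (v x : ℂ)) (Complex.ofRealCLM.comp (fderiv ℝ v x)) x :=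
    Complex.ofRealCLM.hasFDerivAt.comp x h.hasFDerivAt
  rw [del, h1.fderiv]
  simp

lemma eventually_del_ofReal_eq {v : ℂ → ℝ} {z : ℂ} (hv : ContDiffAt ℝ 2 v z) :
    del (fun x => (v x : ℂ)) =ᶠ[𝓝 z] fun x =>
      (1 / 2) * ((fderiv ℝ v x 1 : ℂ) - Complex.I * (fderiv ℝ v x Complex.I : ℂ)) := by
  have h := hv.eventually (by simp)
  filter_upwards [h] with x hx
  exact del_ofReal_eq (hx.differentiableAt (by simp))

/-- The mixed second derivatives cancel by symmetry, leaving a quarter of the Laplacian. -/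
lemma dbar_del {v : ℂ → ℝ} {z : ℂ} (hv : ContDiffAt ℝ 2 v z) :
    DifferentiableAt ℝ (del (fun x => (v x : ℂ))) z ∧
      dbar (del (fun x => (v x : ℂ))) z = (lap v z : ℂ) := by
  have hev := eventually_del_ofReal_eq hv
  have hd2 : DifferentiableAt ℝ (fderiv ℝ v) z :=
    (hv.fderiv_right (m := 1) (by norm_num)).differentiableAt one_ne_zero
  have hw : ∀ w : ℂ, HasFDerivAt (fun x => (fderiv ℝ v x w : ℂ))
      (Complex.ofRealCLM.comp ((ContinuousLinearMap.apply ℝ ℝ w).comp (fderiv ℝ (fderiv ℝ v) z))) z :=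
    fun w => Complex.ofRealCLM.hasFDerivAt.comp z
      ((ContinuousLinearMap.apply ℝ ℝ w).hasFDerivAt.comp z hd2.hasFDerivAt)
  have hD := ((hw 1).sub ((hw Complex.I).const_mul Complex.I)).const_mul (1 / 2 : ℂ)
  have hsymm := hv.isSymmSndFDerivAt (by simp)
  refine ⟨hD.differentiableAt.congr_of_eventuallyEq hev, ?_⟩
  have hf : fderiv ℝ (del (fun x => (v x : ℂ))) z = _ := hev.fderiv_eq.trans hD.fderiv
  rw [dbar, hf, lap, InnerProductSpace.laplacian_eq_iteratedFDeriv_complexPlane]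
  simp only [iteratedFDeriv_two_apply]
  have h2 := hsymm 1 Complex.I
  simp at h2 ⊢
  rw [h2]
  linear_combination (-1 / 4 : ℂ) * (fderiv ℝ (fderiv ℝ v) z Complex.I Complex.I : ℂ) * Complex.I_sq

lemma dbar_conj (z : ℂ) : dbar (fun z => conj z) z = 1 := by
  have h : HasFDerivAt (fun z : ℂ => conj z) (Complex.conjCLE : ℂ →L[ℝ] ℂ) z :=
    Complex.conjCLE.hasFDerivAt
  rw [dbar, h.fderiv]
  simp
  norm_num

lemma dbar_eq_zero {h : ℂ → ℂ} {z : ℂ} (hh : DifferentiableAt ℂ h z) : dbar h z = 0 := by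
  rw [dbar, hh.fderiv_restrictScalars ℝ]
  have : fderiv ℂ h z Complex.I = Complex.I * fderiv ℂ h z 1 := by
    rw [← smul_eq_mul, ← map_smul]; simp
  simp only [ContinuousLinearMap.coe_restrictScalars', this]
  linear_combination (1 / 2 : ℂ) * fderiv ℂ h z 1 * Complex.I_sq

lemma dbar_add {f g : ℂ → ℂ} {z : ℂ} (hf : DifferentiableAt ℝ f z) (hg : DifferentiableAt ℝ g z) :
    dbar (fun x => f x + g x) z = dbar f z + dbar g z := by
  simp only [dbar]
  rw [fderiv_fun_add hf hg]
  simp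
  ring

lemma dbar_sub {f g : ℂ → ℂ} {z : ℂ} (hf : DifferentiableAt ℝ f z) (hg : DifferentiableAt ℝ g z) :
    dbar (fun x => f x - g x) z = dbar f z - dbar g z := by
  simp only [dbar]
  rw [fderiv_fun_sub hf hg]
  simp
  ring

/-- Ward's equation for positive limits of orthonormal systems. -/
lemma IsLimitSystem.ward_equation {n : ℕ → ℕ} {W : ℕ → ℂ → ℝ} {f : ℕ → ℕ → ℂ[X]}
    {V : ℕ → ℂ → ℝ} {ℓ : ℕ → ℂ → ℂ} {K : ℂ → ℂ → ℂ} (H : IsLimitSystem n W f V ℓ K)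
    (hpos : ∀ z, 0 < onePoint K z) (hsm : ContDiff ℝ ∞ (onePoint K)) (a : ℂ) :
    ContDiffAt ℝ ∞ (cauchyTransform K) a ∧ dbar (cauchyTransform K) a =
      ((onePoint K a - 1 - lap (fun u => Real.log (onePoint K u)) a : ℝ) : ℂ) := by
  obtain ⟨h, hh, heq⟩ := H.exists_holomorphic_limit hpos a
  have hlog : ContDiff ℝ ∞ fun z => Real.log (onePoint K z) := hsm.log fun z => (hpos z).ne'
  have hha : ∀ᶠ z in 𝓝 a, DifferentiableAt ℂ h z := by
    filter_upwards [Metric.isOpen_ball.mem_nhds (Metric.mem_ball_self (x := a)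
      (by norm_num : (0 : ℝ) < 1 / 2))] with z hz
    exact hh.differentiableAt (Metric.isOpen_ball.mem_nhds hz)
  -- Solved for the Cauchy transform, the limiting identity shows its smoothness. Under
  -- $\bar\partial$ at `a` the four terms contribute $R$, $1$, $\Delta\log R$ and $0$.
  have hev : cauchyTransform K =ᶠ[𝓝 a] fun z => cutoffCauchy a (onePoint K) z - conj z -
      del (fun z => (Real.log (onePoint K z) : ℂ)) z + h z := by
    filter_upwards [Metric.isOpen_ball.mem_nhds (Metric.mem_ball_self (x := a)
      (by norm_num : (0 : ℝ) < 1 / 2))] with z hz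
    rw [heq z hz]; ring
  set g : ℂ → ℂ := fun w => ((cutoff a w * onePoint K w : ℝ) : ℂ) with hg
  have hgC : ContDiff ℝ ∞ g := Complex.ofRealCLM.contDiff.comp ((cutoff a).contDiff.mul hsm)
  have hgc : HasCompactSupport g := by
    refine (cutoff a).hasCompactSupport.mono fun w hw => ?_
    simp only [hg, Function.mem_support] at hw ⊢
    intro h0; exact hw (by simp [h0])
  have hP : ContDiff ℝ ∞ (cutoffCauchy a (onePoint K)) := contDiff_cauchy hgC hgc
  have hPd : dbar (cutoffCauchy a (onePoint K)) a = onePoint K a := by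
    have := dbar_cauchy (hgC.of_le (by norm_num)) hgc a
    rw [show dbar (cutoffCauchy a (onePoint K)) a = g a from this, hg]
    simp [cutoff_one (Metric.mem_ball_self (x := a) (by norm_num : (0 : ℝ) < 2))]
  have hdelC : ContDiff ℝ ∞ (del (fun z => (Real.log (onePoint K z) : ℂ))) := by
    have e : del (fun z => (Real.log (onePoint K z) : ℂ)) = fun x =>
        (1 / 2) * ((fderiv ℝ (fun z => Real.log (onePoint K z)) x 1 : ℂ) -
          Complex.I * (fderiv ℝ (fun z => Real.log (onePoint K z)) x Complex.I : ℂ)) :=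
      funext fun x => del_ofReal_eq (hlog.differentiable (by simp) x)
    rw [e]
    have hw : ∀ w : ℂ, ContDiff ℝ ∞
        fun x => (fderiv ℝ (fun z => Real.log (onePoint K z)) x w : ℂ) := fun w =>
      Complex.ofRealCLM.contDiff.comp
        ((hlog.fderiv_right (m := ∞) (by simp)).clm_apply contDiff_const)
    exact contDiff_const.mul ((hw 1).sub (contDiff_const.mul (hw Complex.I)))
  have hconj : ContDiff ℝ ∞ fun z : ℂ => conj z := Complex.conjCLE.contDiff
  have hhC : ContDiffAt ℝ ∞ h a := by
    have : AnalyticAt ℂ h a := (Complex.analyticAt_iff_eventually_differentiableAt).2 hha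
    exact this.contDiffAt.restrict_scalars ℝ
  refine ⟨(((hP.contDiffAt.sub hconj.contDiffAt).sub hdelC.contDiffAt).add
    hhC).congr_of_eventuallyEq hev, ?_⟩
  have hd : ∀ {g : ℂ → ℂ}, ContDiffAt ℝ ∞ g a → DifferentiableAt ℝ g a := fun hg =>
    hg.differentiableAt (by simp)
  have e1 : dbar (cauchyTransform K) a = dbar (fun z => cutoffCauchy a (onePoint K) z - conj z -
      del (fun z => (Real.log (onePoint K z) : ℂ)) z + h z) a := by
    simp only [dbar, hev.fderiv_eq]
  have h1 := hd hP.contDiffAt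
  have h2 := hd hconj.contDiffAt
  have h3 := hd hdelC.contDiffAt
  rw [e1, dbar_add ((h1.fun_sub h2).fun_sub h3) (hd hhC), dbar_sub (h1.fun_sub h2) h3, dbar_sub h1 h2, hPd,
    dbar_conj, dbar_eq_zero hha.self_of_nhds,
    (dbar_del (contDiff_infty.1 hlog 2).contDiffAt).2]
  push_cast
  ring

/-! ### Smoothness of entire functions of two variables -/

lemma integral_mul_radialBump {h : ℂ → ℂ} (hh : Differentiable ℂ h) :
    ∫ u, h u * (radialBump 1 ‖u‖ : ℂ) ∂dA =
      h 0 * ((∫ u : ℂ, radialBump 1 ‖u‖ ∂dA : ℝ) : ℂ) := by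
  have hc : Continuous fun u : ℂ => h u * (radialBump 1 ‖u‖ : ℂ) :=
    hh.continuous.mul (contDiff_radialBump 1).continuous
  have hs : HasCompactSupport fun u : ℂ => (radialBump 1 ‖u‖ : ℂ) := by
    simpa using hasCompactSupport_radialBump_sub one_pos 0
  rw [integral_holomorphic_mul_radial hc (hc.integrable_of_hasCompactSupport hs.mul_left)
    fun u _ => hh.diffContOnCl, integral_complex_ofReal]

/-- By the mean value property in each variable, convolution with a product of radial bumps
multiplies `F` by the constant `c ^ 2`; convolution with a smooth compactly supported kernel is
smooth. -/
lemma contDiff_of_differentiable_prod {F : ℂ × ℂ → ℂ} (hF : Differentiable ℂ F) :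
    ContDiff ℝ ∞ F := by
  set c : ℂ := ((∫ u : ℂ, radialBump 1 ‖u‖ ∂dA : ℝ) : ℂ) with hc
  have hc0 : c ≠ 0 := by
    have := integral_radialBump_pos one_pos
    rw [hc]
    exact_mod_cast this.ne'
  set φ : ℂ → ℂ := fun u => (radialBump 1 ‖u‖ : ℂ) with hφ
  have hφs : HasCompactSupport φ := by simpa using hasCompactSupport_radialBump_sub one_pos 0
  have hφC : ContDiff ℝ ∞ φ := contDiff_radialBump 1
  set Φ : ℂ × ℂ → ℂ := fun x => φ x.1 * φ x.2 with hΦ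
  have hΦC : ContDiff ℝ ∞ Φ := (hφC.comp contDiff_fst).mul (hφC.comp contDiff_snd)
  have hΦs : HasCompactSupport Φ := by
    refine HasCompactSupport.intro (hφs.prod hφs) fun x hx => ?_
    simp only [Set.mem_prod, not_and_or] at hx
    rcases hx with hx | hx <;> simp [hΦ, image_eq_zero_of_notMem_tsupport hx]
  have hconv := hΦs.contDiff_convolution_right (ContinuousLinearMap.mul ℝ ℂ)
    (μ := dA.prod dA) hF.continuous.locallyIntegrable hΦC
  have hneg : (dA.prod dA).IsNegInvariant :=
    Measure.IsAddHaarMeasure.isNegInvariant_of_regular (dA.prod dA)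
  have heq : convolution F Φ (ContinuousLinearMap.mul ℝ ℂ) (dA.prod dA) = fun x => F x * c ^ 2 := by
    funext x
    rw [convolution_eq_swap]
    simp only [ContinuousLinearMap.mul_apply']
    rw [integral_prod]
    · have h1 : ∀ u : ℂ, ∫ v, F (x - (u, v)) * Φ (u, v) ∂dA = F (x.1 - u, x.2) * φ u * c := by
        intro u
        have h2 := integral_mul_radialBump (h := fun v => F (x.1 - u, x.2 - v) * φ u)
          ((hF.comp (by fun_prop)).mul_const _)
        rw [← hc, sub_zero] at h2
        rw [← h2]
        refine integral_congr_ae (ae_of_all _ fun v => ?_)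
        simp only [hΦ, hφ]
        rw [Prod.sub_def]
        ring
      simp_rw [h1]
      rw [integral_mul_const]
      have h2 := integral_mul_radialBump (h := fun u => F (x.1 - u, x.2))
          (hF.comp (by fun_prop))
      rw [← hc, sub_zero] at h2
      rw [h2]
      ring
    · refine Continuous.integrable_of_hasCompactSupport ?_ hΦs.mul_left
      exact (hF.continuous.comp (by fun_prop)).mul hΦC.continuous
  rw [heq] at hconv
  have := hconv.mul (contDiff_const (c := (c ^ 2)⁻¹))
  simpa [mul_assoc, hc0] using this

lemma contDiff_diagonal {Ψ : ℂ → ℂ → ℂ} (hΨ : IsHermitianEntire Ψ) :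
    ContDiff ℝ ∞ fun z => (Ψ z z).re := by
  have h1 := contDiff_of_differentiable_prod hΨ.2
  have h2 : ContDiff ℝ ∞ fun z : ℂ => ((z, conj z) : ℂ × ℂ) :=
    contDiff_id.prodMk Complex.conjCLE.contDiff
  have h3 := Complex.reCLM.contDiff.comp (h1.comp h2)
  simpa [Function.comp_def] using h3

/-! ### The weight of an external potential -/

section Weight

variable {Q : ℂ → EReal}

lemma weight_nonneg (Q : ℂ → EReal) (t : ℝ) (ζ : ℂ) : 0 ≤ weight Q t ζ := by
  unfold weight; split_ifs
  · exact le_rfl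
  · exact (Real.exp_pos _).le

lemma measurable_weight (hQ : IsPotential Q) (t : ℝ) : Measurable (weight Q t) := by
  have hm : Measurable Q := hQ.lsc.measurable
  unfold weight
  refine Measurable.ite (hm (measurableSet_singleton ⊤)) measurable_const ?_
  exact Real.measurable_exp.comp ((hm.ereal_toReal.const_mul t).neg)

lemma weight_half_sq (Q : ℂ → EReal) (n : ℕ) (ζ : ℂ) :
    Real.sqrt (weight Q n ζ) = weight Q (n / 2) ζ := by
  rw [Real.sqrt_eq_iff_mul_self_eq (weight_nonneg _ _ _) (weight_nonneg _ _ _)]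
  unfold weight
  split_ifs
  · simp
  · rw [← Real.exp_add]; congr 1; ring

lemma weight_le_exp (hQ : IsPotential Q) {t : ℝ} (ht : 0 ≤ t) {ζ : ℂ} {m : ℝ}
    (h : (m : EReal) ≤ Q ζ) : weight Q t ζ ≤ Real.exp (-(t * m)) := by
  unfold weight
  split_ifs with htop
  · exact (Real.exp_pos _).le
  · refine Real.exp_le_exp.2 (neg_le_neg (mul_le_mul_of_nonneg_left ?_ ht))
    rw [← EReal.coe_toReal htop (hQ.ne_bot ζ)] at h
    exact_mod_cast h

lemma exists_growth (hQ : IsPotential Q) : ∃ c : ℝ, 2 < c ∧ ∃ R : ℝ, 1 < R ∧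
    ∀ ζ : ℂ, R ≤ ‖ζ‖ → ((c * Real.log ‖ζ‖ : ℝ) : EReal) ≤ Q ζ := by
  obtain ⟨c, hc1, hc2⟩ := EReal.lt_iff_exists_real_btwn.1 hQ.growth
  have hc : 2 < c := EReal.coe_lt_coe_iff.1 hc1
  have hev := eventually_lt_of_lt_liminf hc2
  rw [← Metric.cobounded_eq_cocompact, ← comap_norm_atTop, eventually_comap] at hev
  obtain ⟨R, hR⟩ := eventually_atTop.1 hev
  refine ⟨c, hc, max R 2, lt_max_of_lt_right (by norm_num), fun ζ hζ => ?_⟩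
  have h1 := hR ‖ζ‖ ((le_max_left _ _).trans hζ) ζ rfl
  have hlog : 0 < Real.log ‖ζ‖ := Real.log_pos (by linarith [(le_max_right R 2).trans hζ])
  rw [EReal.lt_div_iff (by exact_mod_cast hlog) (EReal.coe_ne_top _)] at h1
  push_cast
  exact h1.le

/-- Growth of `Q` controls the weight near infinity, and a lower semicontinuous function is bounded
below on the remaining disc. -/
lemma exists_weight_bound (hQ : IsPotential Q) (n : ℕ) (hn : 0 < n) :
    ∃ c : ℝ, 2 < c ∧ ∃ D : ℝ, 0 ≤ D ∧ ∀ ζ : ℂ, weight Q n ζ ≤ D * (1 + ‖ζ‖) ^ (-(n * c)) := by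
  obtain ⟨c, hc, R, hR, hgr⟩ := exists_growth hQ
  refine ⟨c, hc, ?_⟩
  have hnR : (0 : ℝ) < n := by exact_mod_cast hn
  obtain ⟨m, hm⟩ : ∃ m : ℝ, ∀ ζ ∈ Metric.closedBall (0 : ℂ) R, (m : EReal) ≤ Q ζ := by
    obtain ⟨x, hx, hmin⟩ := hQ.lsc.lowerSemicontinuousOn (Metric.closedBall (0 : ℂ) R)
      |>.exists_isMinOn ⟨0, by simp; linarith⟩ (isCompact_closedBall 0 R)
    rcases eq_or_ne (Q x) ⊤ with h | h
    -- If the minimum is `⊤`, then `Q` is `⊤` on the whole disc and any constant serves.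
    · refine ⟨0, fun ζ hζ => ?_⟩
      have : Q x ≤ Q ζ := hmin hζ
      rw [h, top_le_iff] at this
      rw [this]; exact le_top
    · refine ⟨(Q x).toReal, fun ζ hζ => ?_⟩
      rw [EReal.coe_toReal h (hQ.ne_bot x)]
      exact hmin hζ
  set e : ℝ := n * c
  have he : 0 < e := by positivity
  refine ⟨Real.exp (-(n * m)) * (1 + R) ^ e + 2 ^ e, by positivity, fun ζ => ?_⟩
  have h1pos : 0 < 1 + ‖ζ‖ := by positivity
  rw [Real.rpow_neg h1pos.le, ← div_eq_mul_inv, le_div_iff₀ (by positivity)]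
  rcases le_or_gt ‖ζ‖ R with h | h
  · have h1 := weight_le_exp hQ hnR.le (hm ζ (by simpa using h))
    have h2 : (1 + ‖ζ‖) ^ e ≤ (1 + R) ^ e := by gcongr
    calc weight Q n ζ * (1 + ‖ζ‖) ^ e ≤ Real.exp (-(n * m)) * (1 + R) ^ e := by gcongr
      _ ≤ _ := le_add_of_nonneg_right (by positivity)
  · have hζ : 0 < ‖ζ‖ := by linarith
    have h1 := weight_le_exp hQ hnR.le (hgr ζ h.le)
    have h2 : Real.exp (-(n * (c * Real.log ‖ζ‖))) = (‖ζ‖ ^ e)⁻¹ := by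
      rw [← Real.rpow_neg hζ.le, Real.rpow_def_of_pos hζ]
      congr 1; ring
    have h3 : (1 + ‖ζ‖) ^ e ≤ (2 * ‖ζ‖) ^ e := by gcongr; linarith
    rw [Real.mul_rpow (by norm_num) hζ.le] at h3
    have h4 : 0 < ‖ζ‖ ^ e := by positivity
    rw [h2] at h1
    calc weight Q n ζ * (1 + ‖ζ‖) ^ e ≤ (‖ζ‖ ^ e)⁻¹ * (2 ^ e * ‖ζ‖ ^ e) := by gcongr
      _ = 2 ^ e := by field_simp
      _ ≤ _ := le_add_of_nonneg_left (by positivity)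

lemma exists_eval_bound {n : ℕ} (hn : 0 < n) {p : ℂ[X]} (hp : p.degree < n) :
    ∃ D : ℝ, 0 ≤ D ∧ ∀ ζ : ℂ, ‖p.eval ζ‖ ≤ D * (1 + ‖ζ‖) ^ (n - 1) := by
  refine ⟨∑ i ∈ Finset.range n, ‖p.coeff i‖, by positivity, fun ζ => ?_⟩
  have h : p.natDegree < n := by
    rcases eq_or_ne p 0 with rfl | h0
    · simpa using hn
    · exact (natDegree_lt_iff_degree_lt h0).2 hp
  rw [eval_eq_sum_range' h, Finset.sum_mul]
  refine (norm_sum_le _ _).trans (Finset.sum_le_sum fun i hi => ?_)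
  have hi' := Finset.mem_range.1 hi
  rw [norm_mul, norm_pow]
  gcongr
  calc ‖ζ‖ ^ i ≤ (1 + ‖ζ‖) ^ i := by gcongr; linarith
    _ ≤ (1 + ‖ζ‖) ^ (n - 1) := pow_le_pow_right₀ (by linarith [norm_nonneg ζ]) (by omega)

/-- The product decays like the power $-(nc-2(n-1))$ of $1+|\zeta|$, and $c>2$ makes this exponent
exceed the real dimension $2$ in absolute value. -/
lemma integrable_poly_weight (hQ : IsPotential Q) (n : ℕ) (p q : ℂ[X]) (hp : p.degree < n)
    (hq : q.degree < n) :
    Integrable (fun ζ => p.eval ζ * conj (q.eval ζ) * (weight Q n ζ : ℂ)) dA := by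
  rcases Nat.eq_zero_or_pos n with rfl | hn
  · have : p = 0 := by
      rw [← degree_eq_bot]
      exact (Nat.WithBot.lt_zero_iff).1 (by simpa using hp)
    simp [this]
  obtain ⟨c, hc, D, hD0, hD⟩ := exists_weight_bound hQ n hn
  obtain ⟨A, hA0, hA⟩ := exists_eval_bound hn hp
  obtain ⟨B, hB0, hB⟩ := exists_eval_bound hn hq
  have hnR : (0 : ℝ) < n := by exact_mod_cast hn
  have hdim : (Module.finrank ℝ ℂ : ℝ) < n * c - 2 * (n - 1) := by
    rw [Complex.finrank_real_complex]
    push_cast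
    nlinarith
  refine ((integrable_one_add_norm (μ := dA) hdim).const_mul (A * B * D)).mono' ?_
    (ae_of_all _ fun ζ => ?_)
  · refine Measurable.aestronglyMeasurable ?_
    have hc1 : Continuous fun ζ => p.eval ζ * conj (q.eval ζ) :=
      p.continuous.mul (Complex.continuous_conj.comp q.continuous)
    exact hc1.measurable.mul (Complex.measurable_ofReal.comp (measurable_weight hQ n))
  · have h1pos : 0 < 1 + ‖ζ‖ := by positivity
    rw [norm_mul, norm_mul, RCLike.norm_conj, Complex.norm_real,
      Real.norm_of_nonneg (weight_nonneg _ _ _)]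
    have hw := weight_nonneg Q n ζ
    calc ‖p.eval ζ‖ * ‖q.eval ζ‖ * weight Q n ζ
        ≤ (A * (1 + ‖ζ‖) ^ (n - 1)) * (B * (1 + ‖ζ‖) ^ (n - 1)) *
          (D * (1 + ‖ζ‖) ^ (-(n * c))) := by
          gcongr
          · exact hA ζ
          · exact hB ζ
          · exact hD ζ
      _ = A * B * D * ((1 + ‖ζ‖) ^ (n - 1) * (1 + ‖ζ‖) ^ (n - 1) * (1 + ‖ζ‖) ^ (-(n * c))) := by
          ring
      _ = A * B * D * (1 + ‖ζ‖) ^ (-(n * c - 2 * (n - 1))) := by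
          rw [← Real.rpow_natCast, ← Real.rpow_add h1pos, ← Real.rpow_add h1pos,
            Nat.cast_pred hn]
          congr 2; ring

/-- The weight is positive on a nonempty open set, and the finitely many roots of `p` do not exhaust
its measure. -/
lemma polyInner_self_pos (hQ : IsPotential Q) {U : Set ℂ} (hU : IsOpen U) (hne : U.Nonempty)
    (hUQ : ∀ ζ ∈ U, Q ζ ≠ ⊤) (n : ℕ) {p : ℂ[X]} (hp : p.degree < n) (hp0 : p ≠ 0) :
    ∃ x : ℝ, 0 < x ∧ polyInner Q n p p = x := by
  have hi := integrable_poly_weight hQ n p p hp hp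
  have e : ∀ ζ, p.eval ζ * conj (p.eval ζ) * (weight Q n ζ : ℂ) =
      ((‖p.eval ζ‖ ^ 2 * weight Q n ζ : ℝ) : ℂ) := by
    intro ζ
    rw [Complex.mul_conj, Complex.normSq_eq_norm_sq]
    push_cast; rfl
  simp_rw [e] at hi
  have hiR : Integrable (fun ζ => ‖p.eval ζ‖ ^ 2 * weight Q n ζ) dA := by
    refine hi.re.congr (ae_of_all _ fun w => ?_)
    exact Complex.ofReal_re _
  refine ⟨∫ ζ, ‖p.eval ζ‖ ^ 2 * weight Q n ζ ∂dA, ?_, ?_⟩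
  · rw [integral_pos_iff_support_of_nonneg
      (fun ζ => mul_nonneg (by positivity) (weight_nonneg _ _ _)) hiR]
    have hsub : U \ {ζ | p.eval ζ = 0} ⊆
        Function.support fun ζ => ‖p.eval ζ‖ ^ 2 * weight Q n ζ := by
      intro ζ hζ
      have h1 : p.eval ζ ≠ 0 := hζ.2
      have h2 : weight Q n ζ ≠ 0 := by
        rw [weight, if_neg (hUQ ζ hζ.1)]; exact (Real.exp_pos _).ne'
      simp [h1, h2]
    refine lt_of_lt_of_le ?_ (measure_mono hsub)
    have hfin : {ζ | p.eval ζ = 0}.Finite := by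
      refine (p.roots.toFinset.finite_toSet).subset fun ζ hζ => ?_
      simpa [hp0] using hζ
    rw [measure_sdiff_null (hfin.measure_zero dA)]
    exact hU.measure_pos dA hne
  · rw [polyInner]
    simp_rw [e]
    exact integral_complex_ofReal

end Weight

/-! ### Gram–Schmidt orthogonalization -/

section GramSchmidt

variable {Q : ℂ → EReal}

lemma polyInner_conj (Q : ℂ → EReal) (n : ℕ) (p q : ℂ[X]) :
    conj (polyInner Q n p q) = polyInner Q n q p := by
  rw [polyInner, ← integral_conj, polyInner]
  refine integral_congr_ae (ae_of_all _ fun ζ => ?_)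
  simp only [map_mul, Complex.conj_conj, Complex.conj_ofReal]
  ring

lemma polyInner_C_mul_left (Q : ℂ → EReal) (n : ℕ) (a : ℂ) (p q : ℂ[X]) :
    polyInner Q n (C a * p) q = a * polyInner Q n p q := by
  rw [polyInner, polyInner, ← integral_const_mul]
  refine integral_congr_ae (ae_of_all _ fun ζ => ?_)
  simp only [eval_mul, eval_C]
  ring

lemma polyInner_C_mul_right (Q : ℂ → EReal) (n : ℕ) (a : ℂ) (p q : ℂ[X]) :
    polyInner Q n p (C a * q) = conj a * polyInner Q n p q := by
  rw [← polyInner_conj, polyInner_C_mul_left, map_mul, polyInner_conj]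

lemma polyInner_sub_sum (hQ : IsPotential Q) (n : ℕ) {j : ℕ} (p : ℂ[X]) (m : Fin j → ℂ[X])
    (c : Fin j → ℂ) (q : ℂ[X]) (hp : p.degree < n) (hm : ∀ k, (m k).degree < n)
    (hq : q.degree < n) :
    polyInner Q n (p - ∑ k, C (c k) * m k) q =
      polyInner Q n p q - ∑ k, c k * polyInner Q n (m k) q := by
  have hi := fun k => (integrable_poly_weight hQ n (m k) q (hm k) hq).const_mul (c k)
  simp only [polyInner]
  simp_rw [← integral_const_mul]
  rw [← integral_finsetSum _ fun k _ => hi k, ← integral_sub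
    (integrable_poly_weight hQ n p q hp hq) (integrable_finsetSum _ fun k _ => hi k)]
  refine integral_congr_ae (ae_of_all _ fun ζ => ?_)
  simp only [eval_sub, eval_finsetSum, eval_mul, eval_C, sub_mul, Finset.sum_mul]
  congr 1
  exact Finset.sum_congr rfl fun k _ => by ring

/-- Degree and orthogonality go through one strong induction, because the denominators in the
recursion are nonzero only once the earlier degrees are known. -/
lemma monicOrtho_spec (hQ : IsPotential Q) {U : Set ℂ} (hU : IsOpen U) (hne : U.Nonempty)
    (hUQ : ∀ ζ ∈ U, Q ζ ≠ ⊤) (n : ℕ) : ∀ j < n, (monicOrtho Q n j).degree = j ∧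
      ∀ i < j, polyInner Q n (monicOrtho Q n j) (monicOrtho Q n i) = 0 := by
  intro j
  induction j using Nat.strong_induction_on with
  | _ j ih =>
    intro hj
    have hdeg : ∀ k : Fin j, (monicOrtho Q n k).degree = (k : ℕ) := fun k =>
      (ih k k.2 (k.2.trans hj)).1
    have hdlt : ∀ k : Fin j, (monicOrtho Q n k).degree < n := fun k => by
      rw [hdeg k]; exact_mod_cast k.2.trans hj
    refine ⟨?_, ?_⟩
    · rw [monicOrtho]
      have hsum : (∑ k : Fin j, C (polyInner Q n (X ^ j) (monicOrtho Q n k) /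
          polyInner Q n (monicOrtho Q n k) (monicOrtho Q n k)) * monicOrtho Q n k).degree <
          (X ^ j : ℂ[X]).degree := by
        rw [degree_X_pow]
        refine (degree_sum_le _ _).trans_lt ?_
        refine (Finset.sup_lt_iff (by exact_mod_cast WithBot.bot_lt_coe j)).2 fun k _ => ?_
        refine (degree_mul_le _ _).trans_lt ?_
        refine lt_of_le_of_lt (add_le_add_left degree_C_le _) ?_
        rw [zero_add, hdeg k]
        exact_mod_cast k.2
      rw [degree_sub_eq_left_of_degree_lt hsum, degree_X_pow]
    · intro i hi
      have hXj : (X ^ j : ℂ[X]).degree < n := by rw [degree_X_pow]; exact_mod_cast hj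
      rw [monicOrtho, polyInner_sub_sum hQ n _ _ _ _ hXj hdlt (hdlt ⟨i, hi⟩)]
      have hi0 : polyInner Q n (monicOrtho Q n i) (monicOrtho Q n i) ≠ 0 := by
        have h0 : monicOrtho Q n i ≠ 0 := by
          intro h0
          have := hdeg ⟨i, hi⟩
          simp [h0] at this
        obtain ⟨x, hx, hx'⟩ := polyInner_self_pos hQ hU hne hUQ n (hdlt ⟨i, hi⟩) h0
        rw [hx']
        exact_mod_cast hx.ne'
      rw [Finset.sum_eq_single (⟨i, hi⟩ : Fin j)]
      · simp only
        field_simp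
        ring
      · intro k _ hki
        have hki' : (k : ℕ) ≠ i := fun h => hki (Fin.ext h)
        rcases lt_or_gt_of_ne hki' with h | h
        · have h0 : polyInner Q n (monicOrtho Q n k) (monicOrtho Q n i) = 0 := by
            rw [← polyInner_conj, (ih i hi (hi.trans hj)).2 k h, map_zero]
          rw [h0, mul_zero]
        · rw [(ih k k.2 (k.2.trans hj)).2 i h]; simp
      · simp

lemma orthoSystem_orthoPoly (hQ : IsPotential Q) {U : Set ℂ} (hU : IsOpen U) (hne : U.Nonempty)
    (hUQ : ∀ ζ ∈ U, Q ζ ≠ ⊤) (n : ℕ) : OrthoSystem n (weight Q n) (orthoPoly Q n) := by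
  have hspec := monicOrtho_spec hQ hU hne hUQ n
  have hpos : ∀ j < n, ∃ x : ℝ, 0 < x ∧
      polyInner Q n (monicOrtho Q n j) (monicOrtho Q n j) = x := by
    intro j hj
    have hd := (hspec j hj).1
    refine polyInner_self_pos hQ hU hne hUQ n (by rw [hd]; exact_mod_cast hj) fun h0 => ?_
    simp [h0] at hd
  refine ⟨weight_nonneg Q n, measurable_weight hQ n, integrable_poly_weight hQ n, ?_, ?_⟩
  · intro j hj
    obtain ⟨x, hx, hx'⟩ := hpos j hj
    rw [orthoPoly, hx', Complex.ofReal_re, degree_C_mul, (hspec j hj).1]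
    have := Real.sqrt_pos.2 hx
    simpa using this.ne'
  · intro i hi j hj
    change polyInner Q n (orthoPoly Q n i) (orthoPoly Q n j) = _
    rw [orthoPoly, orthoPoly, polyInner_C_mul_left, polyInner_C_mul_right, Complex.conj_ofReal]
    split_ifs with h
    · subst h
      obtain ⟨x, hx, hx'⟩ := hpos i hi
      rw [hx', Complex.ofReal_re, ← Complex.ofReal_mul, ← Complex.ofReal_mul]
      have := Real.sqrt_pos.2 hx
      have h2 := Real.mul_self_sqrt hx.le
      rw [Complex.ofReal_eq_one]
      field_simp
      nlinarith
    · rcases lt_or_gt_of_ne h with h | h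
      · have h0 : polyInner Q n (monicOrtho Q n i) (monicOrtho Q n j) = 0 := by
          rw [← polyInner_conj, (hspec j hj).2 i h, map_zero]
        rw [h0, mul_zero, mul_zero]
      · rw [(hspec i hi).2 j h]; simp

end GramSchmidt

/-! ### Rescaling -/

/-- The complex scale `e^{iθ} / √(n ∂∂̄Q(p))`. -/
noncomputable def scale (Q : ℂ → EReal) (n : ℕ) (p : ℂ) (θ : ℝ) : ℂ :=
  Complex.exp (θ * Complex.I) / (Real.sqrt (n * lap (fun ζ => (Q ζ).toReal) p) : ℂ)

lemma unscale_eq (Q : ℂ → EReal) (n : ℕ) (p : ℂ) (θ : ℝ) (z : ℂ) :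
    unscale Q n p θ z = p + scale Q n p θ * z := by
  rw [unscale, scale]; ring

lemma norm_scale_sq (Q : ℂ → EReal) (n : ℕ) (p : ℂ) (θ : ℝ)
    (h : 0 < lap (fun ζ => (Q ζ).toReal) p) :
    ‖scale Q n p θ‖ ^ 2 = (n * lap (fun ζ => (Q ζ).toReal) p)⁻¹ := by
  rw [scale, norm_div, Complex.norm_exp_ofReal_mul_I, Complex.norm_real,
    Real.norm_of_nonneg (Real.sqrt_nonneg _), div_pow, Real.sq_sqrt (by positivity), one_pow,
    one_div]

lemma scale_ne_zero (Q : ℂ → EReal) {n : ℕ} (hn : 0 < n) (p : ℂ) (θ : ℝ)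
    (h : 0 < lap (fun ζ => (Q ζ).toReal) p) : scale Q n p θ ≠ 0 := by
  rw [← norm_ne_zero_iff, ← pow_ne_zero_iff two_ne_zero, norm_scale_sq Q n p θ h]
  have : (0 : ℝ) < n := by exact_mod_cast hn
  positivity

/-- The rescaled orthonormal polynomials. -/
noncomputable def rescaledPoly (Q : ℂ → EReal) (n : ℕ) (p : ℂ) (θ : ℝ) (j : ℕ) : ℂ[X] :=
  C (‖scale Q n p θ‖ : ℂ) * (orthoPoly Q n j).comp (C p + C (scale Q n p θ) * X)

/-- The rescaled weight. -/
noncomputable def rescaledWeight (Q : ℂ → EReal) (n : ℕ) (p : ℂ) (θ : ℝ) (z : ℂ) : ℝ :=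
  weight Q n (p + scale Q n p θ * z)

/-- The prefactor equals the squared modulus of the scale, and each rescaled polynomial carries one
factor of that modulus. -/
lemma rescaledKernel_eq (Q : ℂ → EReal) (n : ℕ) (p : ℂ) (θ : ℝ)
    (h : 0 < lap (fun ζ => (Q ζ).toReal) p) (z w : ℂ) :
    rescaledKernel Q n p θ z w =
      weightedKernel n (rescaledPoly Q n p θ) (rescaledWeight Q n p θ) z w := by
  rw [rescaledKernel, corrKernel, weightedKernel, polyKernel, rescaledWeight, rescaledWeight,
    weight_half_sq, weight_half_sq, Finset.mul_sum, Finset.sum_mul, Finset.sum_mul]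
  refine Finset.sum_congr rfl fun j _ => ?_
  have e : (1 / (n * lap (fun ζ => (Q ζ).toReal) p : ℝ) : ℂ) = (‖scale Q n p θ‖ : ℂ) ^ 2 := by
    rw [← Complex.ofReal_pow, norm_scale_sq Q n p θ h]
    push_cast
    rw [one_div]
  rw [e, unscale_eq, unscale_eq]
  simp only [rescaledPoly, eval_mul, eval_C, eval_comp, eval_add, eval_X, map_mul,
    Complex.conj_ofReal]
  ring

/-! ### Cocycles -/

lemma IsCocycle.self {c : ℂ → ℂ → ℂ} (hc : IsCocycle c) (z : ℂ) : c z z = 1 := by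
  simpa using hc.2 0 fun _ => z

lemma IsCocycle.mul_swap {c : ℂ → ℂ → ℂ} (hc : IsCocycle c) (z w : ℂ) : c z w * c w z = 1 := by
  simpa [Fin.prod_univ_two] using hc.2 1 ![z, w]

lemma IsCocycle.norm_eq_one {c : ℂ → ℂ → ℂ} (hc : IsCocycle c) (z w : ℂ) : ‖c z w‖ = 1 := by
  have h := hc.mul_swap z w
  rw [hc.1.2 w z, Complex.mul_conj, Complex.normSq_eq_norm_sq] at h
  have h2 : ‖c z w‖ ^ 2 = 1 := by exact_mod_cast h
  exact (pow_eq_one_iff_of_nonneg (norm_nonneg _) two_ne_zero).1 h2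

/-- The cycle $z\to w\to0\to z$ exhibits a cocycle as a coboundary, the form in which phases cancel
in the mass-one identity. -/
lemma IsCocycle.eq_mul_conj {c : ℂ → ℂ → ℂ} (hc : IsCocycle c) (z w : ℂ) :
    c z w = c z 0 * conj (c w 0) := by
  have h3 : c z w * c w 0 * c 0 z = 1 := by
    have := hc.2 2 ![z, w, 0]
    rw [Fin.prod_univ_three] at this
    simpa using this
  have h1 := hc.mul_swap z 0
  have h2 := hc.mul_swap w 0
  rw [← hc.1.2 0 w]
  linear_combination c z 0 * c 0 w * h3 - (c z w) * h1 * (c w 0 * c 0 w) - c z w * h2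

/-! ### The rescaled potential -/

lemma contDiffAt_del {q : ℂ → ℝ} {a : ℂ} (hq : ContDiffAt ℝ 2 q a) :
    ContDiffAt ℝ 1 (del fun x => (q x : ℂ)) a := by
  refine ContDiffAt.congr_of_eventuallyEq ?_ (eventually_del_ofReal_eq hq)
  have h1 : ContDiffAt ℝ 1 (fderiv ℝ q) a := hq.fderiv_right (by norm_num)
  have h2 : ∀ w : ℂ, ContDiffAt ℝ 1 (fun x => (fderiv ℝ q x w : ℂ)) a := fun w =>
    Complex.ofRealCLM.contDiff.contDiffAt.comp a (h1.clm_apply contDiffAt_const)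
  exact contDiffAt_const.mul ((h2 1).sub (contDiffAt_const.mul (h2 Complex.I)))

lemma continuousAt_lap {q : ℂ → ℝ} {a : ℂ} (hq : ContDiffAt ℝ 2 q a) : ContinuousAt (lap q) a := by
  have h1 : ContinuousAt (fderiv ℝ (del fun x => (q x : ℂ))) a :=
    ((contDiffAt_del hq).fderiv_right (m := 0) (by norm_num)).continuousAt
  have h2 : ContinuousAt (fun x => (dbar (del fun x => (q x : ℂ)) x).re) a := by
    refine Complex.continuous_re.continuousAt.comp ?_
    exact continuousAt_const.mul ((h1.clm_apply continuousAt_const).add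
      (continuousAt_const.mul (h1.clm_apply continuousAt_const)))
  refine h2.congr ?_
  filter_upwards [hq.eventually (by simp)] with x hx
  rw [(dbar_del hx).2, Complex.ofReal_re]

lemma realLinear_eq (A : ℂ →L[ℝ] ℂ) (w : ℂ) :
    A w = (1 / 2) * (A 1 - Complex.I * A Complex.I) * w +
      (1 / 2) * (A 1 + Complex.I * A Complex.I) * conj w := by
  have h : A w = w.re * A 1 + w.im * A Complex.I := by
    have e : w = w.re • (1 : ℂ) + w.im • Complex.I := by simp
    conv_lhs => rw [e, map_add, map_smul, map_smul, Complex.real_smul, Complex.real_smul]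
  rw [h]
  have h1 : conj w = (w.re : ℂ) - w.im * Complex.I := by
    apply Complex.ext <;> simp
  rw [h1]
  conv_rhs => rw [← Complex.re_add_im w]
  simp only [Complex.add_re, Complex.ofReal_re, Complex.mul_re, Complex.I_re, Complex.ofReal_im,
    Complex.I_im, Complex.add_im, Complex.mul_im]
  push_cast
  linear_combination ((w.im : ℂ) * A Complex.I) * Complex.I_sq

lemma del_affine {q : ℂ → ℝ} {p s z : ℂ} (t : ℝ) (hq : DifferentiableAt ℝ q (p + s * z)) :
    del (fun x => ((t * q (p + s * x) : ℝ) : ℂ)) z =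
      t * s * del (fun x => (q x : ℂ)) (p + s * z) := by
  have h1 : HasFDerivAt (fun x : ℂ => p + s * x) (s • ContinuousLinearMap.id ℝ ℂ) z := by
    simpa using! ((hasFDerivAt_id z).const_mul s).const_add p
  have h2 := (hq.hasFDerivAt.comp z h1).const_mul t
  refine del_ofReal_of_hasFDerivAt h2 fun w => ?_
  have h3 := fderiv_eq_del hq (s * w)
  simp only [smul_apply, ContinuousLinearMap.comp_apply,
    ContinuousLinearMap.id_apply, smul_eq_mul]
  rw [h3, mul_assoc, mul_assoc, Complex.re_ofReal_mul]
  rw [show s * (del (fun x => (q x : ℂ)) (p + s * z) * w) =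
    del (fun x => (q x : ℂ)) (p + s * z) * (s * w) by ring]
  ring

/-- Rescaled to the microscopic scale, the differential of a potential is `z̄` up to an entire
function and an infinitesimal error. -/
lemma exists_potential_expansion {q : ℂ → ℝ} {a : ℂ} (hq : ContDiffAt ℝ 2 q a) (ha : 0 < lap q a)
    {t : ℕ → ℝ} {p s : ℕ → ℂ} (hp : Tendsto p atTop (𝓝 a)) (hs : Tendsto s atTop (𝓝 0))
    (hts : ∀ k, t k * ‖s k‖ ^ 2 = (lap q (p k))⁻¹) :
    ∃ ℓ : ℕ → ℂ → ℂ, (∀ k, Differentiable ℂ (ℓ k)) ∧ ∀ z : ℂ, Tendsto (fun y : ℕ × ℂ =>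
      del (fun x => ((t y.1 * q (p y.1 + s y.1 * x) : ℝ) : ℂ)) y.2 - ℓ y.1 y.2 - conj y.2)
      (atTop ×ˢ 𝓝 z) (𝓝 0) := by
  set g : ℂ → ℂ := del fun x => (q x : ℂ) with hg
  set A := fderiv ℝ g a with hA
  -- Strict differentiability at the limit `a` is used since both the base points `p k` and the
  -- points of evaluation move.
  have hst : HasStrictFDerivAt g A a := (contDiffAt_del hq).hasStrictFDerivAt one_ne_zero
  set α : ℂ := (1 / 2) * (A 1 - Complex.I * A Complex.I) with hα
  have hAw : ∀ w, A w = α * w + lap q a * conj w := fun w => by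
    rw [← (dbar_del hq).2]
    exact realLinear_eq A w
  -- The constant and complex linear terms of the expansion of $\partial q$ are entire. The
  -- antilinear term is $t|s|^2\Delta q(a)\,\bar z$, which tends to $\bar z$ by the choice of scale.
  refine ⟨fun k z => t k * s k * g (p k) + t k * s k * α * (s k * z), fun k => by fun_prop,
    fun z => ?_⟩
  set F : Filter (ℕ × ℂ) := atTop ×ˢ 𝓝 z
  have hpF : Tendsto (fun y : ℕ × ℂ => p y.1) F (𝓝 a) := hp.comp tendsto_fst
  have hsF : Tendsto (fun y : ℕ × ℂ => s y.1) F (𝓝 0) := hs.comp tendsto_fst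
  have hzF : Tendsto (fun y : ℕ × ℂ => y.2) F (𝓝 z) := tendsto_snd
  have hcF : Tendsto (fun y : ℕ × ℂ => p y.1 + s y.1 * y.2) F (𝓝 a) := by
    simpa using hpF.add (hsF.mul hzF)
  have hlF : Tendsto (fun y : ℕ × ℂ => lap q (p y.1)) F (𝓝 (lap q a)) :=
    (continuousAt_lap hq).tendsto.comp hpF
  have ho := hst.isLittleO.comp_tendsto (hcF.prodMk_nhds hpF)
  have ho2 := (Asymptotics.isBigO_refl (fun y : ℕ × ℂ => (t y.1 * s y.1 : ℂ)) F).mul_isLittleO ho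
  -- Since $|t\,s\cdot sz|=|z|/\Delta q(p_k)$ stays bounded, the factor $ts$ does not spoil the
  -- $o(|sz|)$ remainder.
  have hbig : (fun y : ℕ × ℂ => (t y.1 * s y.1 : ℂ) * (p y.1 + s y.1 * y.2 - p y.1)) =O[F]
      fun _ => (1 : ℝ) := by
    have h1 : Tendsto (fun y : ℕ × ℂ => (lap q (p y.1))⁻¹ * ‖y.2‖) F (𝓝 ((lap q a)⁻¹ * ‖z‖)) :=
      (hlF.inv₀ ha.ne').mul hzF.norm
    refine Asymptotics.IsBigO.trans (Asymptotics.IsBigO.of_bound 1 (Eventually.of_forall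
      fun y => ?_)) (h1.isBigO_one ℝ)
    rw [← hts, one_mul, add_sub_cancel_left, norm_mul, norm_mul, norm_mul, norm_mul, norm_mul,
      norm_pow, norm_norm, norm_norm, Complex.norm_real]
    exact le_of_eq (by ring)
  have hlim := (Asymptotics.isLittleO_one_iff ℝ).1 (ho2.trans_isBigO hbig)
  have hlim2 : Tendsto (fun y : ℕ × ℂ => ((lap q a * (lap q (p y.1))⁻¹ - 1 : ℝ) : ℂ) * conj y.2) F
      (𝓝 0) := by
    have h1 : Tendsto (fun y : ℕ × ℂ => lap q a * (lap q (p y.1))⁻¹ - 1) F (𝓝 0) := by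
      have := ((hlF.inv₀ ha.ne').const_mul (lap q a)).sub_const 1
      rwa [mul_inv_cancel₀ ha.ne', sub_self] at this
    have h2 := ((Complex.continuous_ofReal.tendsto 0).comp h1).mul
      ((Complex.continuous_conj.tendsto z).comp hzF)
    simpa using! h2
  have hsum := hlim.add hlim2
  rw [add_zero] at hsum
  refine hsum.congr' ?_
  have hqd := hcF.eventually (hq.eventually (by simp))
  filter_upwards [hqd] with y hy
  rw [del_affine _ (hy.differentiableAt (by simp))]
  have e := hts y.1
  have e2 : (t y.1 : ℂ) * (s y.1 * conj (s y.1)) = ((lap q (p y.1))⁻¹ : ℝ) := by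
    rw [Complex.mul_conj, Complex.normSq_eq_norm_sq, ← hts]
    push_cast; ring
  simp only [Function.comp_apply, add_sub_cancel_left]
  rw [hAw, map_mul]
  push_cast at e2 ⊢
  rw [← hg]
  linear_combination (-(lap q a : ℂ) * conj y.2) * e2

/-! ### Convergence along a subsequence -/

section Limit

variable {Q : ℂ → EReal} {p : ℕ → ℂ} {θ : ℕ → ℝ} {K Ψ : ℂ → ℂ → ℂ}

lemma continuous_ginibre : Continuous (Function.uncurry ginibre) := by
  unfold Function.uncurry ginibre
  fun_prop

lemma isCompact_support {σ : Measure ℂ} (hσ : IsCompactProb σ) : IsCompact σ.support := by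
  obtain ⟨-, E, hE, hE0⟩ := hσ
  exact hE.of_isClosed_subset Measure.isClosed_support
    (Measure.support_subset_of_isClosed hE.isClosed hE0)

/-- Along a subsequence the base points converge and the rescaled kernels converge continuously. -/
lemma IsLimitPoint.exists_subseq {S : Set ℂ} (hS : IsCompact S) (hp : ∀ n, p n ∈ S)
    (hK : IsLimitPoint Q p θ K) (hKc : Continuous (Function.uncurry K)) :
    ∃ N : ℕ → ℕ, (∀ k, 0 < N k) ∧ Tendsto N atTop atTop ∧
      (∃ a ∈ S, Tendsto (fun k => p (N k)) atTop (𝓝 a)) ∧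
      ∃ c : ℕ → ℂ → ℂ → ℂ, (∀ k, IsCocycle (c k)) ∧ ∀ x : ℂ × ℂ,
        Tendsto (fun y : ℕ × (ℂ × ℂ) => c y.1 y.2.1 y.2.2 *
          rescaledKernel Q (N y.1) (p (N y.1)) (θ (N y.1)) y.2.1 y.2.2)
          (atTop ×ˢ 𝓝 x) (𝓝 (K x.1 x.2)) := by
  obtain ⟨c, hc, φ, hφ, hlim⟩ := hK
  -- The shift by one keeps the indices positive, as `φ 0` may be `0`, where the scale degenerates.
  obtain ⟨a, ha, ψ, hψ, hlim2⟩ := hS.tendsto_subseq fun k => hp (φ (k + 1))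
  have hsucc : StrictMono fun k => ψ k + 1 := fun i j h => Nat.succ_lt_succ (hψ h)
  refine ⟨fun k => φ (ψ k + 1), fun k => ?_, (hφ.comp hsucc).tendsto_atTop, ⟨a, ha, hlim2⟩,
    fun k => c (φ (ψ k + 1)), fun k => hc _, fun x => ?_⟩
  · exact lt_of_lt_of_le (Nat.succ_pos _) (hφ.id_le _)
  · have h1 := tendstoLocallyUniformly_iff_forall_tendsto.1 hlim x
    have h2 : Tendsto (fun y : ℕ × (ℂ × ℂ) => (K x.1 x.2, K y.2.1 y.2.2)) (atTop ×ˢ 𝓝 x)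
        (uniformity ℂ) :=
      Uniform.tendsto_nhds_right.1 ((hKc.tendsto x).comp tendsto_snd)
    have h3 := Uniform.tendsto_nhds_right.2 (h2.uniformity_trans h1)
    exact h3.comp ((hsucc.tendsto_atTop.comp tendsto_fst).prodMk tendsto_snd)

end Limit

/-! ### Kernels of the form `GΨ` -/

section GinibreType

variable {K Ψ : ℂ → ℂ → ℂ}

lemma continuous_of_eq_ginibre_mul (hΨ : IsHermitianEntire Ψ)
    (hKΨ : ∀ z w, K z w = ginibre z w * Ψ z w) : Continuous (Function.uncurry K) := by
  have : Function.uncurry K = fun x => Function.uncurry ginibre x * Function.uncurry Ψ x := by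
    ext ⟨z, w⟩; exact hKΨ z w
  rw [this]
  exact continuous_ginibre.mul hΨ.1.1

lemma hermitian_of_eq_ginibre_mul (hΨ : IsHermitianEntire Ψ)
    (hKΨ : ∀ z w, K z w = ginibre z w * Ψ z w) (z w : ℂ) : K z w = conj (K w z) := by
  rw [hKΨ, hKΨ, map_mul, ginibre_conj, ← hΨ.1.2]

lemma onePoint_eq_re (hKΨ : ∀ z w, K z w = ginibre z w * Ψ z w) (z : ℂ) :
    onePoint K z = (Ψ z z).re := by
  rw [onePoint, hKΨ, ginibre_self, one_mul]

lemma ofReal_onePoint_eq (hΨ : IsHermitianEntire Ψ)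
    (hKΨ : ∀ z w, K z w = ginibre z w * Ψ z w) (z : ℂ) : (onePoint K z : ℂ) = Ψ z z := by
  rw [onePoint_eq_re hKΨ]
  exact Complex.conj_eq_iff_re.1 (hΨ.1.2 z z).symm

lemma differentiable_left (hΨ : IsHermitianEntire Ψ) (z : ℂ) : Differentiable ℂ fun w => Ψ w z := by
  have h := hΨ.2.comp (differentiable_id.prodMk (differentiable_const (conj z)) :
    Differentiable ℂ fun w : ℂ => (w, conj z))
  simpa [Function.comp_def] using h

/-- A kernel `GΨ` obeying the mass-one inequality is dominated by the Ginibre kernel. -/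
lemma isPositiveMatrix_compl (hΨ : IsHermitianEntire Ψ)
    (hKΨ : ∀ z w, K z w = ginibre z w * Ψ z w)
    (hmass : ∀ (N : ℕ) (z a : Fin N → ℂ),
      Integrable (fun w => ‖∑ l, conj (a l) * K w (z l)‖ ^ 2) dA ∧
      ∫ w, ‖∑ l, conj (a l) * K w (z l)‖ ^ 2 ∂dA ≤ (quadForm K z a).re) :
    IsPositiveMatrix fun z w => ginibre z w * (1 - Ψ z w) := by
  intro N z a
  have hsub : ∑ j, ∑ k, a j * conj (a k) * (ginibre (z j) (z k) * (1 - Ψ (z j) (z k))) =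
      quadForm ginibre z a - quadForm K z a := by
    simp only [quadForm, ← Finset.sum_sub_distrib]
    refine Finset.sum_congr rfl fun j _ => Finset.sum_congr rfl fun k _ => ?_
    rw [hKΨ]; ring
  have hle := quadForm_le_ginibre (K := K)
    (L := fun w z => Complex.exp (w * conj z) * Complex.exp (-(‖z‖ : ℂ) ^ 2 / 2) * Ψ w z)
    (fun z => ((by fun_prop : Differentiable ℂ fun w : ℂ =>
      Complex.exp (w * conj z) * Complex.exp (-(‖z‖ : ℂ) ^ 2 / 2)).mul (differentiable_left hΨ z)))
    (fun z w => by rw [hKΨ, ginibre_eq]; ring) z a (hmass N z a).1 (hmass N z a).2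
  rw [hsub, Complex.nonneg_iff]
  refine ⟨by simpa using hle, ?_⟩
  rw [Complex.sub_im, quadForm_im_eq_zero (fun z w => (ginibre_conj w z).symm),
    quadForm_im_eq_zero (hermitian_of_eq_ginibre_mul hΨ hKΨ), sub_zero]

lemma onePoint_le_one (hΨ : IsHermitianEntire Ψ) (hKΨ : ∀ z w, K z w = ginibre z w * Ψ z w)
    (h : IsPositiveMatrix fun z w => ginibre z w * (1 - Ψ z w)) (z : ℂ) : onePoint K z ≤ 1 := by
  have h1 := h 1 (fun _ => z) fun _ => 1
  simp only [Fin.sum_univ_one, map_one, mul_one, one_mul, ginibre_self,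
    ← ofReal_onePoint_eq hΨ hKΨ z] at h1
  have h2 : (0 : ℝ) ≤ 1 - onePoint K z := by exact_mod_cast h1
  linarith

/-- The mass-one inequality for a single point with coefficient one, divided by the one-point
function. -/
lemma berezin_mass_le_one (hK : ∀ z w, K z w = conj (K w z))
    (hmass : ∀ (N : ℕ) (z a : Fin N → ℂ),
      Integrable (fun w => ‖∑ l, conj (a l) * K w (z l)‖ ^ 2) dA ∧
      ∫ w, ‖∑ l, conj (a l) * K w (z l)‖ ^ 2 ∂dA ≤ (quadForm K z a).re) (z : ℂ)
    (hz : 0 < onePoint K z) : Integrable (berezin K z) dA ∧ ∫ w, berezin K z w ∂dA ≤ 1 := by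
  have h := hmass 1 (fun _ => z) fun _ => 1
  have hsw : ∀ w, ‖K w z‖ = ‖K z w‖ := fun w => by rw [hK, Complex.norm_conj]
  simp only [quadForm, Fin.sum_univ_one, map_one, mul_one, one_mul, hsw] at h
  refine ⟨h.1.div_const _, ?_⟩
  simp only [berezin]
  rw [integral_div, div_le_one hz]
  exact h.2

end GinibreType

/-! ### Limiting kernels as limits of orthonormal systems -/

section LimitingKernel

variable {Q : ℂ → EReal} {p : ℕ → ℂ} {θ : ℕ → ℝ} {K Ψ : ℂ → ℂ → ℂ}

lemma orthoSystem_rescaled (hQ : IsPotential Q) {U : Set ℂ} (hU : IsOpen U)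
    (hUQ : ∀ ζ ∈ U, Q ζ ≠ ⊤) {n : ℕ} (hn : 0 < n) {a : ℂ} (haU : a ∈ U)
    (ha : 0 < lap (fun ζ => (Q ζ).toReal) a) (t : ℝ) :
    OrthoSystem n (rescaledWeight Q n a t) (rescaledPoly Q n a t) :=
  (orthoSystem_orthoPoly hQ hU ⟨a, haU⟩ hUQ n).affine a (scale_ne_zero Q hn a t ha)

lemma weightedKernel_self {n : ℕ} {W : ℂ → ℝ} {f : ℕ → ℂ[X]} (S : OrthoSystem n W f) (z : ℂ) :
    weightedKernel n f W z z = (density n f W z : ℂ) := by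
  rw [weightedKernel, density, mul_assoc, ← Complex.ofReal_mul, Real.mul_self_sqrt (S.nonneg z),
    Complex.ofReal_mul, polyKernel_self_re]

lemma tendsto_scale {N : ℕ → ℕ} (hN : Tendsto N atTop atTop) {b : ℕ → ℂ} {t : ℕ → ℝ} {a : ℂ}
    (hb : ∀ k, 0 < lap (fun ζ => (Q ζ).toReal) (b k)) (ha : 0 < lap (fun ζ => (Q ζ).toReal) a)
    (hlim : Tendsto (fun k => lap (fun ζ => (Q ζ).toReal) (b k)) atTop
      (𝓝 (lap (fun ζ => (Q ζ).toReal) a))) :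
    Tendsto (fun k => scale Q (N k) (b k) (t k)) atTop (𝓝 0) := by
  have h1 : Tendsto (fun k => ‖scale Q (N k) (b k) (t k)‖ ^ 2) atTop (𝓝 0) := by
    simp_rw [fun k => norm_scale_sq Q (N k) (b k) (t k) (hb k)]
    exact ((tendsto_natCast_atTop_atTop.comp hN).atTop_mul_pos ha hlim).inv_tendsto_atTop
  rw [tendsto_zero_iff_norm_tendsto_zero]
  have h2 := (Real.continuous_sqrt.tendsto 0).comp h1
  rw [Real.sqrt_zero] at h2
  refine h2.congr fun k => ?_
  exact Real.sqrt_sq (norm_nonneg _)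

/-- A limiting kernel is a limit of orthonormal systems, and its complement is a positive matrix. -/
lemma IsLimitPoint.exists_isLimitSystem (hQ : IsPotential Q) {S : Set ℂ} (hS : IsCompact S)
    (hreg : IsRegularNear Q S) (hp : ∀ n, p n ∈ S) (hK : IsLimitPoint Q p θ K)
    (hΨ : IsHermitianEntire Ψ) (hKΨ : ∀ z w, K z w = ginibre z w * Ψ z w) :
    (IsPositiveMatrix fun z w => ginibre z w * (1 - Ψ z w)) ∧
      ∃ n W f V ℓ, IsLimitSystem n W f V ℓ K := by
  have hKc := continuous_of_eq_ginibre_mul hΨ hKΨ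
  have hKh := hermitian_of_eq_ginibre_mul hΨ hKΨ
  obtain ⟨U, hU, hSU, hUQ, hUa, hUl⟩ := hreg
  obtain ⟨N, hN0, hN, ⟨a, haS, hpa⟩, c, hc, hlim⟩ := hK.exists_subseq hS hp hKc
  set q : ℂ → ℝ := fun ζ => (Q ζ).toReal with hq
  have hpU : ∀ k, p (N k) ∈ U := fun k => hSU (hp _)
  have hpl : ∀ k, 0 < lap q (p (N k)) := fun k => hUl _ (hpU k)
  set W : ℕ → ℂ → ℝ := fun k => rescaledWeight Q (N k) (p (N k)) (θ (N k)) with hW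
  set f : ℕ → ℕ → ℂ[X] := fun k => rescaledPoly Q (N k) (p (N k)) (θ (N k)) with hf
  have hsys : ∀ k, OrthoSystem (N k) (W k) (f k) := fun k =>
    orthoSystem_rescaled hQ hU hUQ (hN0 k) (hpU k) (hpl k) _
  have hlim' : ∀ x : ℂ × ℂ, Tendsto (fun y : ℕ × (ℂ × ℂ) => c y.1 y.2.1 y.2.2 *
      weightedKernel (N y.1) (f y.1) (W y.1) y.2.1 y.2.2) (atTop ×ˢ 𝓝 x) (𝓝 (K x.1 x.2)) :=
    fun x => (hlim x).congr fun y => by rw [rescaledKernel_eq Q _ _ _ (hpl y.1)]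
  have hmass : ∀ (N : ℕ) (z a : Fin N → ℂ),
      Integrable (fun w => ‖∑ l, conj (a l) * K w (z l)‖ ^ 2) dA ∧
      ∫ w, ‖∑ l, conj (a l) * K w (z l)‖ ^ 2 ∂dA ≤ (quadForm K z a).re := by
    intro _ z a
    refine integrable_combination_of_tendsto hsys (u := fun k z => c k z 0)
      (fun k z => (hc k).norm_eq_one z 0) (fun z w => ?_) (fun z => ?_) z a
    · have h := Tendsto.pointwise_of_continuous_convergence
        (F := fun k (x : ℂ × ℂ) => c k x.1 x.2 * weightedKernel (N k) (f k) (W k) x.1 x.2) (hlim' (z, w))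
      refine h.congr fun k => ?_
      simp only
      rw [(hc k).eq_mul_conj z w]
    · exact hKc.comp (by fun_prop : Continuous fun w : ℂ => (w, z))
  have hcompl := isPositiveMatrix_compl hΨ hKΨ hmass
  have hqa : ∀ ζ ∈ U, ContDiffAt ℝ 2 q ζ := fun ζ hζ => (hUa ζ hζ).contDiffAt
  have haU := hSU haS
  have hll : Tendsto (fun k => lap q (p (N k))) atTop (𝓝 (lap q a)) :=
    (continuousAt_lap (hqa a haU)).tendsto.comp hpa
  set s : ℕ → ℂ := fun k => scale Q (N k) (p (N k)) (θ (N k)) with hs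
  have hs0 : Tendsto s atTop (𝓝 0) := tendsto_scale hN hpl (hUl a haU) hll
  obtain ⟨ℓ, hℓ, hpot⟩ := exists_potential_expansion (hqa a haU) (hUl a haU)
    (t := fun k => (N k : ℝ)) hpa hs0 fun k => by
      have h0 : (0 : ℝ) < N k := by exact_mod_cast hN0 k
      have := hpl k
      rw [hs, norm_scale_sq Q _ _ _ (hpl k), ← hq]
      field_simp
  refine ⟨hcompl, N, W, f, fun k z => N k * q (p (N k) + s k * z), ℓ, hsys, hN0, fun x => ?_,
    fun z => ?_, hKc, onePoint_le_one hΨ hKΨ hcompl, berezin_mass_le_one hKh hmass, fun ρ => ?_,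
    hℓ, hpot⟩
  · refine (hlim' x).norm.congr fun y => ?_
    rw [norm_mul, (hc y.1).norm_eq_one, one_mul]
  · have h1 : Tendsto (fun y : ℕ × ℂ => (y.1, (y.2, y.2))) (atTop ×ˢ 𝓝 z) (atTop ×ˢ 𝓝 (z, z)) :=
      tendsto_fst.prodMk (tendsto_snd.prodMk_nhds tendsto_snd)
    refine ((Complex.continuous_re.tendsto _).comp ((hlim' (z, z)).comp h1)).congr fun y => ?_
    simp only [Function.comp_apply]
    rw [(hc y.1).self, one_mul, weightedKernel_self (hsys y.1), Complex.ofReal_re]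
  -- The scale tends to zero, so any fixed microscopic disc is eventually mapped into the
  -- neighbourhood where `Q` is finite and smooth.
  · obtain ⟨r, hr, hrU⟩ := Metric.isOpen_iff.1 hU a haU
    have hev1 : ∀ᶠ k in atTop, dist (p (N k)) a < r / 2 :=
      hpa.eventually (Metric.ball_mem_nhds a (half_pos hr))
    have hev2 : ∀ᶠ k in atTop, ‖s k‖ * |ρ| < r / 2 := by
      have : Tendsto (fun k => ‖s k‖ * |ρ|) atTop (𝓝 0) := by
        simpa using hs0.norm.mul_const |ρ|
      exact this.eventually (gt_mem_nhds (half_pos hr))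
    filter_upwards [hev1, hev2] with k h1 h2
    have hmem : ∀ z ∈ Metric.ball (0 : ℂ) ρ, p (N k) + s k * z ∈ U := by
      intro z hz
      refine hrU ?_
      rw [mem_ball_zero_iff] at hz
      rw [Metric.mem_ball]
      have h3 : dist (p (N k) + s k * z) (p (N k)) ≤ ‖s k‖ * |ρ| := by
        rw [dist_self_add_left, norm_mul]
        exact mul_le_mul_of_nonneg_left (hz.le.trans (le_abs_self ρ)) (norm_nonneg _)
      linarith [dist_triangle (p (N k) + s k * z) (p (N k)) a]
    refine ⟨fun z hz => ContDiffAt.contDiffWithinAt ?_, fun z hz => ?_⟩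
    · refine contDiffAt_const.mul ?_
      exact ((hqa _ (hmem z hz)).of_le (by norm_num)).comp z
        (by fun_prop : ContDiff ℝ 1 fun x : ℂ => p (N k) + s k * x).contDiffAt
    · exact if_neg (hUQ _ (hmem z hz))

/-! ### The zero-one law -/

/-- Cauchy–Schwarz makes the one-point function positive wherever the entire function
$\Psi(\cdot,b)$ is nonzero. Its zeros are isolated because $\Psi(b,b)\ne0$, so every point is the
centre of a small circle of positivity. -/
lemma IsLimitSystem.zero_one_law {n : ℕ → ℕ} {W : ℕ → ℂ → ℝ} {f : ℕ → ℕ → ℂ[X]}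
    {V : ℕ → ℂ → ℝ} {ℓ : ℕ → ℂ → ℂ} (H : IsLimitSystem n W f V ℓ K)
    (hΨ : IsHermitianEntire Ψ) (hKΨ : ∀ z w, K z w = ginibre z w * Ψ z w)
    {b : ℂ} (hb : onePoint K b ≠ 0) (z : ℂ) : 0 < onePoint K z := by
  have hpos : ∀ w, Ψ w b ≠ 0 → 0 < onePoint K w := by
    intro w hw
    have hK0 : K w b ≠ 0 := by
      rw [hKΨ]
      exact mul_ne_zero (Complex.exp_ne_zero _) hw
    have h1 := H.norm_sq_le w b
    have h2 : 0 < ‖K w b‖ ^ 2 := by positivity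
    have h3 := H.onePoint_nonneg w
    refine lt_of_le_of_ne h3 fun h => ?_
    rw [← h, zero_mul] at h1
    linarith
  have han : AnalyticOnNhd ℂ (fun w => Ψ w b) Set.univ := fun w _ =>
    (differentiable_left hΨ b).analyticAt w
  have hne : ∀ᶠ w in 𝓝[≠] z, Ψ w b ≠ 0 := by
    rcases (han z (Set.mem_univ z)).eventually_eq_zero_or_eventually_ne_zero with h | h
    · exfalso
      have h0 := han.eqOn_zero_of_preconnected_of_eventuallyEq_zero isPreconnected_univ
        (Set.mem_univ z) h (Set.mem_univ b)
      simp only [Pi.zero_apply] at h0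
      have := ofReal_onePoint_eq hΨ hKΨ b
      rw [h0] at this
      exact hb (by exact_mod_cast this)
    · exact h
  obtain ⟨ε, hε, hball⟩ := Metric.mem_nhdsWithin_iff.1 hne
  have hr : 0 < min (ε / 2) (1 / 3) := by positivity
  refine H.onePoint_pos_of_sphere hr (by
    exact (min_le_right _ _).trans_lt (by norm_num)) fun w hw => hpos w (hball ⟨?_, ?_⟩)
  · rw [Metric.mem_ball, Metric.mem_sphere.1 hw]
    exact (min_le_left _ _).trans_lt (half_lt_self hε)
  · exact Metric.ne_of_mem_sphere hw hr.ne'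

end LimitingKernel

end RNM

/-! ### Assembly of the zero-one law, Ward's equation and complementarity. -/

theorem theorem1p2 (Q : ℂ → EReal) (hQ : RNM.IsPotential Q)
    (σ : Measure ℂ) (hσ : RNM.IsEquilibriumMeasure Q σ)
    (hreg : RNM.IsRegularNear Q σ.support)
    (p : ℕ → ℂ) (hp : ∀ n, p n ∈ σ.support) (θ : ℕ → ℝ)
    (K Ψ : ℂ → ℂ → ℂ) (hK : RNM.IsLimitPoint Q p θ K)
    (hΨ : RNM.IsHermitianEntire Ψ) (hKΨ : ∀ z w, K z w = RNM.ginibre z w * Ψ z w) :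
    ((∀ z, RNM.onePoint K z = 0) ∨ (∀ z, 0 < RNM.onePoint K z)) ∧
    ((∃ z, RNM.onePoint K z ≠ 0) →
      (∀ z, Integrable (fun w => (RNM.berezin K z w : ℂ) / (z - w)) RNM.dA) ∧
      ContDiff ℝ ∞ (RNM.cauchyTransform K) ∧
      ∀ z, RNM.dbar (RNM.cauchyTransform K) z =
        ((RNM.onePoint K z - 1 - RNM.lap (fun u => Real.log (RNM.onePoint K u)) z : ℝ) : ℂ)) ∧
    (RNM.IsPositiveMatrix (fun z w => RNM.ginibre z w * (1 - Ψ z w)) ∧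
      ∀ z, (RNM.onePoint K z : ℂ) = Ψ z z ∧ RNM.onePoint K z ≤ 1) := by
  obtain ⟨hcompl, n, W, f, V, ℓ, H⟩ :=
    hK.exists_isLimitSystem hQ (RNM.isCompact_support hσ.1) hreg hp hΨ hKΨ
  refine ⟨?_, ?_, hcompl, fun z => ⟨RNM.ofReal_onePoint_eq hΨ hKΨ z, H.le_one z⟩⟩
  · by_cases h : ∀ z, RNM.onePoint K z = 0
    · exact Or.inl h
    · obtain ⟨b, hb⟩ := not_forall.1 h
      exact Or.inr (H.zero_one_law hΨ hKΨ hb)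
  · rintro ⟨b, hb⟩
    have hpos := H.zero_one_law hΨ hKΨ hb
    have hsm : ContDiff ℝ ∞ (RNM.onePoint K) := by
      rw [funext (RNM.onePoint_eq_re hKΨ)]
      exact RNM.contDiff_diagonal hΨ
    have hward := H.ward_equation hpos hsm
    refine ⟨fun z => ?_, contDiff_iff_contDiffAt.2 fun z => (hward z).1, fun z => (hward z).2⟩
    refine RNM.integrable_div_cauchy (r := 1) (M := 1) one_pos (fun w _ => ?_)
      (H.mass z (hpos z)).1.ofReal
    have h0 : 0 ≤ RNM.berezin K z w := div_nonneg (sq_nonneg _) (hpos z).le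
    rw [Complex.norm_real, Real.norm_of_nonneg h0]
    exact H.berezin_le (hpos z) w
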